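/- Let $\Omega\subset\mathbb R^2$ be open. Let $\mathcal S(\Omega)$ be the space of real functions on $\Omega$ whose extension by $0$ is a Schwartz function on $\mathbb R^2$ (with the topology of $\mathcal S(\mathbb R^2)$), and let $f\in\mathcal S'(\Omega)$ be a real-valued tempered distribution on $\Omega$. Let $\kappa>0$ and let $\phi_\kappa\in\mathcal S(\mathbb R^2)$ satisfy $\phi_\kappa\ge 0$, $\int\phi_\kappa=1$ and $\operatorname{supp}\phi_\kappa\subset B_\kappa(0)$ with compact support. **Notation.** For a distribution $u$ on $\Omega$ and $N\in\mathbb N$, a point $(x,\xi)\in\Omega\times\mathbb S^1$ is *$N$-regular* for $u$ if there are an open conical neighbourhood $V$ of $\xi$, a cut-off $\psi\in C_c^\infty(\Omega)$ with $\psi(x)=1$, and $C>0$ with $|\widehat{\psi u}(\eta)|\le C(1+|\eta|)^{-N}$ for all $\eta\in V$; $\mathrm{WF}(u)\subset\Omega\times\mathbb S^1$ is the set of points that fail to be $N$-regular for some $N$. The singular support $\operatorname{sing\,supp}(u)$ is the set of $x\in\Omega$ near which $u$ is not a $C^\infty$ function. A distribution $w$ on $\Omega$ is the *product* of distributions $u,v$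 on $\Omega$ if for every $x\in\Omega$ there are cut-offs $\psi\in C_c^\infty(\Omega)$ of arbitrarily small support around $x$, equal to $1$ near $x$, such that for all $\xi$ the integral $\int\widehat{\psi u}(\eta)\,\widehat{\psi v}(\xi-\eta)\,d\eta$ converges absolutely and equals $\widehat{\psi^2w}(\xi)$ (with $\hat h(\xi)=\int h(x)e^{-2\pi i x\cdot\xi}dx$). The positive support $\operatorname{supp}_+(f)$ is the closure of the union of all open $U\subset\Omega$ such that $f(\phi)>0$ for every $0\ne\phi\in\mathcal S(\Omega)$ with $\phi\ge0$ and $\operatorname{supp}\phi\subset U$. Put $H(f)=\mathbb 1_{\operatorname{supp}_+(f)}$. The $L^2$-support $\operatorname{supp}_{L^2}(f)$ is the union of all open $U\subset\Omega$ such that $f|_U$ is given by a function in $L^2(U)$. Let $$X_0=\{x\in\mathbb R^2\setminus\operatorname{supp}_{L^2}(f):\ (x,\lambda)\in\mathrm{WF}(H(f))\text{ and }(x,-\lambda)\in\mathrm{WF}(f)\text{ for some }\lambda\in\mathbb S^1\},$$ $X=X_0+B_\kappa(0)$, $X^{3\kappa}=X_0+B_{3\kappa}(0)$, $\theta_\kappa=\mathbb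 1_X*\phi_\kappa$ and $f^s=(1-\theta_\kappa)f$. Define $\mathrm{ReLU}_{\kappa,\phi_\kappa}(f)$ to be the product $H(f)\,f^s$. Finally let $$R_f=\{x\in\Omega\cap\partial\operatorname{supp}_+(f): x\notin\operatorname{sing\,supp}(f),\ \nabla f(x)\ne0\},$$ $$C_f=\{x\in\Omega\cap\partial\operatorname{supp}_+(f): x\notin\operatorname{sing\,supp}(f),\ \nabla f(x)=0\},$$ $$S_f=\{x\in\Omega\cap\partial\operatorname{supp}_+(f): x\in\operatorname{sing\,supp}(f)\},$$ $$\mathcal A_f=\mathrm{WF}(f)\cap\big(\operatorname{int}(\operatorname{supp}_+(f))\times\mathbb S^1\big),\qquad \mathcal R_f=\{(x,\pm\nabla f(x)/|\nabla f(x)|): x\in R_f\},$$ $$\mathcal{CS}_f=\mathrm{WF}(\mathrm{ReLU}_{\kappa,\phi_\kappa}(f))\cap\big((S_f\cup C_f)\times\mathbb S^1\big).$$ **Theorem.** There is exactly one distribution on $\Omega$ that is the product of $H(f)$ and $f^s$, so $\mathrm{ReLU}_{\kappa,\phi_\kappa}(f)$ is well defined, and $$\mathrm{WF}(\mathrm{ReLU}_{\kappa,\phi_\kappa}(f))\cap(X^{3\kappa}\times\mathbb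 S^1)^c=(\mathcal A_f\cup\mathcal R_f\cup\mathcal{CS}_f)\cap(X^{3\kappa}\times\mathbb S^1)^c,$$ $$\mathrm{WF}(\mathrm{ReLU}_{\kappa,\phi_\kappa}(f))\cap(X^{3\kappa}\times\mathbb S^1)\subset(\mathcal A_f\cup\mathcal R_f\cup\mathcal{CS}_f)\cap(X^{3\kappa}\times\mathbb S^1).$$ In particular, $$\mathrm{WF}(\mathrm{ReLU}_{\kappa,\phi_\kappa}(f))\subset\mathcal A_f\cup\mathcal R_f\cup\big((C_f\cup S_f)\times\mathbb S^1\big).$$ -/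

import Mathlib

open MeasureTheory TopologicalSpace
open scoped Distributions SchwartzMap Pointwise ContDiff Convolution

namespace MicroReLU

/-- The Euclidean plane `ℝ²`. -/
abbrev Plane := EuclideanSpace ℝ (Fin 2)

/-! ### Tempered distributions on an open set -/

/-- `𝓢(Ω)`: the real Schwartz functions on `ℝ²` that vanish outside `Ω`, that is, the functions
on `Ω` whose extension by zero is a Schwartz function. -/
def schwartzOn (Ω : Opens Plane) : Submodule ℝ 𝓢(Plane, ℝ) where
  carrier := {φ | ∀ x, x ∉ Ω → φ x = 0}
  add_mem' := by
    intro a b ha hb x hx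
    simp [ha x hx, hb x hx]
  zero_mem' := by
    intro x _
    simp
  smul_mem' := by
    intro c a ha x hx
    simp [ha x hx]

/-- `𝓢'(Ω)`: real-valued tempered distributions on `Ω`. -/
abbrev TemperedOn (Ω : Opens Plane) := schwartzOn Ω →L[ℝ] ℝ

lemma contDiff_mul_testFunction {Ω : Opens Plane} {g : Plane → ℝ} (hg : ContDiff ℝ ∞ g)
    (φ : 𝓓(Ω, ℝ)) : ContDiff ℝ ∞ (fun x => g x * φ x) :=
  hg.mul φ.contDiff

/-- The product `g φ` of a smooth function and a test function, continuous and linear in `φ`. -/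
noncomputable def mulTest {Ω : Opens Plane} (g : Plane → ℝ) (hg : ContDiff ℝ ∞ g) :
    𝓓(Ω, ℝ) →L[ℝ] 𝓓(Ω, ℝ) :=
  TestFunction.limitCLM ℝ
    (fun φ => ⟨fun x => g x * φ x, contDiff_mul_testFunction hg φ,
      φ.hasCompactSupport.mul_left,
      (closure_mono (Function.support_mul_subset_right g φ)).trans φ.tsupport_subset⟩)
    (fun _ hK => TestFunction.ofSupportedInCLM ℝ hK ∘L
      ContDiffMapSupportedIn.bilinLeftCLM (ContinuousLinearMap.mul ℝ ℝ) hg)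
    (fun K hK φ => by
      ext x
      simp [mul_comm])

@[simp] lemma mulTest_apply {Ω : Opens Plane} (g : Plane → ℝ) (hg : ContDiff ℝ ∞ g)
    (φ : 𝓓(Ω, ℝ)) (x : Plane) : mulTest g hg φ x = g x * φ x := rfl

/-- A test function on `Ω`, seen as an element of `𝓢(Ω)`. -/
noncomputable def testToSchwartz {Ω : Opens Plane} (φ : 𝓓(Ω, ℝ)) : schwartzOn Ω :=
  ⟨φ.hasCompactSupport.toSchwartzMap φ.contDiff, fun x hx => by
    change φ x = 0
    exact image_eq_zero_of_notMem_tsupport fun h => hx (φ.tsupport_subset h)⟩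

@[simp] lemma testToSchwartz_apply {Ω : Opens Plane} (φ : 𝓓(Ω, ℝ)) (x : Plane) :
    (testToSchwartz φ : 𝓢(Plane, ℝ)) x = φ x := rfl

/-- The inclusion of test functions into `𝓢(Ω)` as a linear map. -/
noncomputable def testToSchwartzLM (Ω : Opens Plane) : 𝓓(Ω, ℝ) →ₗ[ℝ] schwartzOn Ω where
  toFun := testToSchwartz
  map_add' _ _ := by
    ext
    rfl
  map_smul' _ _ := by
    ext
    rfl

lemma continuous_testToSchwartzLM (Ω : Opens Plane) : Continuous (testToSchwartzLM Ω) := by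
  rw [TestFunction.continuous_iff_continuous_comp]
  intro K hK
  rw [continuous_induced_rng]
  let L : 𝓓^{⊤}_{K}(Plane, ℝ) →ₗ[ℝ] 𝓢(Plane, ℝ) :=
    { toFun := fun φ => (testToSchwartz (TestFunction.ofSupportedIn hK φ) : 𝓢(Plane, ℝ))
      map_add' := by
        intro a b
        ext
        rfl
      map_smul' := by
        intro c a
        ext
        rfl }
  change Continuous L
  refine WithSeminorms.continuous_of_isBounded
    (ContDiffMapSupportedIn.withSeminorms ℝ Plane ℝ ⊤ K) (schwartz_withSeminorms ℝ Plane ℝ) L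
    (Seminorm.IsBounded.of_real fun kn => ?_)
  obtain ⟨k, n⟩ := kn
  obtain ⟨R, hR⟩ := K.isCompact.isBounded.exists_norm_le
  refine ⟨{n}, |R| ^ k, fun φ => ?_⟩
  refine SchwartzMap.seminorm_le_bound ℝ k n _ (by positivity) fun x => ?_
  change ‖x‖ ^ k * ‖iteratedFDeriv ℝ n φ x‖ ≤ _
  by_cases hx : x ∈ K
  · have h1 : ‖x‖ ≤ |R| := (hR x hx).trans (le_abs_self R)
    rw [Finset.sup_singleton]
    gcongr
    exact ContDiffMapSupportedIn.norm_iteratedFDeriv_apply_le_seminorm_top ℝ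
  · have h0 : iteratedFDeriv ℝ n φ x = 0 :=
      φ.iteratedFDeriv_zero_on_compl hx
    rw [h0, norm_zero, mul_zero]
    positivity

/-- The distribution on `Ω` defined by a tempered distribution on `Ω`, by restriction to test
functions. -/
noncomputable def TemperedOn.toDistribution {Ω : Opens Plane} (f : TemperedOn Ω) : 𝓓'(Ω, ℝ) where
  toFun φ := f (testToSchwartz φ)
  map_add' a b := (f.toLinearMap ∘ₗ testToSchwartzLM Ω).map_add a b
  map_smul' c a := (f.toLinearMap ∘ₗ testToSchwartzLM Ω).map_smul c a
  cont := f.continuous.comp (continuous_testToSchwartzLM Ω)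

/-- The product `g T` of a smooth function and a distribution. -/
noncomputable def smulDistribution {Ω : Opens Plane} (g : Plane → ℝ) (hg : ContDiff ℝ ∞ g)
    (T : 𝓓'(Ω, ℝ)) : 𝓓'(Ω, ℝ) where
  toFun φ := T (mulTest g hg φ)
  map_add' a b := by simp
  map_smul' c a := by simp
  cont := (map_continuous T).comp (mulTest g hg).continuous

/-! ### Wavefront set and singular support -/

lemma contDiff_cosWave (η : Plane) :
    ContDiff ℝ ∞ (fun x : Plane => Real.cos (2 * Real.pi * inner ℝ x η)) :=
  Real.contDiff_cos.comp (contDiff_const.mul (contDiff_id.inner ℝ contDiff_const))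

lemma contDiff_sinWave (η : Plane) :
    ContDiff ℝ ∞ (fun x : Plane => Real.sin (2 * Real.pi * inner ℝ x η)) :=
  Real.contDiff_sin.comp (contDiff_const.mul (contDiff_id.inner ℝ contDiff_const))

/-- The Fourier transform of the compactly supported distribution `ψ T`, that is,
`η ↦ ⟨T, ψ e^{-2πi⟨·,η⟩}⟩`. -/
noncomputable def localFourier {Ω : Opens Plane} (T : 𝓓'(Ω, ℝ)) (ψ : 𝓓(Ω, ℝ)) (η : Plane) : ℂ :=
  (T (mulTest _ (contDiff_cosWave η) ψ) : ℂ) - Complex.I * (T (mulTest _ (contDiff_sinWave η) ψ) : ℂ)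

/-- `(x, ξ)` is an `N`-regular directed point of `T`. -/
def IsRegularDirectedPoint {Ω : Opens Plane} (T : 𝓓'(Ω, ℝ)) (N : ℕ) (x ξ : Plane) : Prop :=
  ∃ U : Set Plane, IsOpen U ∧ x ∈ U ∧
    ∃ V : Set Plane, IsOpen V ∧ ξ ∈ V ∧ (∀ t : ℝ, 0 < t → ∀ η ∈ V, t • η ∈ V) ∧
      ∃ ψ : 𝓓(Ω, ℝ), tsupport ψ ⊆ U ∧ ψ x = 1 ∧
        ∃ C : ℝ, 0 < C ∧ ∀ η ∈ V, ‖localFourier T ψ η‖ ≤ C / (1 + ‖η‖) ^ N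

/-- The `N`-wavefront set, a subset of `Ω × 𝕊¹`. -/
def wavefrontSetN {Ω : Opens Plane} (T : 𝓓'(Ω, ℝ)) (N : ℕ) : Set (Plane × Plane) :=
  {p | p.1 ∈ Ω ∧ p.2 ∈ Metric.sphere (0 : Plane) 1 ∧ ¬ IsRegularDirectedPoint T N p.1 p.2}

/-- The wavefront set, a subset of `Ω × 𝕊¹`. -/
def WF {Ω : Opens Plane} (T : 𝓓'(Ω, ℝ)) : Set (Plane × Plane) := ⋃ N : ℕ, wavefrontSetN T N

/-- On the open set `U ⊆ Ω` the distribution `T` is the smooth function `g`. -/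
def IsSmoothOn {Ω : Opens Plane} (T : 𝓓'(Ω, ℝ)) (U : Set Plane) (g : Plane → ℝ) : Prop :=
  IsOpen U ∧ U ⊆ Ω ∧ ContDiffOn ℝ ∞ g U ∧
    ∀ φ : 𝓓(Ω, ℝ), tsupport φ ⊆ U → T φ = ∫ y in U, g y * φ y

/-- The singular support of `T`, a subset of `Ω`. -/
def singSupp {Ω : Opens Plane} (T : 𝓓'(Ω, ℝ)) : Set Plane :=
  {x | x ∈ Ω ∧ ¬ ∃ U g, IsSmoothOn T U g ∧ x ∈ U}

/-- `T` is a smooth function near `x`, and `v` is the gradient of this function at `x`. -/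
def HasGradAt {Ω : Opens Plane} (T : 𝓓'(Ω, ℝ)) (x v : Plane) : Prop :=
  ∃ U g, IsSmoothOn T U g ∧ x ∈ U ∧ gradient g x = v

/-! ### Positive support, Heaviside operator, `L²`-support -/

/-- The positive support `supp₊(f)`. -/
def posSupp {Ω : Opens Plane} (f : TemperedOn Ω) : Set Plane :=
  closure (⋃₀ {U : Set Plane | IsOpen U ∧ U ⊆ Ω ∧
    ∀ φ : schwartzOn Ω, φ ≠ 0 → tsupport (φ : 𝓢(Plane, ℝ)) ⊆ U →
      (∀ x, 0 ≤ (φ : 𝓢(Plane, ℝ)) x) → 0 < f φ})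

/-- `H(f)`, the characteristic function of `supp₊(f)`, as a distribution on `Ω`. -/
noncomputable def heaviside {Ω : Opens Plane} (f : TemperedOn Ω) : 𝓓'(Ω, ℝ) where
  toFun := TestFunction.integralAgainstBilinCLM (ContinuousLinearMap.mul ℝ ℝ) volume
    ((posSupp f).indicator fun _ => (1 : ℝ))
  map_add' a b := map_add _ a b
  map_smul' c a := map_smul _ c a
  cont := ContinuousLinearMap.continuous _

lemma heaviside_apply {Ω : Opens Plane} (f : TemperedOn Ω) (φ : 𝓓(Ω, ℝ)) :
    heaviside f φ = ∫ x in posSupp f, φ x := by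
  have hm : MeasurableSet (posSupp f) := isClosed_closure.measurableSet
  have hl : LocallyIntegrableOn ((posSupp f).indicator fun _ => (1 : ℝ)) Ω volume :=
    ((locallyIntegrable_const (1 : ℝ)).indicator hm).locallyIntegrableOn _
  change TestFunction.integralAgainstBilinCLM (ContinuousLinearMap.mul ℝ ℝ) volume
    ((posSupp f).indicator fun _ => (1 : ℝ)) φ = _
  rw [TestFunction.integralAgainstBilinCLM_eq_integral hl, ← integral_indicator hm]
  congr 1
  ext x
  by_cases hx : x ∈ posSupp f <;> simp [hx]

/-- The `L²`-support of `f`: the union of the open `U ⊆ Ω` on which `f` is an `L²` function. -/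
def l2Supp {Ω : Opens Plane} (f : TemperedOn Ω) : Set Plane :=
  ⋃₀ {U : Set Plane | IsOpen U ∧ U ⊆ Ω ∧ ∃ g : Plane → ℝ, MemLp g 2 (volume.restrict U) ∧
    ∀ φ : schwartzOn Ω, (∀ y, y ∉ U → (φ : 𝓢(Plane, ℝ)) y = 0) →
      f φ = ∫ y in U, g y * (φ : 𝓢(Plane, ℝ)) y}

/-! ### The distributional ReLU -/

/-- The points outside the `L²`-support at which `H(f)` and `f` have opposite singular
directions. -/
def conflictSet {Ω : Opens Plane} (f : TemperedOn Ω) : Set Plane :=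
  {x | x ∉ l2Supp f ∧ ∃ ξ, (x, ξ) ∈ WF (heaviside f) ∧ (x, -ξ) ∈ WF f.toDistribution}

/-- The neighbourhood `conflictSet f + B_r(0)`. -/
def exceptionalSet {Ω : Opens Plane} (f : TemperedOn Ω) (r : ℝ) : Set Plane :=
  conflictSet f + Metric.ball (0 : Plane) r

/-- A nonnegative Schwartz function of integral one, whose support is a compact subset of
`B_κ(0)`. -/
structure Mollifier (κ : ℝ) where
  /-- the function -/
  fn : 𝓢(Plane, ℝ)
  nonneg : ∀ x, 0 ≤ fn x
  integral_eq_one : ∫ x, fn x = 1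
  tsupport_subset : tsupport fn ⊆ Metric.ball (0 : Plane) κ

/-- The cut-off `θ = 𝟙_X * φ` with `X = conflictSet f + B_κ(0)`. -/
noncomputable def theta {Ω : Opens Plane} (f : TemperedOn Ω) {κ : ℝ} (φ : Mollifier κ) :
    Plane → ℝ :=
  ((exceptionalSet f κ).indicator fun _ => (1 : ℝ)) ⋆[ContinuousLinearMap.mul ℝ ℝ, volume] φ.fn

lemma contDiff_one_sub_theta {Ω : Opens Plane} (f : TemperedOn Ω) {κ : ℝ} (φ : Mollifier κ) :
    ContDiff ℝ ∞ (fun x => 1 - theta f φ x) := by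
  have hm : MeasurableSet (exceptionalSet f κ) := Metric.isOpen_ball.add_left.measurableSet
  have hc : HasCompactSupport φ.fn :=
    (Metric.isBounded_ball.subset φ.tsupport_subset).isCompact_closure.of_isClosed_subset
      (isClosed_tsupport _) subset_closure
  exact contDiff_const.sub (hc.contDiff_convolution_right (n := ⊤) (ContinuousLinearMap.mul ℝ ℝ)
    ((locallyIntegrable_const (1 : ℝ)).indicator hm) (φ.fn.smooth ⊤))

/-- The damped distribution `f^s = (1 - θ) f`. -/
noncomputable def damped {Ω : Opens Plane} (f : TemperedOn Ω) {κ : ℝ} (φ : Mollifier κ) :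
    𝓓'(Ω, ℝ) :=
  smulDistribution (fun x => 1 - theta f φ x) (contDiff_one_sub_theta f φ) f.toDistribution

/-- `w` is the product of the distributions `u` and `v`: near every point, for cut-offs `ψ` of
arbitrarily small support, the Fourier transform of `ψ² w` is the absolutely convergent convolution
of the Fourier transforms of `ψ u` and `ψ v`. -/
def IsProduct {Ω : Opens Plane} (u v w : 𝓓'(Ω, ℝ)) : Prop :=
  ∀ x ∈ Ω, ∀ U : Set Plane, IsOpen U → x ∈ U →
    ∃ ψ : 𝓓(Ω, ℝ), tsupport ψ ⊆ U ∧ (∀ᶠ y in nhds x, ψ y = 1) ∧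
      ∀ ξ : Plane,
        Integrable (fun η : Plane => localFourier u ψ η * localFourier v ψ (ξ - η)) ∧
        localFourier w (mulTest ψ ψ.contDiff ψ) ξ =
          ∫ η : Plane, localFourier u ψ η * localFourier v ψ (ξ - η)

open scoped Classical in
/-- `ReLU_{κ,φ}(f) = H(f) f^s`, the product of the distributions `H(f)` and `f^s` (zero if there
is no such product). -/
noncomputable def relu {Ω : Opens Plane} (f : TemperedOn Ω) {κ : ℝ} (φ : Mollifier κ) :
    𝓓'(Ω, ℝ) :=
  if h : ∃ w : 𝓓'(Ω, ℝ), IsProduct (heaviside f) (damped f φ) w then h.choose else 0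

/-! ### The parts of the wavefront set -/

/-- `R_f`: boundary points of `supp₊(f)` near which `f` is smooth, with nonzero gradient. -/
def regularPart {Ω : Opens Plane} (f : TemperedOn Ω) : Set Plane :=
  {x | x ∈ Ω ∧ x ∈ frontier (posSupp f) ∧ x ∉ singSupp f.toDistribution ∧
    ∃ v, HasGradAt f.toDistribution x v ∧ v ≠ 0}

/-- `C_f`: boundary points of `supp₊(f)` near which `f` is smooth, with vanishing gradient. -/
def criticalPart {Ω : Opens Plane} (f : TemperedOn Ω) : Set Plane :=
  {x | x ∈ Ω ∧ x ∈ frontier (posSupp f) ∧ x ∉ singSupp f.toDistribution ∧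
    HasGradAt f.toDistribution x 0}

/-- `S_f`: boundary points of `supp₊(f)` in the singular support of `f`. -/
def singularPart {Ω : Opens Plane} (f : TemperedOn Ω) : Set Plane :=
  {x | x ∈ Ω ∧ x ∈ frontier (posSupp f) ∧ x ∈ singSupp f.toDistribution}

/-- `𝒜_f`. -/
def partA {Ω : Opens Plane} (f : TemperedOn Ω) : Set (Plane × Plane) :=
  WF f.toDistribution ∩ (interior (posSupp f) ×ˢ Metric.sphere (0 : Plane) 1)

/-- `ℛ_f`: the pairs `(x, ±∇f(x)/|∇f(x)|)` with `x ∈ R_f`. -/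
def partR {Ω : Opens Plane} (f : TemperedOn Ω) : Set (Plane × Plane) :=
  {p | p.1 ∈ regularPart f ∧ ∃ v, HasGradAt f.toDistribution p.1 v ∧
    (p.2 = ‖v‖⁻¹ • v ∨ p.2 = -(‖v‖⁻¹ • v))}

/-- `𝒞𝒮_f`: the wavefront set of the ReLU over `S_f ∪ C_f`. -/
def partCS {Ω : Opens Plane} (f : TemperedOn Ω) {κ : ℝ} (φ : Mollifier κ) : Set (Plane × Plane) :=
  {p | p.1 ∈ singularPart f ∪ criticalPart f ∧ p.2 ∈ Metric.sphere (0 : Plane) 1 ∧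
    p ∈ WF (relu f φ)}

end MicroReLU

open MicroReLU

namespace MicroReLU
open scoped FourierTransform

/-! The product exists because near every point of `Ω` the transforms of cut-off pieces of `H(f)`
and `f^s` have an absolutely convergent convolution of polynomial growth (`GoodOn`, established in
`exists_goodOn`). Three mechanisms cover all points. On the `L²`-support both transforms are
square-integrable by Plancherel. Near a conflict point `θ = 1`, so `f^s` vanishes. At any other
point each direction `ξ` is regular for `H(f)`, or `-ξ` is regular for `f`; finitely many cones
cover the circle, and in each of them the decay of one factor beats the growth of the other.

The value of the product on `φ` must then be `pairing φ ψ` with `ψ = 1` on the support of `φ`. A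
smooth factor can be moved from one slot of the pairing to the other (`pairing_mulTest_comm`), so
this value does not depend on `ψ`, and a partition of unity glues the local values to a distribution
(`exists_isLocalProduct`). Conversely every product is given by the pairing near each point
(`IsProduct.locally_eq_pairing`); this yields uniqueness and all local computations of the ReLU.

The wavefront set is read off locally. In the interior of the positive support the product is `(1 -
θ) f`, and multiplication by a smooth function creates no singularities; off `X^{3κ}` it is `f`
itself, because `θ` vanishes nearby. Outside the positive support it is `0`. Near a boundary point
where `f` is a smooth function `G`, the sign of `G` decides membership in the positive support
wherever `G ≠ 0`, so the product is `max (G, 0) (1 - θ)`. For a non-normal direction one integrates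
by parts over `{G > 0}` along the gradient rotated by a right angle: this field is divergence-free
and tangent to the level sets, so there is no boundary term (`oscIntegral_decay`). If a normal
direction were regular as well, the transform would decay to order 4 in all directions and `max (G,
0)` would be differentiable, which is impossible where `G = 0` and `∇G ≠ 0`
(`not_isRegularDirectedPoint_normal`). -/

/-! ### Fourier transforms of real functions -/

/-- The Fourier transform of a real function on the plane. -/
noncomputable def ft (g : Plane → ℝ) : Plane → ℂ := 𝓕 fun x => (g x : ℂ)

/-- A real test function, as a complex Schwartz function. -/
noncomputable def complexSchwartz {g : Plane → ℝ} (hg : ContDiff ℝ ∞ g)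
    (hc : HasCompactSupport g) : 𝓢(Plane, ℂ) :=
  HasCompactSupport.toSchwartzMap (f := fun x => (g x : ℂ))
    (hc.comp_left (g := fun t : ℝ => (t : ℂ)) Complex.ofReal_zero)
    (Complex.ofRealCLM.contDiff.comp hg)

lemma complexSchwartz_apply {g : Plane → ℝ} (hg : ContDiff ℝ ∞ g) (hc : HasCompactSupport g)
    (x : Plane) : complexSchwartz hg hc x = (g x : ℂ) := rfl

lemma ft_eq_schwartz {g : Plane → ℝ} (hg : ContDiff ℝ ∞ g) (hc : HasCompactSupport g) :
    ft g = ⇑(𝓕 (complexSchwartz hg hc) : 𝓢(Plane, ℂ)) := by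
  rw [SchwartzMap.fourier_coe]
  rfl

lemma continuous_ft {g : Plane → ℝ} (hg : ContDiff ℝ ∞ g) (hc : HasCompactSupport g) :
    Continuous (ft g) := by
  rw [ft_eq_schwartz hg hc]
  exact SchwartzMap.continuous _

lemma ft_decay {g : Plane → ℝ} (hg : ContDiff ℝ ∞ g) (hc : HasCompactSupport g) (n : ℕ) :
    ∃ C, 0 ≤ C ∧ ∀ ζ, (1 + ‖ζ‖) ^ n * ‖ft g ζ‖ ≤ C := by
  refine ⟨2 ^ n * ((Finset.Iic (n, 0)).sup fun m => SchwartzMap.seminorm ℝ m.1 m.2)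
    (𝓕 (complexSchwartz hg hc) : 𝓢(Plane, ℂ)), by positivity, fun ζ => ?_⟩
  · have := SchwartzMap.one_add_le_sup_seminorm_apply (𝕜 := ℝ) (m := (n, 0)) (k := n) (n := 0)
      le_rfl le_rfl (𝓕 (complexSchwartz hg hc) : 𝓢(Plane, ℂ)) ζ
    rw [norm_iteratedFDeriv_zero, ← ft_eq_schwartz hg hc] at this
    exact this

/-- The exponent 3 exceeds the dimension 2, so `(1 + |ζ|) ^ (-3)` is integrable. -/
lemma integrable_of_decay {u : Plane → ℂ} (hu : AEStronglyMeasurable u) {C : ℝ}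
    (h : ∀ ζ, (1 + ‖ζ‖) ^ 3 * ‖u ζ‖ ≤ C) : Integrable u := by
  have h1 : Integrable (fun ζ : Plane => C * (1 + ‖ζ‖) ^ (-(3 : ℝ))) :=
    (integrable_one_add_norm (by simp; norm_num)).const_mul C
  refine h1.mono' hu (Filter.Eventually.of_forall fun ζ => ?_)
  have h2 : (0 : ℝ) < 1 + ‖ζ‖ := by positivity
  rw [Real.rpow_neg h2.le, ← div_eq_mul_inv, le_div_iff₀ (by positivity)]
  have := h ζ
  rw [mul_comm] at this
  exact_mod_cast this

lemma integrable_weight_mul_ft {g : Plane → ℝ} (hg : ContDiff ℝ ∞ g) (hc : HasCompactSupport g)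
    (n : ℕ) : Integrable (fun ζ => (1 + ‖ζ‖) ^ n * ‖ft g ζ‖) := by
  obtain ⟨C, -, hC⟩ := ft_decay hg hc (n + 3)
  have hcont := continuous_ft hg hc
  have h : Integrable (fun ζ => ((1 + ‖ζ‖) ^ n : ℂ) * ft g ζ) := by
    refine integrable_of_decay (C := C) ?_ fun ζ => ?_
    · exact Continuous.aestronglyMeasurable (by fun_prop)
    · have h2 : ‖((1 + ‖ζ‖ : ℂ))‖ = 1 + ‖ζ‖ := by
        have := Complex.norm_of_nonneg (r := 1 + ‖ζ‖) (by positivity)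
        push_cast at this
        exact this
      rw [norm_mul, norm_pow, h2, ← mul_assoc, ← pow_add, add_comm 3 n]
      exact hC ζ
  refine h.norm.congr (Filter.Eventually.of_forall fun ζ => ?_)
  have h2 : ‖((1 + ‖ζ‖ : ℂ))‖ = 1 + ‖ζ‖ := by
    have := Complex.norm_of_nonneg (r := 1 + ‖ζ‖) (by positivity)
    push_cast at this
    exact this
  simp [h2]

lemma integrable_ft {g : Plane → ℝ} (hg : ContDiff ℝ ∞ g) (hc : HasCompactSupport g) :
    Integrable (ft g) := by
  rw [ft_eq_schwartz hg hc]
  exact SchwartzMap.integrable _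

lemma ofReal_eq_fourierInv_ft {g : Plane → ℝ} (hg : ContDiff ℝ ∞ g) (hc : HasCompactSupport g) :
    (fun x => (g x : ℂ)) = 𝓕⁻ (ft g) := by
  refine (Continuous.fourierInv_fourier_eq (f := fun x => (g x : ℂ)) ?_ ?_ ?_).symm
  · exact Complex.continuous_ofReal.comp hg.continuous
  · exact (complexSchwartz hg hc).integrable
  · exact integrable_ft hg hc

/-- By Fourier inversion, each derivative of `g` costs one factor `2π|ζ|` under the integral. -/
lemma norm_iteratedFDeriv_le_integral_ft {g : Plane → ℝ} (hg : ContDiff ℝ ∞ g)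
    (hc : HasCompactSupport g) (i : ℕ) (x : Plane) :
    ‖iteratedFDeriv ℝ i g x‖ ≤ (2 * Real.pi) ^ i * ∫ ζ, (1 + ‖ζ‖) ^ i * ‖ft g ζ‖ := by
  have h1 : ‖iteratedFDeriv ℝ i g x‖ = ‖iteratedFDeriv ℝ i (fun x => (g x : ℂ)) x‖ :=
    (Complex.ofRealLI.norm_iteratedFDeriv_comp_left (f := g) (x := x) (n := i)
      (hg.contDiffAt.of_le (by exact_mod_cast le_top)) le_rfl).symm
  have h2 : (fun x => (g x : ℂ)) = 𝓕 (fun ζ => ft g (-ζ)) := by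
    rw [ofReal_eq_fourierInv_ft hg hc, Real.fourierInv_eq_fourier_comp_neg]
  have hint : ∀ n : ℕ, Integrable (fun v : Plane => ‖v‖ ^ n * ‖ft g (-v)‖) := by
    intro n
    have h3 := (integrable_weight_mul_ft hg hc n).comp_neg
    refine h3.mono' ?_ (Filter.Eventually.of_forall fun v => ?_)
    · have := continuous_ft hg hc
      exact Continuous.aestronglyMeasurable (by fun_prop)
    · rw [Real.norm_of_nonneg (by positivity), norm_neg]
      gcongr
      linarith
  rw [h1, h2, Real.iteratedFDeriv_fourier (N := ⊤) (fun n _ => hint n)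
    (((continuous_ft hg hc).comp continuous_neg).aestronglyMeasurable) (by exact_mod_cast le_top)]
  refine (VectorFourier.norm_fourierIntegral_le_integral_norm _ _ _ _ _).trans ?_
  rw [← integral_const_mul]
  have h4 : ∫ ζ, (2 * Real.pi) ^ i * ((1 + ‖ζ‖) ^ i * ‖ft g ζ‖) =
      ∫ ζ, (2 * Real.pi) ^ i * ((1 + ‖ζ‖) ^ i * ‖ft g (-ζ)‖) := by
    rw [← integral_neg_eq_self]
    simp
  rw [h4]
  refine integral_mono_of_nonneg (Filter.Eventually.of_forall fun _ => norm_nonneg _) ?_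
    (Filter.Eventually.of_forall fun ζ => ?_)
  · have := ((integrable_weight_mul_ft hg hc i).const_mul ((2 * Real.pi) ^ i)).comp_neg
    simpa using this
  · refine (VectorFourier.norm_fourierPowSMulRight_le _ _ _ _).trans ?_
    have hn : ‖innerSL ℝ (E := Plane)‖ ≤ 1 := norm_innerSL_le ℝ
    have hpi := Real.pi_pos
    calc (2 * Real.pi * ‖innerSL ℝ (E := Plane)‖) ^ i * ‖ζ‖ ^ i * ‖ft g (-ζ)‖
        ≤ (2 * Real.pi * 1) ^ i * (1 + ‖ζ‖) ^ i * ‖ft g (-ζ)‖ := by gcongr; linarith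
      _ = _ := by ring

/-- A distribution is bounded on test functions supported in a fixed compact set by a weighted
`L¹` norm of the Fourier transform. -/
lemma exists_bound_weight_ft {Ω : Opens Plane} (T : 𝓓'(Ω, ℝ)) (K : Compacts Plane)
    (hK : (K : Set Plane) ⊆ Ω) :
    ∃ (k : ℕ) (C : ℝ), 0 ≤ C ∧ ∀ φ : 𝓓(Ω, ℝ), tsupport φ ⊆ K →
      |T φ| ≤ C * ∫ ζ, (1 + ‖ζ‖) ^ k * ‖ft φ ζ‖ := by
  let S : 𝓓^{⊤}_{K}(Plane, ℝ) →L[ℝ] ℝ :=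
    { toFun := fun φ => T (TestFunction.ofSupportedInCLM ℝ hK φ)
      map_add' := fun a b => by rw [map_add, map_add]
      map_smul' := fun c a => by rw [map_smul, map_smul]; rfl
      cont := (map_continuous T).comp (TestFunction.ofSupportedInCLM ℝ hK).continuous }
  -- Continuity on functions supported in `K` gives a bound by finitely many `C^i` seminorms; the
  -- largest order `i` becomes the weight.
  obtain ⟨s, C, -, hsC⟩ := Seminorm.bound_of_continuous
    (ContDiffMapSupportedIn.withSeminorms ℝ Plane ℝ ⊤ K) ((normSeminorm ℝ ℝ).comp S.toLinearMap)
    (continuous_norm.comp S.continuous)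
  refine ⟨s.sup id, C * (2 * Real.pi) ^ (s.sup id), by positivity, fun φ hφ => ?_⟩
  let φK : 𝓓^{⊤}_{K}(Plane, ℝ) :=
    .of_support_subset φ.contDiff (subset_closure.trans hφ)
  have h1 : S φK = T φ := rfl
  have h2 := hsC φK
  change ‖S φK‖ ≤ C • (s.sup (ContDiffMapSupportedIn.seminorm ℝ Plane ℝ ⊤ K)) φK at h2
  rw [h1, Real.norm_eq_abs] at h2
  refine h2.trans ?_
  rw [NNReal.smul_def, smul_eq_mul, mul_assoc]
  refine mul_le_mul_of_nonneg_left ?_ C.2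
  have hg := φ.contDiff
  have hc := φ.hasCompactSupport
  have hpi : (1 : ℝ) ≤ 2 * Real.pi := by linarith [Real.pi_gt_three]
  refine Seminorm.finset_sup_apply_le (by positivity) fun i hi => ?_
  rw [ContDiffMapSupportedIn.seminorm_top_le_iff ℝ (by positivity)]
  intro x _
  refine (norm_iteratedFDeriv_le_integral_ft hg hc i x).trans ?_
  have hik : i ≤ s.sup id := Finset.le_sup (f := id) hi
  have h3 : ∫ ζ, (1 + ‖ζ‖) ^ i * ‖ft φ ζ‖ ≤ ∫ ζ, (1 + ‖ζ‖) ^ (s.sup id) * ‖ft φ ζ‖ := by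
    refine integral_mono (integrable_weight_mul_ft hg hc i) (integrable_weight_mul_ft hg hc _)
      fun ζ => ?_
    have : (1 : ℝ) ≤ 1 + ‖ζ‖ := by simp
    dsimp only
    gcongr
  gcongr

lemma ft_neg (g : Plane → ℝ) (ζ : Plane) : ft g (-ζ) = (starRingEnd ℂ) (ft g ζ) := by
  rw [ft, Real.fourier_eq', Real.fourier_eq', ← integral_conj]
  congr 1
  ext x
  have h2 : (starRingEnd ℂ) 2 = 2 := Complex.conj_ofReal 2
  rw [smul_eq_mul, smul_eq_mul, map_mul, ← Complex.exp_conj, Complex.conj_ofReal]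
  simp [h2]

lemma ft_add {g h : Plane → ℝ} (hg : ContDiff ℝ ∞ g) (hgc : HasCompactSupport g)
    (hh : ContDiff ℝ ∞ h) (hhc : HasCompactSupport h) (ζ : Plane) :
    ft (g + h) ζ = ft g ζ + ft h ζ := by
  have h1 : ft (g + h) = ⇑(𝓕 (complexSchwartz hg hgc + complexSchwartz hh hhc) : 𝓢(Plane, ℂ)) := by
    have h2 : (fun x => (((g + h) x : ℝ) : ℂ)) =
        ⇑(complexSchwartz hg hgc + complexSchwartz hh hhc) := by
      ext x
      simp [complexSchwartz_apply]
    rw [SchwartzMap.fourier_coe, ← h2]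
    rfl
  rw [h1, FourierTransform.fourier_add, ft_eq_schwartz hg hgc, ft_eq_schwartz hh hhc]
  rfl

lemma ft_smul {g : Plane → ℝ} (c : ℝ) (ζ : Plane) : ft (c • g) ζ = c * ft g ζ := by
  rw [ft, Real.fourier_eq', ft, Real.fourier_eq', ← integral_const_mul]
  congr 1
  ext x
  simp
  ring

lemma norm_one_add_norm (ζ : Plane) : ‖((1 + ‖ζ‖ : ℂ))‖ = 1 + ‖ζ‖ := by
  have := Complex.norm_of_nonneg (r := 1 + ‖ζ‖) (by positivity)
  push_cast at this
  exact this

lemma memLp_of_decay {u : Plane → ℂ} (hu : AEStronglyMeasurable u) {C : ℝ}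
    (h : ∀ ζ, (1 + ‖ζ‖) ^ 2 * ‖u ζ‖ ≤ C) : MemLp u 2 := by
  rw [memLp_two_iff_integrable_sq_norm hu]
  have h0 : ∀ ζ, 0 ≤ (1 + ‖ζ‖) ^ 2 * ‖u ζ‖ := fun ζ => by positivity
  have h1 : Integrable (fun ζ => ((‖u ζ‖ ^ 2 : ℝ) : ℂ)) := by
    refine integrable_of_decay (C := C ^ 2) ?_ fun ζ => ?_
    · exact Complex.continuous_ofReal.comp_aestronglyMeasurable (hu.norm.pow 2)
    · rw [Complex.norm_of_nonneg (by positivity)]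
      have h2 := pow_le_pow_left₀ (h0 ζ) (h ζ) 2
      refine le_trans ?_ h2
      rw [mul_pow, ← pow_mul]
      gcongr
      · simp
      · norm_num
  exact h1.re

lemma memLp_weight_mul_ft {g : Plane → ℝ} (hg : ContDiff ℝ ∞ g) (hc : HasCompactSupport g)
    (n : ℕ) : MemLp (fun ζ => ((1 + ‖ζ‖) ^ n : ℂ) * ft g ζ) 2 := by
  obtain ⟨C, -, hC⟩ := ft_decay hg hc (n + 2)
  have hcont := continuous_ft hg hc
  refine memLp_of_decay (C := C) (Continuous.aestronglyMeasurable (by fun_prop)) fun ζ => ?_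
  rw [norm_mul, norm_pow, norm_one_add_norm, ← mul_assoc, ← pow_add, add_comm 2 n]
  exact hC ζ

lemma memLp_inv_weight : MemLp (fun ζ : Plane => ((1 + ‖ζ‖ : ℂ) ^ 2)⁻¹) 2 := by
  refine memLp_of_decay (C := 1) ?_ fun ζ => ?_
  · refine Continuous.aestronglyMeasurable ?_
    refine Continuous.inv₀ (by fun_prop) fun ζ => ?_
    rw [← norm_ne_zero_iff, norm_pow, norm_one_add_norm]
    positivity
  · rw [norm_inv, norm_pow, norm_one_add_norm]
    exact (mul_inv_cancel₀ (by positivity)).le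

/-- A distribution, restricted to test functions supported in a fixed compact set, is the Fourier
transform of a function of polynomial growth. -/
lemma exists_representation {Ω : Opens Plane} (T : 𝓓'(Ω, ℝ)) (K : Compacts Plane)
    (hK : (K : Set Plane) ⊆ Ω) :
    ∃ (k : ℕ) (m : Plane → ℂ), StronglyMeasurable m ∧ Integrable m ∧
      ∀ φ : 𝓓(Ω, ℝ), tsupport φ ⊆ K →
        (T φ : ℂ) = ∫ ζ, ft φ ζ * ((1 + ‖ζ‖) ^ k * m ζ) := by
  obtain ⟨k, C, hC0, hC⟩ := exists_bound_weight_ft T K hK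
  let S : 𝓓^{⊤}_{K}(Plane, ℝ) →ₗ[ℝ] ℝ :=
    { toFun := fun φ => T (TestFunction.ofSupportedInCLM ℝ hK φ)
      map_add' := fun a b => by rw [map_add, map_add]
      map_smul' := fun c a => by rw [map_smul, map_smul]; rfl }
  have hcd : ∀ φ : 𝓓^{⊤}_{K}(Plane, ℝ), ContDiff ℝ ∞ φ := fun φ => φ.contDiff
  have hcs : ∀ φ : 𝓓^{⊤}_{K}(Plane, ℝ), HasCompactSupport φ := fun φ => φ.hasCompactSupport
  -- Test functions are sent into `L²` by their weighted transforms. The two extra powers of the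
  -- weight turn the `L¹` bound into an `L²` bound, by Cauchy–Schwarz against the square-integrable
  -- `(1 + |ζ|) ^ (-2)`.
  let J : 𝓓^{⊤}_{K}(Plane, ℝ) →ₗ[ℝ] Lp ℂ 2 (volume : Measure Plane) :=
    { toFun := fun φ => (memLp_weight_mul_ft (hcd φ) (hcs φ) (k + 2)).toLp
      map_add' := fun a b => by
        rw [← MemLp.toLp_add]
        congr 1
        ext ζ
        have : ft (⇑(a + b)) ζ = ft a ζ + ft b ζ := ft_add (hcd a) (hcs a) (hcd b) (hcs b) ζ
        simp only [this, mul_add, Pi.add_apply]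
      map_smul' := fun c a => by
        rw [RingHom.id_apply, ← MemLp.toLp_const_smul]
        congr 1
        ext ζ
        have : ft (⇑(c • a)) ζ = c * ft a ζ := ft_smul c ζ
        simp only [this, Pi.smul_apply, Complex.real_smul]
        ring }
  have hJ : ∀ φ, ⇑(J φ) =ᵐ[volume] fun ζ => ((1 + ‖ζ‖) ^ (k + 2) : ℂ) * ft φ ζ :=
    fun φ => MemLp.coeFn_toLp (memLp_weight_mul_ft (hcd φ) (hcs φ) (k + 2))
  let q : Lp ℂ 2 (volume : Measure Plane) := memLp_inv_weight.toLp
  have hbound : ∀ φ, |S φ| ≤ C * ‖q‖ * ‖J φ‖ := by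
    intro φ
    refine (hC (TestFunction.ofSupportedIn hK φ) φ.tsupport_subset).trans ?_
    rw [mul_assoc]
    refine mul_le_mul_of_nonneg_left ?_ hC0
    have h1 := integral_mul_norm_le_Lp_mul_Lq (μ := (volume : Measure Plane))
      (f := fun ζ : Plane => ((1 + ‖ζ‖ : ℂ) ^ 2)⁻¹)
      (g := fun ζ => ((1 + ‖ζ‖) ^ (k + 2) : ℂ) * ft φ ζ) (p := 2) (q := 2)
      Real.HolderConjugate.two_two (by simpa using memLp_inv_weight)
      (by simpa using memLp_weight_mul_ft (hcd φ) (hcs φ) (k + 2))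
    have hn : ∀ {u : Plane → ℂ} (hu : MemLp u 2), ‖hu.toLp‖ = (∫ ζ, ‖u ζ‖ ^ (2 : ℝ)) ^ (1 / 2 : ℝ) := by
      intro u hu
      rw [Lp.norm_toLp, hu.eLpNorm_eq_integral_rpow_norm (by simp) (by simp),
        ENNReal.toReal_ofReal (by positivity)]
      simp
    rw [← hn memLp_inv_weight, ← hn (memLp_weight_mul_ft (hcd φ) (hcs φ) (k + 2))] at h1
    refine le_trans (le_of_eq ?_) h1
    congr 1
    ext ζ
    rw [norm_mul, norm_inv, norm_pow, norm_pow, norm_one_add_norm]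
    have : (1 + ‖ζ‖) ≠ 0 := by positivity
    field_simp
    rw [← pow_add, add_comm 2 k]
    rfl
  -- The bound lets `S` descend to the range of `J`; Hahn–Banach then extends it to `L²`, and Riesz
  -- represents it by a function `m₀`.
  have hker : LinearMap.ker J ≤ LinearMap.ker S := by
    intro φ hφ
    have h1 := hbound φ
    rw [LinearMap.mem_ker.mp hφ, norm_zero, mul_zero] at h1
    exact LinearMap.mem_ker.mpr (abs_nonpos_iff.mp h1)
  let ℓ₀ : LinearMap.range J →ₗ[ℝ] ℝ :=
    (LinearMap.ker J).liftQ S hker ∘ₗ J.quotKerEquivRange.symm.toLinearMap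
  have hℓ₀ : ∀ φ, ℓ₀ ⟨J φ, LinearMap.mem_range_self J φ⟩ = S φ := by
    intro φ
    have : J.quotKerEquivRange.symm ⟨J φ, LinearMap.mem_range_self J φ⟩ =
        (LinearMap.ker J).mkQ φ := by
      rw [LinearEquiv.symm_apply_eq]
      rfl
    simp [ℓ₀, this]
  let ℓ₁ : LinearMap.range J →L[ℝ] ℝ := ℓ₀.mkContinuous (C * ‖q‖) (by
    rintro ⟨_, φ, rfl⟩
    rw [hℓ₀ φ]
    exact hbound φ)
  obtain ⟨ℓ, hℓ, -⟩ := exists_extension_norm_eq (𝕜 := ℝ) (LinearMap.range J) ℓ₁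
  let m₀ : Lp ℂ 2 (volume : Measure Plane) := (InnerProductSpace.toDual ℝ _).symm ℓ
  have hm₀ : ∀ φ, S φ = ∫ ζ, (ft φ ζ * ((1 + ‖ζ‖) ^ (k + 2) * (starRingEnd ℂ) (m₀ ζ))).re := by
    intro φ
    have h1 : inner ℝ m₀ (J φ) = S φ := by
      rw [InnerProductSpace.toDual_symm_apply, ← hℓ₀ φ]
      exact hℓ ⟨J φ, LinearMap.mem_range_self J φ⟩
    rw [← h1, L2.inner_def]
    refine integral_congr_ae ?_
    filter_upwards [hJ φ] with ζ hζ
    rw [hζ, Complex.inner]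
    congr 1
    ring
  have hmm : MemLp m₀ 2 := Lp.memLp m₀
  have hsm : StronglyMeasurable m₀ := Lp.stronglyMeasurable m₀
  let M : Plane → ℂ := fun ζ => (starRingEnd ℂ) (m₀ ζ)
  have hMs : StronglyMeasurable M := Complex.continuous_conj.comp_stronglyMeasurable hsm
  have hM : MemLp M 2 := hmm.congr_norm hMs.aestronglyMeasurable
    (Filter.Eventually.of_forall fun ζ => by simp [M])
  -- Riesz for the real inner product yields only a real part. Averaging `M` with its reflected
  -- conjugate makes the complex integral itself real, since `ft φ` is Hermitian.
  let M' : Plane → ℂ := fun ζ => (starRingEnd ℂ) (M (-ζ))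
  have hMs' : StronglyMeasurable M' := Complex.continuous_conj.comp_stronglyMeasurable
    (hMs.comp_measurable measurable_neg)
  have hM' : MemLp M' 2 := by
    have h1 : MemLp (fun ζ => M (-ζ)) 2 :=
      hM.comp_measurePreserving (Measure.measurePreserving_neg volume)
    exact h1.congr_norm hMs'.aestronglyMeasurable (Filter.Eventually.of_forall fun ζ => by simp [M'])
  -- Two more powers are split off, so that `m` is a product of two `L²` functions and hence
  -- integrable.
  refine ⟨k + 4, fun ζ => ((1 + ‖ζ‖ : ℂ) ^ 2)⁻¹ * ((M ζ + M' ζ) / 2), ?_, ?_, fun φ hφ => ?_⟩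
  · refine StronglyMeasurable.mul ?_ ((hMs.add hMs').measurable.div_const 2).stronglyMeasurable
    exact Measurable.stronglyMeasurable (by fun_prop)
  · have h1 : MemLp (fun ζ => (M ζ + M' ζ) / 2) 2 := by
      have := (hM.add hM').const_mul (2⁻¹ : ℂ)
      refine this.ae_eq (Filter.Eventually.of_forall fun ζ => ?_)
      simp
      ring
    exact memLp_inv_weight.integrable_mul h1
  · let φK : 𝓓^{⊤}_{K}(Plane, ℝ) := .of_support_subset φ.contDiff (subset_closure.trans hφ)
    have h1 : T φ = S φK := rfl
    have hint : ∀ {N : Plane → ℂ}, MemLp N 2 →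
        Integrable fun ζ => ft φ ζ * ((1 + ‖ζ‖) ^ (k + 2) * N ζ) := by
      intro N hN
      refine ((memLp_weight_mul_ft φ.contDiff φ.hasCompactSupport (k + 2)).integrable_mul hN).congr
        (Filter.Eventually.of_forall fun ζ => ?_)
      simp
      ring
    have h2 : ∫ ζ, ft φ ζ * ((1 + ‖ζ‖) ^ (k + 2) * M' ζ) =
        (starRingEnd ℂ) (∫ ζ, ft φ ζ * ((1 + ‖ζ‖) ^ (k + 2) * M ζ)) := by
      rw [← integral_conj, ← integral_neg_eq_self]
      congr 1
      ext ζ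
      simp [M', ft_neg]
    have h3 : (T φ : ℂ) = ((∫ ζ, ft φ ζ * ((1 + ‖ζ‖) ^ (k + 2) * M ζ)).re : ℂ) := by
      rw [h1, hm₀ φK]
      congr 1
      exact integral_re (hint hM)
    have h4 : ∀ ζ, ft φ ζ * ((1 + ‖ζ‖) ^ (k + 4) * (((1 + ‖ζ‖ : ℂ) ^ 2)⁻¹ * ((M ζ + M' ζ) / 2))) =
        2⁻¹ * (ft φ ζ * ((1 + ‖ζ‖) ^ (k + 2) * M ζ) + ft φ ζ * ((1 + ‖ζ‖) ^ (k + 2) * M' ζ)) := by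
      intro ζ
      have : (1 + ‖ζ‖ : ℂ) ≠ 0 := by
        rw [← norm_ne_zero_iff, norm_one_add_norm]
        positivity
      field_simp
      ring
    simp_rw [h4]
    rw [integral_const_mul, integral_add (hint hM) (hint hM'), h2, h3, Complex.add_conj]
    push_cast
    ring

lemma tsupport_mulTest_subset {Ω : Opens Plane} (g : Plane → ℝ) (hg : ContDiff ℝ ∞ g)
    (φ : 𝓓(Ω, ℝ)) : tsupport (mulTest g hg φ) ⊆ tsupport φ :=
  closure_mono (Function.support_mul_subset_right g φ)

lemma tsupport_mulTest_subset_left {Ω : Opens Plane} (g : Plane → ℝ) (hg : ContDiff ℝ ∞ g)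
    (φ : 𝓓(Ω, ℝ)) : tsupport (mulTest g hg φ) ⊆ tsupport g :=
  closure_mono (Function.support_mul_subset_left g φ)

/-- The Fourier transform turns the product of a test function and an integrable function into a
convolution. -/
lemma fourier_mul_eq_integral {g : Plane → ℝ} (hg : ContDiff ℝ ∞ g) (hc : HasCompactSupport g)
    {u : Plane → ℂ} (hu : Integrable u) (ζ : Plane) :
    𝓕 (fun x => (g x : ℂ) * u x) ζ = ∫ ξ, ft g ξ * 𝓕 u (ζ - ξ) := by
  -- Reflection and modulation turn `𝓕 u (ζ - ξ)` into `𝓕 v ξ`, so that the transform can be shifted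
  -- from `v` onto `ft g`.
  let v : Plane → ℂ := fun x => Complex.exp ((2 * Real.pi * inner ℝ x ζ : ℝ) * Complex.I) * u (-x)
  have hv : Integrable v := by
    refine hu.comp_neg.bdd_mul (c := 1) (Continuous.aestronglyMeasurable (by fun_prop))
      (Filter.Eventually.of_forall fun x => ?_)
    rw [Complex.norm_exp_ofReal_mul_I]
  have h1 : ∀ ξ, 𝓕 u (ζ - ξ) = 𝓕 v ξ := by
    intro ξ
    rw [Real.fourier_eq', Real.fourier_eq', ← integral_neg_eq_self]
    congr 1
    ext x
    simp only [v, smul_eq_mul]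
    rw [← mul_assoc, ← Complex.exp_add, inner_neg_left, inner_sub_right]
    congr 2
    push_cast
    ring
  have h2 := VectorFourier.integral_fourierIntegral_smul_eq_flip (μ := (volume : Measure Plane))
    (ν := (volume : Measure Plane)) (L := innerₗ Plane) (f := ft g) (g := v)
    Real.continuous_fourierChar continuous_inner (integrable_ft hg hc) hv
  have h3 : ∀ x, 𝓕 (ft g) x = (g (-x) : ℂ) := by
    intro x
    have := congrFun (ofReal_eq_fourierInv_ft hg hc) (-x)
    rw [Real.fourierInv_eq_fourier_neg, neg_neg] at this
    exact this.symm
  have h4 : ∫ ξ, ft g ξ * 𝓕 v ξ = ∫ x, 𝓕 (ft g) x * v x := by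
    rw [flip_innerₗ] at h2
    exact h2.symm
  simp_rw [h1]
  rw [h4, Real.fourier_eq', ← integral_neg_eq_self]
  congr 1
  ext x
  rw [h3]
  simp [v]
  ring

lemma ft_mul {g ψ : Plane → ℝ} (hg : ContDiff ℝ ∞ g) (hgc : HasCompactSupport g)
    (hψ : ContDiff ℝ ∞ ψ) (hψc : HasCompactSupport ψ) (ζ : Plane) :
    ft (fun x => g x * ψ x) ζ = ∫ ξ, ft g ξ * ft ψ (ζ - ξ) := by
  have := fourier_mul_eq_integral hg hgc (complexSchwartz hψ hψc).integrable ζ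
  rw [ft]
  push_cast
  exact this

/-- Cosine minus `i` times sine is the plane wave, which translates frequencies; the two parts are
kept apart because test functions are real. -/
lemma ft_wave {g : Plane → ℝ} (hg : ContDiff ℝ ∞ g) (hc : HasCompactSupport g) (η ζ : Plane) :
    ft (fun x => Real.cos (2 * Real.pi * inner ℝ x η) * g x) ζ -
      Complex.I * ft (fun x => Real.sin (2 * Real.pi * inner ℝ x η) * g x) ζ = ft g (ζ + η) := by
  have hint : Integrable (fun x => (g x : ℂ)) := (complexSchwartz hg hc).integrable
  rw [ft, ft, ft, Real.fourier_eq', Real.fourier_eq', Real.fourier_eq', ← integral_const_mul,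
    ← integral_sub]
  · congr 1
    ext x
    simp only [smul_eq_mul]
    have h1 : ((-2 * Real.pi * inner ℝ x (ζ + η) : ℝ) : ℂ) * Complex.I =
      ((-2 * Real.pi * inner ℝ x ζ : ℝ) : ℂ) * Complex.I +
      (((-(2 * Real.pi * inner ℝ x η) : ℝ) : ℂ)) * Complex.I := by
      rw [inner_add_right]
      push_cast
      ring
    rw [h1, Complex.exp_add, Complex.exp_mul_I (((-(2 * Real.pi * inner ℝ x η) : ℝ) : ℂ)),
      ← Complex.ofReal_cos, ← Complex.ofReal_sin, Real.cos_neg, Real.sin_neg]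
    push_cast
    ring
  · simp only [smul_eq_mul]
    have h : Integrable (fun x : Plane => Complex.exp ((-2 * Real.pi * inner ℝ x ζ : ℝ) * Complex.I)
        * Real.cos (2 * Real.pi * inner ℝ x η) * g x) := by
      refine hint.bdd_mul (c := 1) (Continuous.aestronglyMeasurable (by fun_prop))
        (Filter.Eventually.of_forall fun x => ?_)
      rw [norm_mul, Complex.norm_exp_ofReal_mul_I, one_mul, Complex.norm_real]
      exact Real.abs_cos_le_one _
    refine h.congr (Filter.Eventually.of_forall fun x => ?_)
    push_cast
    ring
  · simp only [smul_eq_mul]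
    have h : Integrable (fun x : Plane => Complex.I *
        Complex.exp ((-2 * Real.pi * inner ℝ x ζ : ℝ) * Complex.I)
        * Real.sin (2 * Real.pi * inner ℝ x η) * g x) := by
      refine hint.bdd_mul (c := 1) (Continuous.aestronglyMeasurable (by fun_prop))
        (Filter.Eventually.of_forall fun x => ?_)
      rw [norm_mul, norm_mul, Complex.norm_exp_ofReal_mul_I, Complex.norm_I, one_mul, one_mul,
        Complex.norm_real]
      exact Real.abs_sin_le_one _
    refine h.congr (Filter.Eventually.of_forall fun x => ?_)
    push_cast
    ring

/-- Submultiplicativity of the weight (Peetre's inequality): a shift of the frequency costs only a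
polynomial factor. -/
lemma one_add_norm_add_le (a b : Plane) : 1 + ‖a + b‖ ≤ (1 + ‖a‖) * (1 + ‖b‖) := by
  have := norm_add_le a b
  nlinarith [norm_nonneg a, norm_nonneg b, mul_nonneg (norm_nonneg a) (norm_nonneg b)]

lemma one_add_norm_sub_le (a b : Plane) : 1 + ‖a - b‖ ≤ (1 + ‖a‖) * (1 + ‖b‖) := by
  have := one_add_norm_add_le a (-b)
  rwa [norm_neg, ← sub_eq_add_neg] at this

lemma one_add_norm_le_sub (a b : Plane) : 1 + ‖a‖ ≤ (1 + ‖a - b‖) * (1 + ‖b‖) := by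
  have := one_add_norm_add_le (a - b) b
  rwa [sub_add_cancel] at this

/-! ### Consequences of the Fourier representation of a distribution. -/

section Representation

variable {Ω : Opens Plane} {T : 𝓓'(Ω, ℝ)} {K : Set Plane} {k : ℕ} {m : Plane → ℂ}

/-- The distribution `T` is, on test functions supported in `K`, the Fourier transform of the
function `(1 + |ζ|) ^ k m(ζ)` with `m` integrable. -/
def IsRepresentedOn (T : 𝓓'(Ω, ℝ)) (K : Set Plane) (k : ℕ) (m : Plane → ℂ) : Prop :=
  StronglyMeasurable m ∧ Integrable m ∧ ∀ φ : 𝓓(Ω, ℝ), tsupport φ ⊆ K →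
    (T φ : ℂ) = ∫ ζ, ft φ ζ * ((1 + ‖ζ‖) ^ k * m ζ)

lemma IsRepresentedOn.integrable (h : IsRepresentedOn T K k m) {g : Plane → ℝ}
    (hg : ContDiff ℝ ∞ g) (hc : HasCompactSupport g) :
    Integrable fun ζ => ft g ζ * ((1 + ‖ζ‖) ^ k * m ζ) := by
  obtain ⟨C, hC0, hC⟩ := ft_decay hg hc k
  have hcont := continuous_ft hg hc
  have := h.2.1.bdd_mul (f := fun ζ => ft g ζ * (1 + ‖ζ‖) ^ k) (c := C)
    (Continuous.aestronglyMeasurable (by fun_prop)) (Filter.Eventually.of_forall fun ζ => by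
      rw [norm_mul, norm_pow, norm_one_add_norm, mul_comm]
      exact hC ζ)
  refine this.congr (Filter.Eventually.of_forall fun ζ => by simp only; ring)

lemma IsRepresentedOn.localFourier_eq (h : IsRepresentedOn T K k m) {ψ : 𝓓(Ω, ℝ)}
    (hψ : tsupport ψ ⊆ K) (η : Plane) :
    localFourier T ψ η = ∫ ζ, ft ψ (ζ + η) * ((1 + ‖ζ‖) ^ k * m ζ) := by
  rw [localFourier, h.2.2 _ ((tsupport_mulTest_subset _ _ _).trans hψ),
    h.2.2 _ ((tsupport_mulTest_subset _ _ _).trans hψ), ← integral_const_mul, ← integral_sub]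
  · congr 1
    ext ζ
    rw [← ft_wave ψ.contDiff ψ.hasCompactSupport η ζ, sub_mul, mul_assoc]
    rfl
  · exact h.integrable (TestFunction.contDiff _) (TestFunction.hasCompactSupport _)
  · exact (h.integrable (TestFunction.contDiff _) (TestFunction.hasCompactSupport _)).const_mul _

lemma IsRepresentedOn.measurable_localFourier (h : IsRepresentedOn T K k m) {ψ : 𝓓(Ω, ℝ)}
    (hψ : tsupport ψ ⊆ K) : StronglyMeasurable (localFourier T ψ) := by
  have h1 : localFourier T ψ = fun η => ∫ ζ, ft ψ (ζ + η) * ((1 + ‖ζ‖) ^ k * m ζ) :=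
    funext fun η => h.localFourier_eq hψ η
  rw [h1]
  have hcont := continuous_ft ψ.contDiff ψ.hasCompactSupport
  have hm := h.1.measurable
  refine StronglyMeasurable.integral_prod_right (f := fun η ζ => ft ψ (ζ + η) * ((1 + ‖ζ‖) ^ k * m ζ))
    ?_
  have : Measurable (ft ψ) := hcont.measurable
  refine Measurable.stronglyMeasurable ?_
  change Measurable fun p : Plane × Plane => ft ψ (p.2 + p.1) * ((1 + ‖p.2‖) ^ k * m p.2)
  fun_prop

/-- The weight at `ζ` is at most the weight at `ζ + η`, absorbed by the decay of `ft ψ`, times the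
weight at `η`. The degree `k` depends on `K` only and not on `ψ`, which matters in
`exists_goodOn_of_notMem`. -/
lemma IsRepresentedOn.norm_localFourier_le (h : IsRepresentedOn T K k m) {ψ : 𝓓(Ω, ℝ)}
    (hψ : tsupport ψ ⊆ K) :
    ∃ C, 0 ≤ C ∧ ∀ η, ‖localFourier T ψ η‖ ≤ C * (1 + ‖η‖) ^ k := by
  obtain ⟨C, hC0, hC⟩ := ft_decay ψ.contDiff ψ.hasCompactSupport k
  refine ⟨C * ∫ ζ, ‖m ζ‖, by positivity, fun η => ?_⟩
  rw [h.localFourier_eq hψ η]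
  refine (norm_integral_le_of_norm_le (h.2.1.norm.const_mul (C * (1 + ‖η‖) ^ k))
    (Filter.Eventually.of_forall fun ζ => ?_)).trans (le_of_eq ?_)
  · rw [norm_mul, norm_mul, norm_pow, norm_one_add_norm, ← mul_assoc]
    refine mul_le_mul_of_nonneg_right ?_ (norm_nonneg _)
    have h1 : (1 + ‖ζ‖) ^ k ≤ (1 + ‖ζ + η‖) ^ k * (1 + ‖η‖) ^ k := by
      rw [← mul_pow]
      have := one_add_norm_sub_le (ζ + η) η
      rw [add_sub_cancel_right] at this
      gcongr
    calc ‖ft ψ (ζ + η)‖ * (1 + ‖ζ‖) ^ k ≤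
        ‖ft ψ (ζ + η)‖ * ((1 + ‖ζ + η‖) ^ k * (1 + ‖η‖) ^ k) := by gcongr
      _ = ((1 + ‖ζ + η‖) ^ k * ‖ft ψ (ζ + η)‖) * (1 + ‖η‖) ^ k := by ring
      _ ≤ C * (1 + ‖η‖) ^ k := by gcongr; exact hC _
  · rw [integral_const_mul]
    ring

lemma IsRepresentedOn.localFourier_mulTest (h : IsRepresentedOn T K k m) {ψ : 𝓓(Ω, ℝ)}
    (hψ : tsupport ψ ⊆ K) {g : Plane → ℝ} (hg : ContDiff ℝ ∞ g) (hc : HasCompactSupport g)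
    (η : Plane) :
    localFourier T (mulTest g hg ψ) η = ∫ ξ, ft g ξ * localFourier T ψ (η - ξ) := by
  rw [h.localFourier_eq ((tsupport_mulTest_subset _ _ _).trans hψ)]
  obtain ⟨C, hC0, hC⟩ := ft_decay ψ.contDiff ψ.hasCompactSupport k
  have hψm : Measurable (ft ψ) := (continuous_ft ψ.contDiff ψ.hasCompactSupport).measurable
  have hgm : Measurable (ft g) := (continuous_ft hg hc).measurable
  have hm := h.1.measurable
  -- Absolute integrability for Fubini: the weight at `ζ` is distributed over `ζ + η - ξ`, `ξ` and
  -- `η`, and `ft ψ` and `ft g` absorb the first two.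
  have hint : Integrable (Function.uncurry fun ζ ξ : Plane =>
      ft g ξ * ft ψ (ζ + η - ξ) * ((1 + ‖ζ‖) ^ k * m ζ)) (volume.prod volume) := by
    have h1 := (h.2.1.norm.const_mul (C * (1 + ‖η‖) ^ k)).mul_prod
      (integrable_weight_mul_ft hg hc k)
    refine h1.mono' ?_ (Filter.Eventually.of_forall fun p => ?_)
    · refine Measurable.aestronglyMeasurable ?_
      change Measurable fun p : Plane × Plane =>
        ft g p.2 * ft ψ (p.1 + η - p.2) * ((1 + ‖p.1‖) ^ k * m p.1)
      fun_prop
    · obtain ⟨ζ, ξ⟩ := p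
      simp only [Function.uncurry_apply_pair]
      rw [norm_mul, norm_mul, norm_mul, norm_pow, norm_one_add_norm]
      have h2 : (1 + ‖ζ‖) ^ k ≤ (1 + ‖ζ + η - ξ‖) ^ k * (1 + ‖ξ‖) ^ k * (1 + ‖η‖) ^ k := by
        rw [← mul_pow, ← mul_pow]
        have h3 := one_add_norm_le_sub (ζ + η) ξ
        have h4 := one_add_norm_sub_le (ζ + η) η
        rw [add_sub_cancel_right] at h4
        gcongr
        exact h4.trans (by gcongr)
      calc ‖ft g ξ‖ * ‖ft ψ (ζ + η - ξ)‖ * ((1 + ‖ζ‖) ^ k * ‖m ζ‖)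
          ≤ ‖ft g ξ‖ * ‖ft ψ (ζ + η - ξ)‖ *
            (((1 + ‖ζ + η - ξ‖) ^ k * (1 + ‖ξ‖) ^ k * (1 + ‖η‖) ^ k) * ‖m ζ‖) := by gcongr
        _ = ((1 + ‖ζ + η - ξ‖) ^ k * ‖ft ψ (ζ + η - ξ)‖) * ((1 + ‖η‖) ^ k * ‖m ζ‖ *
            ((1 + ‖ξ‖) ^ k * ‖ft g ξ‖)) := by ring
        _ ≤ C * ((1 + ‖η‖) ^ k * ‖m ζ‖ * ((1 + ‖ξ‖) ^ k * ‖ft g ξ‖)) := by gcongr; exact hC _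
        _ = _ := by ring
  have hswap := integral_integral_swap hint
  have h5 : ∀ ζ : Plane, ft (mulTest g hg ψ) (ζ + η) * ((1 + ‖ζ‖) ^ k * m ζ) =
      ∫ ξ, ft g ξ * ft ψ (ζ + η - ξ) * ((1 + ‖ζ‖) ^ k * m ζ) := by
    intro ζ
    rw [integral_mul_const]
    congr 1
    exact ft_mul hg hc ψ.contDiff ψ.hasCompactSupport (ζ + η)
  simp_rw [h5]
  rw [hswap]
  congr 1
  ext ξ
  rw [h.localFourier_eq hψ, ← integral_const_mul]
  congr 1
  ext ζ
  rw [mul_assoc, add_sub_assoc]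

end Representation

section LocalFourier

variable {Ω : Opens Plane} (T : 𝓓'(Ω, ℝ))

lemma exists_isRepresentedOn {K : Set Plane} (hK : IsCompact K) (hKΩ : K ⊆ Ω) :
    ∃ k m, IsRepresentedOn T K k m :=
  exists_representation T ⟨K, hK⟩ hKΩ

lemma exists_isRepresentedOn_tsupport (ψ : 𝓓(Ω, ℝ)) : ∃ k m, IsRepresentedOn T (tsupport ψ) k m :=
  exists_isRepresentedOn T ψ.hasCompactSupport ψ.tsupport_subset

lemma stronglyMeasurable_localFourier (ψ : 𝓓(Ω, ℝ)) : StronglyMeasurable (localFourier T ψ) := by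
  obtain ⟨k, m, h⟩ := exists_isRepresentedOn_tsupport T ψ
  exact h.measurable_localFourier subset_rfl

lemma exists_norm_localFourier_le (ψ : 𝓓(Ω, ℝ)) :
    ∃ (k : ℕ) (C : ℝ), 0 ≤ C ∧ ∀ η, ‖localFourier T ψ η‖ ≤ C * (1 + ‖η‖) ^ k := by
  obtain ⟨k, m, h⟩ := exists_isRepresentedOn_tsupport T ψ
  exact ⟨k, h.norm_localFourier_le subset_rfl⟩

lemma localFourier_mulTest (ψ : 𝓓(Ω, ℝ)) {g : Plane → ℝ} (hg : ContDiff ℝ ∞ g)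
    (hc : HasCompactSupport g) (η : Plane) :
    localFourier T (mulTest g hg ψ) η = ∫ ξ, ft g ξ * localFourier T ψ (η - ξ) := by
  obtain ⟨k, m, h⟩ := exists_isRepresentedOn_tsupport T ψ
  exact h.localFourier_mulTest subset_rfl hg hc η

lemma localFourier_zero (ψ : 𝓓(Ω, ℝ)) : localFourier T ψ 0 = T ψ := by
  have h1 : mulTest _ (contDiff_cosWave 0) ψ = ψ := by
    ext x
    simp
  have h2 : mulTest _ (contDiff_sinWave 0) ψ = 0 := by
    ext x
    simp
  rw [localFourier, h1, h2, map_zero]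
  simp

lemma apply_mulTest (ψ : 𝓓(Ω, ℝ)) {g : Plane → ℝ} (hg : ContDiff ℝ ∞ g)
    (hc : HasCompactSupport g) :
    (T (mulTest g hg ψ) : ℂ) = ∫ ξ, ft g ξ * localFourier T ψ (-ξ) := by
  rw [← localFourier_zero, localFourier_mulTest T ψ hg hc]
  simp

end LocalFourier

/-! ### Decay in cones -/

/-- The function `b` decays like `(1 + |η|) ^ (-N)` for `η ∈ V`, stably under translations. -/
def ConeDecayOn (b : Plane → ℂ) (N : ℕ) (V : Set Plane) : Prop :=
  ∃ (C : ℝ) (P : ℕ), 0 ≤ C ∧ ∀ η ∈ V, ∀ ζ, ‖b (η - ζ)‖ * (1 + ‖η‖) ^ N ≤ C * (1 + ‖ζ‖) ^ P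

/-- An open conical neighbourhood of `ξ`. -/
def IsOpenCone (V : Set Plane) (ξ : Plane) : Prop :=
  IsOpen V ∧ ξ ∈ V ∧ ∀ t : ℝ, 0 < t → ∀ η ∈ V, t • η ∈ V

/-- In a narrower cone, a shift with `|ζ| ≤ δ|η|` keeps `η - ζ` inside `V`, where the assumed decay
applies. A larger shift gives `1 + |η| ≤ δ⁻¹ (1 + |ζ|)`, so that all growth in `η` is paid for by
powers of `1 + |ζ|`. -/
lemma exists_coneDecayOn_of_le {b : Plane → ℂ} {M N : ℕ} {C C' : ℝ} {V : Set Plane} {ξ : Plane}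
    (hC' : 0 ≤ C') (hb : ∀ η, ‖b η‖ ≤ C' * (1 + ‖η‖) ^ M) (hV : IsOpen V) (hξ : ξ ∈ V)
    (hcone : ∀ t : ℝ, 0 < t → ∀ η ∈ V, t • η ∈ V) (hξ1 : ‖ξ‖ = 1) (hC : 0 ≤ C)
    (hbV : ∀ η ∈ V, ‖b η‖ ≤ C / (1 + ‖η‖) ^ N) : ∃ V', IsOpenCone V' ξ ∧ ConeDecayOn b N V' := by
  obtain ⟨ε, hε, hball⟩ := Metric.isOpen_iff.mp hV ξ hξ
  -- The cone aperture and the shift each use up `δ`, whence `2 * δ ≤ ε`; `δ ≤ 1` is needed for the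
  -- summand 1 in the comparison of weights for large shifts.
  obtain ⟨δ, hδ0, hδ1, hδε⟩ : ∃ δ : ℝ, 0 < δ ∧ δ ≤ 1 ∧ 2 * δ ≤ ε :=
    ⟨min 1 (ε / 2), by positivity, min_le_left _ _, by linarith [min_le_right 1 (ε / 2)]⟩
  refine ⟨{η | ‖η - ‖η‖ • ξ‖ < δ * ‖η‖}, ⟨isOpen_lt (by fun_prop) (by fun_prop), ?_, ?_⟩,
    C + C' * (δ⁻¹) ^ (M + N), 2 * M + N, by positivity, ?_⟩
  · simp [hξ1, hδ0]
  · intro t ht η hη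
    simp only [Set.mem_ofPred_eq] at hη ⊢
    rw [norm_smul, Real.norm_of_nonneg ht.le, mul_smul, ← smul_sub, norm_smul,
      Real.norm_of_nonneg ht.le]
    nlinarith
  · intro η hη ζ
    simp only [Set.mem_ofPred_eq] at hη
    have hη0 : 0 < ‖η‖ := by
      by_contra h
      have : ‖η‖ = 0 := le_antisymm (not_lt.mp h) (norm_nonneg _)
      rw [this, mul_zero] at hη
      exact absurd hη (not_lt.mpr (norm_nonneg _))
    have hζ1 : (1 : ℝ) ≤ 1 + ‖ζ‖ := by simp
    by_cases hζ : ‖ζ‖ ≤ δ * ‖η‖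
    · have hmem : η - ζ ∈ V := by
        have h1 : ‖η‖⁻¹ • (η - ζ) ∈ V := by
          apply hball
          rw [Metric.mem_ball, dist_eq_norm]
          have h2 : ‖η‖⁻¹ • (η - ζ) - ξ = ‖η‖⁻¹ • ((η - ‖η‖ • ξ) - ζ) := by
            rw [smul_sub, smul_sub, smul_sub, inv_smul_smul₀ hη0.ne']
            abel
          rw [h2, norm_smul, norm_inv, norm_norm, inv_mul_lt_iff₀ hη0]
          calc ‖(η - ‖η‖ • ξ) - ζ‖ ≤ ‖η - ‖η‖ • ξ‖ + ‖ζ‖ := norm_sub_le _ _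
            _ < δ * ‖η‖ + δ * ‖η‖ := by linarith
            _ ≤ ‖η‖ * ε := by nlinarith
        have := hcone ‖η‖ hη0 _ h1
        rwa [smul_inv_smul₀ hη0.ne'] at this
      have h1 : (1 + ‖η‖) ^ N ≤ (1 + ‖η - ζ‖) ^ N * (1 + ‖ζ‖) ^ N := by
        rw [← mul_pow]
        have := one_add_norm_le_sub η ζ
        gcongr
      calc ‖b (η - ζ)‖ * (1 + ‖η‖) ^ N
          ≤ C / (1 + ‖η - ζ‖) ^ N * ((1 + ‖η - ζ‖) ^ N * (1 + ‖ζ‖) ^ N) := by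
            gcongr
            exact hbV _ hmem
        _ = C * (1 + ‖ζ‖) ^ N := by field_simp
        _ ≤ C * (1 + ‖ζ‖) ^ (2 * M + N) := by gcongr; omega
        _ ≤ _ := by
          gcongr
          have : 0 ≤ C' * (δ⁻¹) ^ (M + N) := by positivity
          linarith
    · have hηζ : 1 + ‖η‖ ≤ δ⁻¹ * (1 + ‖ζ‖) := by
        rw [le_inv_mul_iff₀ hδ0]
        nlinarith
      have h1 : (1 + ‖η - ζ‖) ^ M ≤ (1 + ‖η‖) ^ M * (1 + ‖ζ‖) ^ M := by
        rw [← mul_pow]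
        have := one_add_norm_sub_le η ζ
        gcongr
      calc ‖b (η - ζ)‖ * (1 + ‖η‖) ^ N
          ≤ C' * ((1 + ‖η‖) ^ M * (1 + ‖ζ‖) ^ M) * (1 + ‖η‖) ^ N := by
            gcongr
            exact (hb _).trans (by gcongr)
        _ = C' * (1 + ‖η‖) ^ (M + N) * (1 + ‖ζ‖) ^ M := by ring
        _ ≤ C' * (δ⁻¹ * (1 + ‖ζ‖)) ^ (M + N) * (1 + ‖ζ‖) ^ M := by gcongr
        _ = C' * (δ⁻¹) ^ (M + N) * (1 + ‖ζ‖) ^ (2 * M + N) := by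
          rw [mul_pow]
          ring
        _ ≤ _ := by
          gcongr
          linarith

/-- Because the decay bound is polynomial in the shift, it can be integrated against the rapidly
decreasing `ft g`; the cone does not shrink. -/
lemma ConeDecayOn.convolve {b : Plane → ℂ} {N : ℕ} {V : Set Plane}
    (h : ConeDecayOn b N V) {g : Plane → ℝ} (hg : ContDiff ℝ ∞ g) (hc : HasCompactSupport g) :
    ConeDecayOn (fun η => ∫ ζ, ft g ζ * b (η - ζ)) N V := by
  obtain ⟨C, P, hC, hbd⟩ := h
  refine ⟨C * ∫ ζ, (1 + ‖ζ‖) ^ P * ‖ft g ζ‖, P, by positivity, fun η hη ζ => ?_⟩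
  have hN : (0 : ℝ) < (1 + ‖η‖) ^ N := by positivity
  have h1 := norm_integral_le_of_norm_le
    (f := fun ζ' => ft g ζ' * b (η - ζ - ζ'))
    ((integrable_weight_mul_ft hg hc P).const_mul (C * (1 + ‖ζ‖) ^ P / (1 + ‖η‖) ^ N))
    (Filter.Eventually.of_forall fun ζ' => by
      rw [norm_mul]
      have h2 := hbd η hη (ζ + ζ')
      rw [← sub_sub, ← le_div_iff₀ hN] at h2
      have h3 : (1 + ‖ζ + ζ'‖) ^ P ≤ (1 + ‖ζ‖) ^ P * (1 + ‖ζ'‖) ^ P := by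
        rw [← mul_pow]
        have := one_add_norm_add_le ζ ζ'
        gcongr
      calc ‖ft g ζ'‖ * ‖b (η - ζ - ζ')‖
          ≤ ‖ft g ζ'‖ * (C * ((1 + ‖ζ‖) ^ P * (1 + ‖ζ'‖) ^ P) / (1 + ‖η‖) ^ N) := by
            gcongr
            exact h2.trans (by gcongr)
        _ = _ := by ring)
  rw [integral_const_mul] at h1
  calc _ ≤ (C * (1 + ‖ζ‖) ^ P / (1 + ‖η‖) ^ N * ∫ ζ, (1 + ‖ζ‖) ^ P * ‖ft g ζ‖) * (1 + ‖η‖) ^ N := by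
        gcongr
    _ = _ := by field_simp

/-! ### Absolutely convergent convolutions -/

/-- The convolution of `a` and `b` converges absolutely, with polynomial bounds. -/
def ConvBounded (a b : Plane → ℂ) : Prop :=
  ∃ (C : ℝ) (M : ℕ), 0 ≤ C ∧ ∀ ζ, Integrable (fun η => a η * b (ζ - η)) ∧
    ∫ η, ‖a η * b (ζ - η)‖ ≤ C * (1 + ‖ζ‖) ^ M

section ConvBounded

variable {a b : Plane → ℂ}

lemma ConvBounded.integrable (h : ConvBounded a b) (ζ : Plane) :
    Integrable (fun η => a η * b (ζ - η)) := by
  obtain ⟨C, M, -, h⟩ := h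
  exact (h ζ).1

lemma ConvBounded.integrable_neg (h : ConvBounded a b) : Integrable (fun η => a η * b (-η)) := by
  simpa using h.integrable 0

lemma ConvBounded.norm_integral_le (h : ConvBounded a b) :
    ∃ (C : ℝ) (M : ℕ), 0 ≤ C ∧ ∀ ζ, ‖∫ η, a η * b (ζ - η)‖ ≤ C * (1 + ‖ζ‖) ^ M := by
  obtain ⟨C, M, hC, h⟩ := h
  exact ⟨C, M, hC, fun ζ => (norm_integral_le_integral_norm _).trans (h ζ).2⟩

lemma convBounded_of_le (ha : StronglyMeasurable a) (hb : StronglyMeasurable b) {C : ℝ} {M : ℕ}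
    (hC : 0 ≤ C)
    (h : ∀ ζ η, ‖a η * b (ζ - η)‖ * (1 + ‖η‖) ^ 3 ≤ C * (1 + ‖ζ‖) ^ M) : ConvBounded a b := by
  have h1 : Integrable (fun ζ : Plane => (1 + ‖ζ‖) ^ (-(3 : ℝ))) :=
    integrable_one_add_norm (by simp; norm_num)
  have hle : ∀ ζ η, ‖a η * b (ζ - η)‖ ≤ C * (1 + ‖ζ‖) ^ M * (1 + ‖η‖) ^ (-(3 : ℝ)) := by
    intro ζ η
    have h2 : (0 : ℝ) < 1 + ‖η‖ := by positivity
    rw [Real.rpow_neg h2.le, ← div_eq_mul_inv, le_div_iff₀ (by positivity)]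
    exact_mod_cast h ζ η
  have hint : ∀ ζ, Integrable (fun η => a η * b (ζ - η)) := fun ζ =>
    (h1.const_mul (C * (1 + ‖ζ‖) ^ M)).mono'
      (ha.mul (hb.comp_measurable (by fun_prop))).aestronglyMeasurable
      (Filter.Eventually.of_forall (hle ζ))
  refine ⟨C * ∫ ζ : Plane, (1 + ‖ζ‖) ^ (-(3 : ℝ)), M, ?_, fun ζ => ⟨hint ζ, ?_⟩⟩
  · have : 0 ≤ ∫ ζ : Plane, (1 + ‖ζ‖) ^ (-(3 : ℝ)) := integral_nonneg fun ζ => by positivity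
    positivity
  · have := integral_mono (hint ζ).norm (h1.const_mul (C * (1 + ‖ζ‖) ^ M)) (hle ζ)
    rw [integral_const_mul] at this
    linarith

variable {g : Plane → ℝ}

lemma ConvBounded.integrable_prod (h : ConvBounded a b) (ha : StronglyMeasurable a)
    (hb : StronglyMeasurable b) (hg : ContDiff ℝ ∞ g) (hc : HasCompactSupport g) (ζ : Plane) :
    Integrable (Function.uncurry fun η ξ : Plane => ft g ξ * a η * b (ζ - η - ξ))
      (volume.prod volume) := by
  obtain ⟨C, M, hC, h⟩ := h
  have ham := ha.measurable
  have hbm := hb.measurable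
  have hgm : Measurable (ft g) := (continuous_ft hg hc).measurable
  have hmeas : Measurable (Function.uncurry fun η ξ : Plane => ft g ξ * a η * b (ζ - η - ξ)) := by
    change Measurable fun p : Plane × Plane => ft g p.2 * a p.1 * b (ζ - p.1 - p.2)
    fun_prop
  have heq : ∀ ξ η : Plane, ft g ξ * a η * b (ζ - η - ξ) = ft g ξ * (a η * b (ζ - ξ - η)) := by
    intro ξ η
    rw [mul_assoc, sub_right_comm]
  rw [integrable_prod_iff' hmeas.aestronglyMeasurable]
  constructor
  · refine Filter.Eventually.of_forall fun ξ => ?_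
    simp only [Function.uncurry_apply_pair, heq]
    exact (h _).1.const_mul _
  · simp only [Function.uncurry_apply_pair, heq]
    refine ((integrable_weight_mul_ft hg hc M).const_mul (C * (1 + ‖ζ‖) ^ M)).mono' ?_
      (Filter.Eventually.of_forall fun ξ => ?_)
    · refine StronglyMeasurable.aestronglyMeasurable ?_
      refine StronglyMeasurable.integral_prod_right
        (f := fun ξ η => ‖ft g ξ * (a η * b (ζ - ξ - η))‖) (Measurable.stronglyMeasurable ?_)
      change Measurable fun p : Plane × Plane => ‖ft g p.1 * (a p.2 * b (ζ - p.1 - p.2))‖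
      fun_prop
    · rw [Real.norm_of_nonneg (by positivity)]
      simp_rw [norm_mul (ft g ξ)]
      rw [integral_const_mul]
      have h1 := (h (ζ - ξ)).2
      have h2 : (1 + ‖ζ - ξ‖) ^ M ≤ (1 + ‖ζ‖) ^ M * (1 + ‖ξ‖) ^ M := by
        rw [← mul_pow]
        have := one_add_norm_sub_le ζ ξ
        gcongr
      calc ‖ft g ξ‖ * ∫ η, ‖a η * b (ζ - ξ - η)‖
          ≤ ‖ft g ξ‖ * (C * ((1 + ‖ζ‖) ^ M * (1 + ‖ξ‖) ^ M)) := by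
            gcongr
            exact h1.trans (by gcongr)
        _ = _ := by ring

/-- Fubini. The right-hand side is the same as in `ConvBounded.convolve_left`, which is what allows
a smooth factor to change sides. -/
lemma ConvBounded.convolve_right (h : ConvBounded a b) (ha : StronglyMeasurable a)
    (hb : StronglyMeasurable b) (hg : ContDiff ℝ ∞ g) (hc : HasCompactSupport g) (ζ : Plane) :
    ∫ η, a η * ∫ ξ, ft g ξ * b (ζ - η - ξ) = ∫ ξ, ft g ξ * ∫ η, a η * b (ζ - ξ - η) := by
  have h1 := integral_integral_swap (h.integrable_prod ha hb hg hc ζ)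
  have e1 : ∀ η, a η * ∫ ξ, ft g ξ * b (ζ - η - ξ) = ∫ ξ, ft g ξ * a η * b (ζ - η - ξ) := by
    intro η
    rw [← integral_const_mul]
    congr 1
    ext ξ
    ring
  simp_rw [e1]
  rw [h1]
  congr 1
  ext ξ
  rw [← integral_const_mul]
  congr 1
  ext η
  rw [mul_assoc, sub_right_comm]

lemma ConvBounded.convolve_left (h : ConvBounded a b) (ha : StronglyMeasurable a)
    (hb : StronglyMeasurable b) (hg : ContDiff ℝ ∞ g) (hc : HasCompactSupport g) (ζ : Plane) :
    ∫ η, (∫ ξ, ft g ξ * a (η - ξ)) * b (ζ - η) = ∫ ξ, ft g ξ * ∫ η, a η * b (ζ - ξ - η) := by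
  -- The substitution `η ↦ ζ - η` exchanges `a` and `b`, reducing to the previous lemma.
  have h0 : ConvBounded b a := by
    obtain ⟨C, M, hC, h⟩ := h
    refine ⟨C, M, hC, fun ζ => ⟨?_, ?_⟩⟩
    · refine ((h ζ).1.comp_sub_left ζ).congr (Filter.Eventually.of_forall fun η => ?_)
      simp [mul_comm]
    · refine le_trans (le_of_eq ?_) (h ζ).2
      rw [← integral_sub_left_eq_self _ _ ζ]
      simp [mul_comm]
  have h1 := h0.convolve_right hb ha hg hc ζ
  calc ∫ η, (∫ ξ, ft g ξ * a (η - ξ)) * b (ζ - η)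
      = ∫ η, b η * ∫ ξ, ft g ξ * a (ζ - η - ξ) := by
        rw [← integral_sub_left_eq_self _ _ ζ]
        simp [mul_comm]
    _ = _ := by
        rw [h1]
        congr 1
        ext ξ
        congr 1
        rw [← integral_sub_left_eq_self _ _ (ζ - ξ)]
        simp [mul_comm]

end ConvBounded

/-! ### Cut-offs, partitions of unity, division -/

/-- A smooth function with compact support in `Ω`, as a test function. -/
def mkTest {Ω : Opens Plane} (g : Plane → ℝ) (hg : ContDiff ℝ ∞ g) (hc : HasCompactSupport g)
    (hs : tsupport g ⊆ Ω) : 𝓓(Ω, ℝ) := ⟨g, hg, hc, hs⟩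

@[simp] lemma mkTest_apply {Ω : Opens Plane} (g : Plane → ℝ) (hg : ContDiff ℝ ∞ g)
    (hc : HasCompactSupport g) (hs : tsupport g ⊆ Ω) (x : Plane) : mkTest g hg hc hs x = g x := rfl

lemma exists_cutoff {Ω : Opens Plane} {K U : Set Plane} (hK : IsCompact K) (hU : IsOpen U)
    (hKU : K ⊆ U) (hKΩ : K ⊆ Ω) :
    ∃ ψ : 𝓓(Ω, ℝ), tsupport ψ ⊆ U ∧ ∃ W, IsOpen W ∧ K ⊆ W ∧ ∀ y ∈ W, ψ y = 1 := by
  obtain ⟨K', hK', hKK', hK'U⟩ := exists_compact_between hK (hU.inter Ω.isOpen)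
    (Set.subset_inter hKU hKΩ)
  obtain ⟨f, hf1, hf0, -⟩ := exists_contMDiffMap_one_nhds_of_subset_interior (n := ⊤)
    (modelWithCornersSelf ℝ Plane) hK.isClosed hKK'
  have hts : tsupport f ⊆ K' := closure_minimal (fun x hx => by
    by_contra h
    exact hx (hf0 x h)) hK'.isClosed
  refine ⟨mkTest f f.contMDiff.contDiff (hK'.of_isClosed_subset (isClosed_tsupport _) hts)
    (hts.trans (hK'U.trans Set.inter_subset_right)), hts.trans (hK'U.trans Set.inter_subset_left),
    ?_⟩
  rw [Filter.Eventually, mem_nhdsSet_iff_exists] at hf1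
  obtain ⟨W, hW, hKW, h⟩ := hf1
  exact ⟨W, hW, hKW, fun y hy => h hy⟩

lemma exists_cutoff_nhds {Ω : Opens Plane} {x : Plane} (hx : x ∈ Ω) {U : Set Plane}
    (hU : IsOpen U) (hxU : x ∈ U) :
    ∃ ψ : 𝓓(Ω, ℝ), tsupport ψ ⊆ U ∧ ∃ W, IsOpen W ∧ x ∈ W ∧ W ⊆ U ∧ ∀ y ∈ W, ψ y = 1 := by
  obtain ⟨ψ, hψU, W, hW, hxW, h⟩ := exists_cutoff (Ω := Ω) (isCompact_singleton (x := x)) hU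
    (by simpa using hxU) (by simpa using hx)
  refine ⟨ψ, hψU, W, hW, hxW rfl, fun y hy => hψU (subset_tsupport _ ?_), h⟩
  rw [Function.mem_support, h y hy]
  exact one_ne_zero

lemma exists_finite_partition {Ω : Opens Plane} {K : Set Plane} (hK : IsCompact K) (hKΩ : K ⊆ Ω)
    (U : Plane → Set Plane) (hU : ∀ x ∈ K, IsOpen (U x)) (hxU : ∀ x ∈ K, x ∈ U x) :
    ∃ (s : Finset K) (χ : K → 𝓓(Ω, ℝ)), (∀ i, tsupport (χ i) ⊆ U i) ∧
      ∀ x ∈ K, ∑ i ∈ s, χ i x = 1 := by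
  -- The unit balls force compact supports; local finiteness leaves only finitely many members that
  -- meet `K`.
  obtain ⟨f, hf⟩ := SmoothPartitionOfUnity.exists_isSubordinate (modelWithCornersSelf ℝ Plane)
    hK.isClosed (fun i : K => U i ∩ (Metric.ball (i : Plane) 1 ∩ Ω))
    (fun i => (hU i i.2).inter (Metric.isOpen_ball.inter Ω.isOpen))
    (fun x hx => Set.mem_iUnion.mpr ⟨⟨x, hx⟩, hxU x hx, Metric.mem_ball_self one_pos, hKΩ hx⟩)
  have hcomp : ∀ i : K, HasCompactSupport (f i) := fun i =>
    (Metric.isBounded_ball.subset ((hf i).trans (Set.inter_subset_right.trans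
      Set.inter_subset_left))).isCompact_closure.of_isClosed_subset (isClosed_tsupport _)
      subset_closure
  have hfin := f.locallyFinite.finite_nonempty_inter_compact hK
  refine ⟨hfin.toFinset, fun i => mkTest (f i) (f i).contMDiff.contDiff (hcomp i)
    ((hf i).trans (Set.inter_subset_right.trans Set.inter_subset_right)),
    fun i => (hf i).trans Set.inter_subset_left, fun x hx => ?_⟩
  refine Eq.trans ?_ (f.sum_eq_one hx)
  symm
  refine finsum_eq_sum_of_support_subset _ ?_
  · intro i hi
    simp only [Set.Finite.coe_toFinset, Set.mem_ofPred_eq]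
    exact ⟨x, hi, hx⟩

lemma contDiff_div_testFunction {Ω : Opens Plane} (φ ψ : 𝓓(Ω, ℝ))
    (h : tsupport φ ⊆ Function.support ψ) : ContDiff ℝ ∞ (fun x => φ x / ψ x) := by
  rw [contDiff_iff_contDiffAt]
  intro x
  by_cases hx : x ∈ tsupport φ
  · exact φ.contDiff.contDiffAt.div ψ.contDiff.contDiffAt (h hx)
  · have h0 : (fun x => φ x / ψ x) =ᶠ[nhds x] fun _ => 0 := by
      filter_upwards [(isClosed_tsupport φ).isOpen_compl.mem_nhds hx] with y hy
      rw [image_eq_zero_of_notMem_tsupport hy, zero_div]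
    exact contDiffAt_const.congr_of_eventuallyEq h0

/-- Division by `ψ`: an estimate known for one cut-off `ψ` passes to all test functions supported
where `ψ ≠ 0`. -/
lemma exists_mulTest_eq_of_tsupport_subset {Ω : Opens Plane} (φ ψ : 𝓓(Ω, ℝ))
    (h : tsupport φ ⊆ Function.support ψ) :
    ∃ (g : Plane → ℝ) (hg : ContDiff ℝ ∞ g), HasCompactSupport g ∧ mulTest g hg ψ = φ := by
  refine ⟨fun x => φ x / ψ x, contDiff_div_testFunction φ ψ h, ?_, ?_⟩
  · simp_rw [div_eq_mul_inv]
    exact φ.hasCompactSupport.mul_right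
  · ext x
    by_cases hx : ψ x = 0
    · have : φ x = 0 := by
        by_contra h'
        exact h (subset_tsupport _ h') hx
      simp [hx, this]
    · simp [hx]

lemma mulTest_eq_self {Ω : Opens Plane} {g : Plane → ℝ} (hg : ContDiff ℝ ∞ g) {φ : 𝓓(Ω, ℝ)}
    (h : ∀ x ∈ tsupport φ, g x = 1) : mulTest g hg φ = φ := by
  ext x
  by_cases hx : x ∈ tsupport φ
  · simp [h x hx]
  · simp [image_eq_zero_of_notMem_tsupport hx]

lemma sum_mulTest_eq_self {Ω : Opens Plane} {K : Set Plane} {s : Finset K} {χ : K → 𝓓(Ω, ℝ)}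
    (h : ∀ x ∈ K, ∑ i ∈ s, χ i x = 1) {φ : 𝓓(Ω, ℝ)} (hφ : tsupport φ ⊆ K) :
    ∑ i ∈ s, mulTest (χ i) (χ i).contDiff φ = φ := by
  ext x
  have h1 : (∑ i ∈ s, mulTest (χ i) (χ i).contDiff φ) x = ∑ i ∈ s, χ i x * φ x := by
    let ev : 𝓓(Ω, ℝ) →+ ℝ :=
      { toFun := fun u => u x
        map_zero' := rfl
        map_add' := fun _ _ => rfl }
    exact map_sum ev (fun i => mulTest (χ i) (χ i).contDiff φ) s
  rw [h1, ← Finset.sum_mul]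
  by_cases hx : x ∈ tsupport φ
  · rw [h x (hφ hx), one_mul]
  · rw [image_eq_zero_of_notMem_tsupport hx, mul_zero]

/-- Two distributions that agree locally are equal. -/
lemma eq_of_locally_eq {Ω : Opens Plane} {S T : 𝓓'(Ω, ℝ)}
    (h : ∀ x ∈ Ω, ∃ U, IsOpen U ∧ x ∈ U ∧ ∀ φ : 𝓓(Ω, ℝ), tsupport φ ⊆ U → S φ = T φ) :
    S = T := by
  choose! U hU hxU hST using h
  ext φ
  obtain ⟨s, χ, hχ, hsum⟩ := exists_finite_partition φ.hasCompactSupport φ.tsupport_subset U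
    (fun x hx => hU x (φ.tsupport_subset hx)) (fun x hx => hxU x (φ.tsupport_subset hx))
  rw [← sum_mulTest_eq_self hsum subset_rfl, map_sum, map_sum]
  refine Finset.sum_congr rfl fun i _ => ?_
  exact hST i (φ.tsupport_subset i.2) _ ((tsupport_mulTest_subset_left _ _ _).trans (hχ i))

/-! ### Regular directed points -/

section Regular

variable {Ω : Opens Plane} {T : 𝓓'(Ω, ℝ)} {N : ℕ} {x ξ : Plane}

lemma ConeDecayOn.mulTest {V : Set Plane} {ψ : 𝓓(Ω, ℝ)}
    (h : ConeDecayOn (localFourier T ψ) N V) {g : Plane → ℝ}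
    (hg : ContDiff ℝ ∞ g) (hc : HasCompactSupport g) :
    ConeDecayOn (localFourier T (mulTest g hg ψ)) N V := by
  rw [show localFourier T (MicroReLU.mulTest g hg ψ) = _ from
    funext fun η => localFourier_mulTest T ψ hg hc η]
  exact h.convolve hg hc

/-- Regularity provides a single cut-off `ψ`. Each `φ` supported in `{ψ ≠ 0}` is `ψ` times a test
function, and the stable form of decay survives the resulting convolution, with one cone for all
`φ`. -/
lemma IsRegularDirectedPoint.exists_coneDecayOn (h : IsRegularDirectedPoint T N x ξ)
    (hξ : ‖ξ‖ = 1) :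
    ∃ W V, IsOpen W ∧ x ∈ W ∧ IsOpenCone V ξ ∧
      ∀ φ : 𝓓(Ω, ℝ), tsupport φ ⊆ W → ConeDecayOn (localFourier T φ) N V := by
  obtain ⟨U, -, -, V, hV, hξV, hcone, ψ, -, hψx, C, hC, hbd⟩ := h
  obtain ⟨k, C', hC', hb⟩ := exists_norm_localFourier_le T ψ
  obtain ⟨V', hV', hdecay⟩ := exists_coneDecayOn_of_le hC' hb hV hξV hcone hξ hC.le hbd
  refine ⟨Function.support ψ, V', ψ.continuous.isOpen_support, by simp [hψx], hV', fun φ hφ => ?_⟩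
  obtain ⟨g, hg, hgc, rfl⟩ := exists_mulTest_eq_of_tsupport_subset φ ψ hφ
  exact hdecay.mulTest hg hgc

lemma isRegularDirectedPoint_of_coneDecayOn {V : Set Plane} {ψ : 𝓓(Ω, ℝ)} (hψ : ψ x = 1)
    (hV : IsOpenCone V ξ) (h : ConeDecayOn (localFourier T ψ) N V) :
    IsRegularDirectedPoint T N x ξ := by
  obtain ⟨C, P, hC, hbd⟩ := h
  -- The shift is taken to be `0`; `C + 1` is used because the constant has to be positive.
  refine ⟨Set.univ, isOpen_univ, trivial, V, hV.1, hV.2.1, hV.2.2, ψ, Set.subset_univ _, hψ, C + 1,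
    by positivity, fun η hη => ?_⟩
  have := hbd η hη 0
  rw [sub_zero, norm_zero, add_zero, one_pow, mul_one] at this
  rw [le_div_iff₀ (by positivity)]
  linarith

/-- Regularity of a directed point depends on the distribution near the point only, and is
preserved by multiplication with smooth functions. -/
lemma IsRegularDirectedPoint.of_locally_eq_mul {S : 𝓓'(Ω, ℝ)}
    (h : IsRegularDirectedPoint T N x ξ) (hξ : ‖ξ‖ = 1) (hx : x ∈ Ω) {g : Plane → ℝ}
    (hg : ContDiff ℝ ∞ g) {U : Set Plane} (hU : IsOpen U) (hxU : x ∈ U)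
    (hST : ∀ φ : 𝓓(Ω, ℝ), tsupport φ ⊆ U → S φ = T (MicroReLU.mulTest g hg φ)) :
    IsRegularDirectedPoint S N x ξ := by
  obtain ⟨W, V, hW, hxW, hV, hdecay⟩ := h.exists_coneDecayOn hξ
  obtain ⟨ψ, hψ, W', -, hxW', -, hψ1⟩ := exists_cutoff_nhds hx (hU.inter hW) ⟨hxU, hxW⟩
  refine isRegularDirectedPoint_of_coneDecayOn (hψ1 x hxW') hV ?_
  have heq : localFourier S ψ = localFourier T (MicroReLU.mulTest g hg ψ) := by
    ext η
    have hsub := fun (h : Plane → ℝ) hh =>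
      (tsupport_mulTest_subset h hh ψ).trans (hψ.trans Set.inter_subset_left)
    rw [localFourier, localFourier, hST _ (hsub _ _), hST _ (hsub _ _)]
    have hcomm : ∀ (h : Plane → ℝ) (hh : ContDiff ℝ ∞ h), MicroReLU.mulTest g hg
        (MicroReLU.mulTest h hh ψ) = MicroReLU.mulTest h hh (MicroReLU.mulTest g hg ψ) := by
      intro h hh
      ext y
      simp only [mulTest_apply]
      ring
    rw [hcomm, hcomm]
  rw [heq]
  exact hdecay _ ((tsupport_mulTest_subset _ _ _).trans (hψ.trans Set.inter_subset_right))

lemma notMem_WF_iff (hx : x ∈ Ω) (hξ : ‖ξ‖ = 1) :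
    (x, ξ) ∉ WF T ↔ ∀ N, IsRegularDirectedPoint T N x ξ := by
  simp [WF, wavefrontSetN, hx, hξ]

lemma mem_WF_imp (h : (x, ξ) ∈ WF T) : x ∈ Ω ∧ ‖ξ‖ = 1 := by
  simp only [WF, wavefrontSetN, Set.mem_iUnion, Set.mem_ofPred_eq] at h
  obtain ⟨_, h1, h2, _⟩ := h
  exact ⟨h1, by simpa using h2⟩

lemma mem_WF_of_locally_eq_mul {S : 𝓓'(Ω, ℝ)} {g : Plane → ℝ}
    (hg : ContDiff ℝ ∞ g) {U : Set Plane} (hU : IsOpen U) (hxU : x ∈ U)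
    (hST : ∀ φ : 𝓓(Ω, ℝ), tsupport φ ⊆ U → S φ = T (MicroReLU.mulTest g hg φ))
    (h : (x, ξ) ∈ WF S) : (x, ξ) ∈ WF T := by
  obtain ⟨hx, hξ⟩ := mem_WF_imp h
  by_contra hn
  rw [notMem_WF_iff hx hξ] at hn
  exact (notMem_WF_iff hx hξ).mpr
    (fun N => (hn N).of_locally_eq_mul hξ hx hg hU hxU hST) h

lemma mem_WF_of_locally_eq {S : 𝓓'(Ω, ℝ)} {U : Set Plane} (hU : IsOpen U) (hxU : x ∈ U)
    (hST : ∀ φ : 𝓓(Ω, ℝ), tsupport φ ⊆ U → S φ = T φ) (h : (x, ξ) ∈ WF S) : (x, ξ) ∈ WF T := by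
  refine mem_WF_of_locally_eq_mul (g := fun _ => 1) contDiff_const hU hxU (fun φ hφ => ?_) h
  rw [hST φ hφ, mulTest_eq_self _ fun _ _ => rfl]

end Regular

/-! ### Products of distributions -/

/-- Integration of Schwartz functions against a function of polynomial growth. -/
lemma exists_integral_mul_CLM {F : Plane → ℂ} (hF : StronglyMeasurable F) {C : ℝ} {M : ℕ}
    (hC : 0 ≤ C) (hb : ∀ ζ, ‖F ζ‖ ≤ C * (1 + ‖ζ‖) ^ M) :
    ∃ A : 𝓢(Plane, ℂ) →L[ℝ] ℂ, ∀ u, A u = ∫ ζ, u ζ * F ζ := by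
  have hI : Integrable (fun ζ : Plane => (1 + ‖ζ‖) ^ (-(3 : ℝ))) :=
    integrable_one_add_norm (by simp; norm_num)
  let p : 𝓢(Plane, ℂ) → ℝ := fun u => 2 ^ (M + 3) * ((Finset.Iic (M + 3, 0)).sup
    fun m => SchwartzMap.seminorm ℝ m.1 m.2) u
  have hp : ∀ u ζ, ‖u ζ * F ζ‖ ≤ C * p u * (1 + ‖ζ‖) ^ (-(3 : ℝ)) := by
    intro u ζ
    have h1 := SchwartzMap.one_add_le_sup_seminorm_apply (𝕜 := ℝ) (m := (M + 3, 0)) (k := M + 3)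
      (n := 0) le_rfl le_rfl u ζ
    rw [norm_iteratedFDeriv_zero] at h1
    have h2 : (0 : ℝ) < 1 + ‖ζ‖ := by positivity
    rw [Real.rpow_neg h2.le, ← div_eq_mul_inv, le_div_iff₀ (by positivity), norm_mul]
    have h3 : (1 + ‖ζ‖) ^ (3 : ℝ) = (1 + ‖ζ‖) ^ 3 := by exact_mod_cast Real.rpow_natCast _ 3
    rw [h3]
    calc ‖u ζ‖ * ‖F ζ‖ * (1 + ‖ζ‖) ^ 3 ≤ ‖u ζ‖ * (C * (1 + ‖ζ‖) ^ M) * (1 + ‖ζ‖) ^ 3 := by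
          gcongr
          exact hb ζ
      _ = C * ((1 + ‖ζ‖) ^ (M + 3) * ‖u ζ‖) := by ring
      _ ≤ C * p u := by gcongr
  have hint : ∀ u : 𝓢(Plane, ℂ), Integrable fun ζ => u ζ * F ζ := fun u =>
    (hI.const_mul (C * p u)).mono'
      (u.continuous.aestronglyMeasurable.mul hF.aestronglyMeasurable)
      (Filter.Eventually.of_forall (hp u))
  refine ⟨SchwartzMap.mkCLMtoNormedSpace (σ := RingHom.id ℝ) (fun u => ∫ ζ, u ζ * F ζ)
    (fun u v => ?_) (fun a u => ?_)
    ⟨Finset.Iic (M + 3, 0), C * 2 ^ (M + 3) * ∫ ζ : Plane, (1 + ‖ζ‖) ^ (-(3 : ℝ)), ?_, fun u => ?_⟩,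
    fun u => rfl⟩
  · rw [← integral_add (hint u) (hint v)]
    congr 1
    ext ζ
    simp [add_mul]
  · rw [RingHom.id_apply, ← integral_smul]
    congr 1
    ext ζ
    simp [mul_assoc]
  · have : 0 ≤ ∫ ζ : Plane, (1 + ‖ζ‖) ^ (-(3 : ℝ)) := integral_nonneg fun ζ => by positivity
    positivity
  · refine (norm_integral_le_of_norm_le (hI.const_mul (C * p u))
      (Filter.Eventually.of_forall (hp u))).trans (le_of_eq ?_)
    rw [integral_const_mul]
    change C * (2 ^ (M + 3) * ((Finset.Iic (M + 3, 0)).sup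
      fun m => SchwartzMap.seminorm ℝ m.1 m.2) u) * _ = _ * ((Finset.Iic (M + 3, 0)).sup
      fun m => SchwartzMap.seminorm ℝ m.1 m.2) u
    ring

/-- The distribution whose Fourier transform is a given function of polynomial growth. -/
lemma exists_distribution_eq_integral_ft (Ω : Opens Plane) {F : Plane → ℂ}
    (hF : StronglyMeasurable F) {C : ℝ} {M : ℕ} (hC : 0 ≤ C)
    (hb : ∀ ζ, ‖F ζ‖ ≤ C * (1 + ‖ζ‖) ^ M) :
    ∃ w : 𝓓'(Ω, ℝ), ∀ φ : 𝓓(Ω, ℝ), w φ = (∫ ζ, ft φ ζ * F ζ).re := by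
  obtain ⟨A, hA⟩ := exists_integral_mul_CLM hF hC hb
  let L : 𝓢(Plane, ℝ) →L[ℝ] ℝ := Complex.reCLM ∘L A ∘L
    (FourierTransform.fourierCLM ℝ 𝓢(Plane, ℂ)) ∘L SchwartzMap.postcompCLM Complex.ofRealCLM
  let w : 𝓓'(Ω, ℝ) :=
    { toFun := fun φ => L (testToSchwartz φ)
      map_add' := fun a b => by
        have := (testToSchwartzLM Ω).map_add a b
        change testToSchwartz (a + b) = testToSchwartz a + testToSchwartz b at this
        rw [this, Submodule.coe_add, map_add]
      map_smul' := fun c a => by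
        have := (testToSchwartzLM Ω).map_smul c a
        change testToSchwartz (c • a) = c • testToSchwartz a at this
        rw [this, Submodule.coe_smul, map_smul]
        rfl
      cont := L.continuous.comp (continuous_subtype_val.comp (continuous_testToSchwartzLM Ω)) }
  refine ⟨w, fun φ => ?_⟩
  change (A (𝓕 (SchwartzMap.postcompCLM Complex.ofRealCLM (testToSchwartz φ : 𝓢(Plane, ℝ))))).re = _
  rw [hA, SchwartzMap.fourier_coe]
  rfl

section Product

variable {Ω : Opens Plane} (u v : 𝓓'(Ω, ℝ))

lemma localFourier_neg (φ : 𝓓(Ω, ℝ)) (η : Plane) :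
    localFourier u φ (-η) = (starRingEnd ℂ) (localFourier u φ η) := by
  have h1 : mulTest _ (contDiff_cosWave (-η)) φ = mulTest _ (contDiff_cosWave η) φ := by
    ext x
    simp
  have h2 : mulTest _ (contDiff_sinWave (-η)) φ = -mulTest _ (contDiff_sinWave η) φ := by
    ext x
    change _ = -(_ : ℝ)
    simp
  rw [localFourier, localFourier, h1, h2, map_neg]
  simp

lemma localFourier_sum {ι : Type*} (s : Finset ι) (φ : ι → 𝓓(Ω, ℝ)) (η : Plane) :
    localFourier u (∑ i ∈ s, φ i) η = ∑ i ∈ s, localFourier u (φ i) η := by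
  simp only [localFourier, map_sum, Complex.ofReal_sum, Finset.mul_sum, Finset.sum_sub_distrib]

lemma localFourier_wave (φ : 𝓓(Ω, ℝ)) (ξ η : Plane) :
    localFourier u (mulTest _ (contDiff_cosWave ξ) φ) η -
      Complex.I * localFourier u (mulTest _ (contDiff_sinWave ξ) φ) η =
      localFourier u φ (η + ξ) := by
  have h1 : mulTest _ (contDiff_cosWave (η + ξ)) φ =
      mulTest _ (contDiff_cosWave η) (mulTest _ (contDiff_cosWave ξ) φ) -
      mulTest _ (contDiff_sinWave η) (mulTest _ (contDiff_sinWave ξ) φ) := by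
    ext x
    change _ = (_ : ℝ) - _
    simp only [mulTest_apply]
    rw [inner_add_right, mul_add, Real.cos_add]
    ring
  have h2 : mulTest _ (contDiff_sinWave (η + ξ)) φ =
      mulTest _ (contDiff_sinWave η) (mulTest _ (contDiff_cosWave ξ) φ) +
      mulTest _ (contDiff_cosWave η) (mulTest _ (contDiff_sinWave ξ) φ) := by
    ext x
    change _ = (_ : ℝ) + _
    simp only [mulTest_apply]
    rw [inner_add_right, mul_add, Real.sin_add]
    ring
  simp only [localFourier, h1, h2, map_sub, map_add]
  push_cast
  linear_combination (u (mulTest _ (contDiff_sinWave η) (mulTest _ (contDiff_sinWave ξ) φ)) : ℂ) *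
    Complex.I_mul_I

lemma mulTest_comm {g h : Plane → ℝ} (hg : ContDiff ℝ ∞ g) (hh : ContDiff ℝ ∞ h) (φ : 𝓓(Ω, ℝ)) :
    mulTest g hg (mulTest h hh φ) = mulTest h hh (mulTest g hg φ) := by
  ext x
  simp only [mulTest_apply]
  ring

lemma mulTest_swap (φ ψ : 𝓓(Ω, ℝ)) : mulTest φ φ.contDiff ψ = mulTest ψ ψ.contDiff φ := by
  ext x
  simp only [mulTest_apply]
  ring

/-- The value of the product of `u` and `v` on the test function `φ ψ`, computed with the Fourier
transforms of `φ u` and `ψ v`. -/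
noncomputable def pairing (φ ψ : 𝓓(Ω, ℝ)) : ℂ :=
  ∫ η, localFourier u φ η * localFourier v ψ (-η)

/-- The local convolutions of the Fourier transforms of `u` and `v` over `U` converge. -/
def GoodOn (U : Set Plane) : Prop :=
  ∀ φ ψ : 𝓓(Ω, ℝ), tsupport φ ⊆ U → tsupport ψ ⊆ U →
    ConvBounded (localFourier u φ) (localFourier v ψ)

variable {u v}

lemma GoodOn.mono {U U' : Set Plane} (h : GoodOn u v U) (hU : U' ⊆ U) : GoodOn u v U' :=
  fun φ ψ hφ hψ => h φ ψ (hφ.trans hU) (hψ.trans hU)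

/-- All data are real, so both transforms are Hermitian and `η ↦ -η` conjugates the integrand. Hence
the pairing can be a value of a real distribution. -/
lemma pairing_conj (φ ψ : 𝓓(Ω, ℝ)) : (starRingEnd ℂ) (pairing u v φ ψ) = pairing u v φ ψ := by
  rw [pairing, ← integral_conj, ← integral_neg_eq_self]
  congr 1
  ext η
  rw [map_mul, ← localFourier_neg, ← localFourier_neg]
  simp

lemma ofReal_re_pairing (φ ψ : 𝓓(Ω, ℝ)) : ((pairing u v φ ψ).re : ℂ) = pairing u v φ ψ :=
  Complex.conj_eq_iff_re.mp (pairing_conj φ ψ)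

lemma pairing_mulTest_left {φ ψ : 𝓓(Ω, ℝ)}
    (h : ConvBounded (localFourier u φ) (localFourier v ψ)) {g : Plane → ℝ}
    (hg : ContDiff ℝ ∞ g) (hc : HasCompactSupport g) :
    pairing u v (mulTest g hg φ) ψ =
      ∫ ξ, ft g ξ * ∫ η, localFourier u φ η * localFourier v ψ (-ξ - η) := by
  have := h.convolve_left (stronglyMeasurable_localFourier u φ)
    (stronglyMeasurable_localFourier v ψ) hg hc 0
  simp only [zero_sub] at this
  rw [← this, pairing]
  congr 1
  ext η
  rw [localFourier_mulTest u φ hg hc]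

lemma pairing_mulTest_right {φ ψ : 𝓓(Ω, ℝ)}
    (h : ConvBounded (localFourier u φ) (localFourier v ψ)) {g : Plane → ℝ}
    (hg : ContDiff ℝ ∞ g) (hc : HasCompactSupport g) :
    pairing u v φ (mulTest g hg ψ) =
      ∫ ξ, ft g ξ * ∫ η, localFourier u φ η * localFourier v ψ (-ξ - η) := by
  have := h.convolve_right (stronglyMeasurable_localFourier u φ)
    (stronglyMeasurable_localFourier v ψ) hg hc 0
  simp only [zero_sub] at this
  rw [← this, pairing]
  congr 1
  ext η
  rw [localFourier_mulTest v ψ hg hc]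

/-- Both sides are the same iterated integral against `ft g`. -/
lemma pairing_mulTest_comm {φ ψ : 𝓓(Ω, ℝ)}
    (h : ConvBounded (localFourier u φ) (localFourier v ψ)) {g : Plane → ℝ}
    (hg : ContDiff ℝ ∞ g) (hc : HasCompactSupport g) :
    pairing u v (mulTest g hg φ) ψ = pairing u v φ (mulTest g hg ψ) := by
  rw [pairing_mulTest_left h hg hc, pairing_mulTest_right h hg hc]

/-- Writing `φ = ψ' φ` and moving `ψ'` across turns the left side into the pairing of `φ` with `ψ'
ψ`, which is symmetric in the two cut-offs. -/
lemma pairing_eq_of_eq_one {φ ψ ψ' : 𝓓(Ω, ℝ)}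
    (h : ConvBounded (localFourier u φ) (localFourier v ψ))
    (h' : ConvBounded (localFourier u φ) (localFourier v ψ'))
    (hψ : ∀ x ∈ tsupport φ, ψ x = 1) (hψ' : ∀ x ∈ tsupport φ, ψ' x = 1) :
    pairing u v φ ψ = pairing u v φ ψ' := by
  have h1 := pairing_mulTest_comm h ψ'.contDiff ψ'.hasCompactSupport
  have h2 := pairing_mulTest_comm h' ψ.contDiff ψ.hasCompactSupport
  rw [mulTest_eq_self _ hψ'] at h1
  rw [mulTest_eq_self _ hψ] at h2
  rw [h1, h2, mulTest_swap]

/-- `w` is given by the pairing of `u` and `v` wherever the local convolutions converge. -/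
def IsLocalProduct (u v w : 𝓓'(Ω, ℝ)) : Prop :=
  ∀ U, IsOpen U → GoodOn u v U → ∀ φ ψ : 𝓓(Ω, ℝ), tsupport φ ⊆ U → tsupport ψ ⊆ U →
    (∀ x ∈ tsupport φ, ψ x = 1) → (w φ : ℂ) = pairing u v φ ψ

/-- One factor `ψ` of `g ψ²` is moved to the second slot, where the auxiliary cut-off `ψ'`
disappears because it is 1 on the support of `ψ`. Taking cosine and sine waves for `g` shifts the
first transform by `ξ`, and a translation of the variable gives the convolution. -/
lemma IsLocalProduct.localFourier_eq {w : 𝓓'(Ω, ℝ)} (hw : IsLocalProduct u v w) {U : Set Plane}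
    (hU : IsOpen U) (hgood : GoodOn u v U) {ψ : 𝓓(Ω, ℝ)} (hψ : tsupport ψ ⊆ U) (ξ : Plane) :
    localFourier w (mulTest ψ ψ.contDiff ψ) ξ =
      ∫ η, localFourier u ψ η * localFourier v ψ (ξ - η) := by
  obtain ⟨ψ', hψ'U, W, -, hW, hψ'⟩ := exists_cutoff ψ.hasCompactSupport hU hψ ψ.tsupport_subset
  have key : ∀ (g : Plane → ℝ) (hg : ContDiff ℝ ∞ g),
      (w (mulTest g hg (mulTest ψ ψ.contDiff ψ)) : ℂ) = pairing u v (mulTest g hg ψ) ψ := by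
    intro g hg
    have hsub : tsupport (mulTest g hg ψ) ⊆ U := (tsupport_mulTest_subset _ _ _).trans hψ
    rw [mulTest_comm hg, hw U hU hgood _ ψ' ((tsupport_mulTest_subset _ _ _).trans hsub) hψ'U
      (fun x hx => hψ' x (hW (tsupport_mulTest_subset_left _ _ _ hx))),
      pairing_mulTest_comm (hgood _ _ hsub hψ'U) ψ.contDiff ψ.hasCompactSupport,
      mulTest_swap, mulTest_eq_self ψ'.contDiff fun x hx => hψ' x (hW hx)]
  rw [localFourier, key, key, pairing, pairing, ← integral_const_mul, ← integral_sub]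
  · rw [← integral_add_right_eq_self (fun η => localFourier u ψ η * localFourier v ψ (ξ - η)) ξ]
    congr 1
    ext η
    rw [← localFourier_wave]
    simp only [sub_add_cancel_right]
    ring
  · exact (hgood _ _ ((tsupport_mulTest_subset _ _ _).trans hψ) hψ).integrable_neg
  · exact (hgood _ _ ((tsupport_mulTest_subset _ _ _).trans hψ) hψ).integrable_neg.const_mul _

lemma IsLocalProduct.isProduct {w : 𝓓'(Ω, ℝ)} (hw : IsLocalProduct u v w)
    (h : ∀ x ∈ Ω, ∃ U, IsOpen U ∧ x ∈ U ∧ GoodOn u v U) : IsProduct u v w := by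
  intro x hx U hU hxU
  obtain ⟨U', hU', hxU', hgood⟩ := h x hx
  obtain ⟨ψ, hψ, W, hW, hxW, -, hψ1⟩ := exists_cutoff_nhds hx (hU.inter hU') ⟨hxU, hxU'⟩
  refine ⟨ψ, hψ.trans Set.inter_subset_left, Filter.eventually_of_mem (hW.mem_nhds hxW) hψ1,
    fun ξ => ?_⟩
  have hψ' := hψ.trans Set.inter_subset_right
  exact ⟨(hgood _ _ hψ' hψ').integrable ξ, hw.localFourier_eq hU' hgood hψ' ξ⟩

/-- A `φ` supported where `ψ₀ = 1` equals `φ ψ₀²`, so `w φ` is the integral of `ft φ` against the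
transform of `ψ₀² w`. The product formula turns this into a pairing with `ψ₀`, and the choice of
cut-off does not matter. -/
lemma IsProduct.locally_eq_pairing {w : 𝓓'(Ω, ℝ)} (hw : IsProduct u v w) {U : Set Plane}
    (hU : IsOpen U) (hgood : GoodOn u v U) {x : Plane} (hx : x ∈ Ω) (hxU : x ∈ U) :
    ∃ W, IsOpen W ∧ x ∈ W ∧ W ⊆ U ∧ ∀ φ ψ : 𝓓(Ω, ℝ), tsupport φ ⊆ W → tsupport ψ ⊆ U →
      (∀ x ∈ tsupport φ, ψ x = 1) → (w φ : ℂ) = pairing u v φ ψ := by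
  obtain ⟨ψ₀, hψ₀U, hψ₀, hprod⟩ := hw x hx U hU hxU
  obtain ⟨W, hWψ, hW, hxW⟩ := eventually_nhds_iff.mp hψ₀
  have hWU : W ⊆ U := fun y hy => hψ₀U (subset_tsupport _ (by simp [hWψ y hy]))
  refine ⟨W, hW, hxW, hWU, fun φ ψ hφ hψU hψ => ?_⟩
  have hφ1 : mulTest φ φ.contDiff (mulTest ψ₀ ψ₀.contDiff ψ₀) = φ := by
    rw [mulTest_swap, mulTest_eq_self]
    intro y hy
    simp [hWψ y (hφ hy)]
  have hg := hgood _ _ hψ₀U hψ₀U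
  have h1 := apply_mulTest w (mulTest ψ₀ ψ₀.contDiff ψ₀) φ.contDiff φ.hasCompactSupport
  simp_rw [(hprod _).2] at h1
  rw [hφ1, ← pairing_mulTest_left hg φ.contDiff φ.hasCompactSupport, mulTest_swap,
    mulTest_eq_self ψ₀.contDiff fun y hy => hWψ y (hφ hy)] at h1
  rw [h1]
  exact pairing_eq_of_eq_one (hgood _ _ (hφ.trans hWU) hψ₀U) (hgood _ _ (hφ.trans hWU) hψU)
    (fun y hy => hWψ y (hφ hy)) hψ

lemma IsProduct.unique {w w' : 𝓓'(Ω, ℝ)} (hw : IsProduct u v w) (hw' : IsProduct u v w')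
    (h : ∀ x ∈ Ω, ∃ U, IsOpen U ∧ x ∈ U ∧ GoodOn u v U) : w = w' := by
  refine eq_of_locally_eq fun x hx => ?_
  obtain ⟨U, hU, hxU, hgood⟩ := h x hx
  obtain ⟨W, hW, hxW, hWU, hloc⟩ := hw.locally_eq_pairing hU hgood hx hxU
  obtain ⟨W', hW', hxW', -, hloc'⟩ := hw'.locally_eq_pairing hU hgood hx hxU
  refine ⟨W ∩ W', hW.inter hW', ⟨hxW, hxW'⟩, fun φ hφ => ?_⟩
  obtain ⟨ψ, hψU, V, -, hV, hψ⟩ := exists_cutoff φ.hasCompactSupport hU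
    (hφ.trans (Set.inter_subset_left.trans hWU)) φ.tsupport_subset
  have h1 := hloc φ ψ (hφ.trans Set.inter_subset_left) hψU fun y hy => hψ y (hV hy)
  have h2 := hloc' φ ψ (hφ.trans Set.inter_subset_right) hψU fun y hy => hψ y (hV hy)
  exact_mod_cast h1.trans h2.symm

/-- The distribution is a finite sum of pairings of `φ χ i` with `ψ i`, for a partition of unity
`χ`. Each summand is continuous in `φ`, being the integral of `ft φ` against a function of
polynomial growth. -/
lemma exists_isLocalProduct_of_compact (h : ∀ x ∈ Ω, ∃ U, IsOpen U ∧ x ∈ U ∧ GoodOn u v U)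
    {K : Set Plane} (hK : IsCompact K) (hKΩ : K ⊆ Ω) :
    ∃ w : 𝓓'(Ω, ℝ), ∀ U, IsOpen U → GoodOn u v U → ∀ φ ψ : 𝓓(Ω, ℝ), tsupport φ ⊆ K →
      tsupport φ ⊆ U → tsupport ψ ⊆ U → (∀ x ∈ tsupport φ, ψ x = 1) →
      (w φ : ℂ) = pairing u v φ ψ := by
  choose! U hU hxU hgood using h
  obtain ⟨s, χ, hχ, hsum⟩ := exists_finite_partition hK hKΩ U
    (fun x hx => hU x (hKΩ hx)) (fun x hx => hxU x (hKΩ hx))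
  have hcut : ∀ i : K, ∃ ψ : 𝓓(Ω, ℝ), tsupport ψ ⊆ U i ∧ ∀ y ∈ tsupport (χ i), ψ y = 1 := by
    intro i
    obtain ⟨ψ, hψU, W, -, hW, hψ⟩ := exists_cutoff (χ i).hasCompactSupport (hU i (hKΩ i.2)) (hχ i)
      (χ i).tsupport_subset
    exact ⟨ψ, hψU, fun y hy => hψ y (hW hy)⟩
  choose ψ hψU hψ using hcut
  have hgi : ∀ i : K, ConvBounded (localFourier u (χ i)) (localFourier v (ψ i)) :=
    fun i => hgood i (hKΩ i.2) _ _ (hχ i) (hψU i)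
  have hwi : ∀ i : K, ∃ w : 𝓓'(Ω, ℝ), ∀ φ : 𝓓(Ω, ℝ),
      (w φ : ℂ) = pairing u v (mulTest φ φ.contDiff (χ i)) (ψ i) := by
    intro i
    obtain ⟨C, M, hC, hb⟩ := (hgi i).norm_integral_le
    have hm : StronglyMeasurable fun ξ =>
        ∫ η, localFourier u (χ i) η * localFourier v (ψ i) (-ξ - η) := by
      have h1 := (stronglyMeasurable_localFourier u (χ i)).measurable
      have h2 := (stronglyMeasurable_localFourier v (ψ i)).measurable
      refine StronglyMeasurable.integral_prod_right
        (f := fun ξ η => localFourier u (χ i) η * localFourier v (ψ i) (-ξ - η))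
        (Measurable.stronglyMeasurable ?_)
      change Measurable fun p : Plane × Plane =>
        localFourier u (χ i) p.2 * localFourier v (ψ i) (-p.1 - p.2)
      fun_prop
    obtain ⟨w, hw⟩ := exists_distribution_eq_integral_ft Ω hm hC
      (fun ξ => (hb (-ξ)).trans_eq (by rw [norm_neg]))
    refine ⟨w, fun φ => ?_⟩
    rw [hw φ, ← pairing_mulTest_left (hgi i) φ.contDiff φ.hasCompactSupport, ofReal_re_pairing]
  choose w hw using hwi
  refine ⟨∑ i ∈ s, w i, fun V hV hgV φ ψ' hφK hφV hψ'V hψ' => ?_⟩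
  have happ : (∑ i ∈ s, w i) φ = ∑ i ∈ s, w i φ := by
    let ev : 𝓓'(Ω, ℝ) →+ ℝ :=
      { toFun := fun T => T φ
        map_zero' := rfl
        map_add' := fun _ _ => rfl }
    exact map_sum ev w s
  -- Independence of the cut-off replaces all the `ψ i` by the given `ψ'`; linearity in the first
  -- slot then recombines the partition.
  have hi : ∀ i ∈ s, (w i φ : ℂ) = pairing u v (mulTest (χ i) (χ i).contDiff φ) ψ' := by
    intro i _
    rw [hw, mulTest_swap]
    have hsub := tsupport_mulTest_subset (χ i) (χ i).contDiff φ
    have hsub' := tsupport_mulTest_subset_left (χ i) (χ i).contDiff φ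
    exact pairing_eq_of_eq_one (hgood i (hKΩ i.2) _ _ (hsub'.trans (hχ i)) (hψU i))
      (hgV _ _ (hsub.trans hφV) hψ'V) (fun y hy => hψ i y (hsub' hy)) (fun y hy => hψ' y (hsub hy))
  rw [happ, Complex.ofReal_sum, Finset.sum_congr rfl hi]
  simp only [pairing]
  rw [← integral_finsetSum]
  · simp_rw [← Finset.sum_mul, ← localFourier_sum]
    rw [sum_mulTest_eq_self hsum hφK]
  · intro i _
    exact (hgV _ _ ((tsupport_mulTest_subset _ _ _).trans hφV) hψ'V).integrable_neg

/-- The distributions found over two compact sets agree on common test functions, since both are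
given by the same pairings after a partition of unity. The inductive limit topology then supplies
continuity. -/
lemma exists_isLocalProduct (h : ∀ x ∈ Ω, ∃ U, IsOpen U ∧ x ∈ U ∧ GoodOn u v U) :
    ∃ w : 𝓓'(Ω, ℝ), IsLocalProduct u v w := by
  have hK := fun (K : Compacts Plane) (hKΩ : (K : Set Plane) ⊆ Ω) =>
    exists_isLocalProduct_of_compact h K.isCompact hKΩ
  choose w hw using hK
  have heq : ∀ (K K' : Compacts Plane) (hKΩ : (K : Set Plane) ⊆ Ω) (hKΩ' : (K' : Set Plane) ⊆ Ω)
      (φ : 𝓓(Ω, ℝ)), tsupport φ ⊆ K → tsupport φ ⊆ K' → w K hKΩ φ = w K' hKΩ' φ := by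
    intro K K' hKΩ hKΩ' φ hφ hφ'
    choose! U hU hxU hgood using h
    obtain ⟨s, χ, hχ, hsum⟩ := exists_finite_partition φ.hasCompactSupport φ.tsupport_subset U
      (fun x hx => hU x (φ.tsupport_subset hx)) (fun x hx => hxU x (φ.tsupport_subset hx))
    rw [← sum_mulTest_eq_self hsum subset_rfl, map_sum, map_sum]
    refine Finset.sum_congr rfl fun i _ => ?_
    have hsub := tsupport_mulTest_subset (χ i) (χ i).contDiff φ
    have hsub' := tsupport_mulTest_subset_left (χ i) (χ i).contDiff φ
    have hiΩ := φ.tsupport_subset i.2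
    obtain ⟨ψ, hψU, W, -, hW, hψ⟩ := exists_cutoff
      (mulTest (χ i) (χ i).contDiff φ).hasCompactSupport (hU i hiΩ) (hsub'.trans (hχ i))
      (TestFunction.tsupport_subset _)
    have h1 := hw K hKΩ (U i) (hU i hiΩ) (hgood i hiΩ) _ ψ (hsub.trans hφ) (hsub'.trans (hχ i)) hψU
      fun y hy => hψ y (hW hy)
    have h2 := hw K' hKΩ' (U i) (hU i hiΩ) (hgood i hiΩ) _ ψ (hsub.trans hφ') (hsub'.trans (hχ i))
      hψU fun y hy => hψ y (hW hy)
    exact_mod_cast h1.trans h2.symm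
  let L : 𝓓(Ω, ℝ) →L[ℝ] ℝ := TestFunction.limitCLM ℝ
    (fun φ => w ⟨tsupport φ, φ.hasCompactSupport⟩ φ.tsupport_subset φ)
    (fun K hK =>
      { toFun := fun φ => w K hK (TestFunction.ofSupportedInCLM ℝ hK φ)
        map_add' := fun a b => by rw [map_add, map_add]
        map_smul' := fun c a => by rw [map_smul, map_smul]; rfl
        cont := (map_continuous (w K hK)).comp (TestFunction.ofSupportedInCLM ℝ hK).continuous })
    (fun K hK φ => heq _ _ _ _ _ subset_rfl φ.tsupport_subset)
  let W : 𝓓'(Ω, ℝ) :=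
    { toFun := L
      map_add' := L.map_add
      map_smul' := L.map_smul
      cont := L.continuous }
  refine ⟨W, fun U hU hg φ ψ hφ hψ h1 => ?_⟩
  exact hw ⟨tsupport φ, φ.hasCompactSupport⟩ φ.tsupport_subset U hU hg φ ψ subset_rfl hφ hψ h1

end Product

/-! ### Square-integrable distributions -/

/-- The Fourier transform of an integrable and square-integrable function is
square-integrable. -/
lemma memLp_fourier {u : Plane → ℂ} (h1 : Integrable u) (h2 : MemLp u 2) : MemLp (𝓕 u) 2 := by
  let f : Lp ℂ 2 (volume : Measure Plane) := h2.toLp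
  have hcont : Continuous (𝓕 u) := VectorFourier.fourierIntegral_continuous
    Real.continuous_fourierChar continuous_inner h1
  -- The Plancherel extension and the Fourier integral agree almost everywhere: tested against a
  -- smooth compactly supported `G`, both give the integral of `𝓕 G` times `u`.
  have hae : ∀ᵐ x, (𝓕 f : Lp ℂ 2 (volume : Measure Plane)) x = 𝓕 u x := by
    refine ae_eq_of_integral_contDiff_smul_eq ?_ hcont.locallyIntegrable fun g hg hc => ?_
    · exact (Lp.memLp (𝓕 f)).locallyIntegrable (by norm_num)
    · let G : 𝓢(Plane, ℂ) := complexSchwartz hg hc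
      have e1 : ∫ x, g x • (𝓕 f : Lp ℂ 2 (volume : Measure Plane)) x =
          Lp.toTemperedDistribution (𝓕 f : Lp ℂ 2 (volume : Measure Plane)) G := by
        rw [Lp.toTemperedDistribution_apply]
        rfl
      have e2 : ∫ x, g x • 𝓕 u x = ∫ x, 𝓕 (G : Plane → ℂ) x * u x := by
        have := VectorFourier.integral_fourierIntegral_smul_eq_flip (μ := (volume : Measure Plane))
          (ν := (volume : Measure Plane)) (L := innerₗ Plane) (f := G) (g := u)
          Real.continuous_fourierChar continuous_inner G.integrable h1
        rw [flip_innerₗ] at this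
        exact this.symm
      rw [e1, e2, ← Lp.fourier_toTemperedDistribution_eq, TemperedDistribution.fourier_apply,
        Lp.toTemperedDistribution_apply, SchwartzMap.fourier_coe]
      refine integral_congr_ae ?_
      filter_upwards [h2.coeFn_toLp] with x hx
      rw [hx, smul_eq_mul]
  exact (Lp.memLp (𝓕 f)).ae_eq hae

/-- Cauchy–Schwarz; translation invariance makes the bound uniform in `ζ`, hence degree 0. -/
lemma convBounded_of_memLp {a b : Plane → ℂ} (ha : MemLp a 2) (hb : MemLp b 2) :
    ConvBounded a b := by
  refine ⟨(∫ η, ‖a η‖ ^ (2 : ℝ)) ^ (1 / 2 : ℝ) * (∫ η, ‖b η‖ ^ (2 : ℝ)) ^ (1 / 2 : ℝ), 0,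
    by positivity, fun ζ => ?_⟩
  have hb' : MemLp (fun η => b (ζ - η)) 2 :=
    hb.comp_measurePreserving (Measure.measurePreserving_sub_left volume ζ)
  refine ⟨ha.integrable_mul hb', ?_⟩
  have h1 := integral_mul_norm_le_Lp_mul_Lq (μ := (volume : Measure Plane))
      (f := a) (g := fun η => b (ζ - η)) (p := 2) (q := 2)
      Real.HolderConjugate.two_two (by simpa using ha) (by simpa using hb')
  rw [integral_sub_left_eq_self (fun η => ‖b η‖ ^ (2 : ℝ)) volume ζ] at h1
  simpa using h1

section Functions

variable {Ω : Opens Plane} {T : 𝓓'(Ω, ℝ)} {h : Plane → ℝ} {U : Set Plane} {ψ : 𝓓(Ω, ℝ)}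

lemma localFourier_eq_fourier
    (hT : ∀ φ : 𝓓(Ω, ℝ), tsupport φ ⊆ U → T φ = ∫ x, h x * φ x) (hψU : tsupport ψ ⊆ U)
    (hint : Integrable fun x => h x * ψ x) (η : Plane) :
    localFourier T ψ η = 𝓕 (fun x => ((h x * ψ x : ℝ) : ℂ)) η := by
  have hw : ∀ (w : Plane → ℝ) (hw : ContDiff ℝ ∞ w), (∀ x, |w x| ≤ 1) →
      Integrable fun x => h x * mulTest w hw ψ x := by
    intro w hw hw1
    refine (hint.bdd_mul (c := 1) hw.continuous.aestronglyMeasurable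
      (Filter.Eventually.of_forall hw1)).congr (Filter.Eventually.of_forall fun x => ?_)
    simp only [mulTest_apply]
    exact mul_left_comm _ _ _
  rw [localFourier, hT _ ((tsupport_mulTest_subset _ _ _).trans hψU),
    hT _ ((tsupport_mulTest_subset _ _ _).trans hψU), ← integral_complex_ofReal,
    ← integral_complex_ofReal, ← integral_const_mul, ← integral_sub, Real.fourier_eq']
  · congr 1
    ext x
    have h1 : ((-2 * Real.pi * inner ℝ x η : ℝ) : ℂ) * Complex.I =
      (((-(2 * Real.pi * inner ℝ x η) : ℝ) : ℂ)) * Complex.I := by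
      push_cast
      ring
    rw [h1, Complex.exp_mul_I, ← Complex.ofReal_cos, ← Complex.ofReal_sin, Real.cos_neg,
      Real.sin_neg]
    simp only [mulTest_apply, smul_eq_mul]
    push_cast
    ring
  · exact Integrable.ofReal (hw _ (contDiff_cosWave η) fun x => Real.abs_cos_le_one _)
  · exact (Integrable.ofReal (hw _ (contDiff_sinWave η) fun x => Real.abs_sin_le_one _)).const_mul _

lemma memLp_localFourier
    (hT : ∀ φ : 𝓓(Ω, ℝ), tsupport φ ⊆ U → T φ = ∫ x, h x * φ x) (hψU : tsupport ψ ⊆ U)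
    (hint : MemLp (fun x => h x * ψ x) 2) : MemLp (localFourier T ψ) 2 := by
  have h1 : Integrable fun x => h x * ψ x := by
    have h2 : (fun x => h x * ψ x) = (tsupport ψ).indicator fun x => h x * ψ x := by
      ext x
      by_cases hx : x ∈ tsupport ψ
      · simp [hx]
      · simp [hx, image_eq_zero_of_notMem_tsupport hx]
    rw [h2, integrable_indicator_iff (isClosed_tsupport ψ).measurableSet]
    have : IsFiniteMeasure (volume.restrict (tsupport ψ)) :=
      ⟨by simpa using ψ.hasCompactSupport.measure_lt_top⟩
    exact (hint.restrict _).integrable (by norm_num)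
  rw [funext fun η => localFourier_eq_fourier hT hψU h1 η]
  exact memLp_fourier h1.ofReal hint.ofReal

end Functions

/-! ### Convergence of the convolutions of `H(f)` and `f^s` near every point. -/

section Cases

variable {Ω : Opens Plane} (f : TemperedOn Ω) {κ : ℝ} (φm : Mollifier κ)

lemma measurableSet_posSupp : MeasurableSet (posSupp f) := isClosed_closure.measurableSet

lemma heaviside_eq_integral (φ : 𝓓(Ω, ℝ)) :
    heaviside f φ = ∫ x, (posSupp f).indicator (fun _ => (1 : ℝ)) x * φ x := by
  rw [heaviside_apply, ← integral_indicator (measurableSet_posSupp f)]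
  congr 1
  ext x
  by_cases hx : x ∈ posSupp f <;> simp [hx]

lemma memLp_indicator_mul (φ : 𝓓(Ω, ℝ)) (p : ENNReal) :
    MemLp (fun x => (posSupp f).indicator (fun _ => (1 : ℝ)) x * φ x) p := by
  have h1 : (fun x => (posSupp f).indicator (fun _ => (1 : ℝ)) x * φ x) =
      (posSupp f).indicator φ := by
    ext x
    by_cases hx : x ∈ posSupp f <;> simp [hx]
  rw [h1]
  exact (φ.continuous.memLp_of_hasCompactSupport φ.hasCompactSupport).indicator
    (measurableSet_posSupp f)

lemma memLp_localFourier_heaviside (φ : 𝓓(Ω, ℝ)) : MemLp (localFourier (heaviside f) φ) 2 :=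
  memLp_localFourier (U := Set.univ) (fun φ _ => heaviside_eq_integral f φ) (Set.subset_univ _)
    (memLp_indicator_mul f φ 2)

lemma exists_norm_localFourier_heaviside_le (φ : 𝓓(Ω, ℝ)) :
    ∃ C, 0 ≤ C ∧ ∀ η, ‖localFourier (heaviside f) φ η‖ ≤ C := by
  refine ⟨∫ x, ‖(((posSupp f).indicator (fun _ => (1 : ℝ)) x * φ x : ℝ) : ℂ)‖, by positivity,
    fun η => ?_⟩
  rw [localFourier_eq_fourier (U := Set.univ) (fun φ _ => heaviside_eq_integral f φ)
    (Set.subset_univ _) (memLp_one_iff_integrable.mp (memLp_indicator_mul f φ 1))]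
  exact VectorFourier.norm_fourierIntegral_le_integral_norm _ _ _ _ _

lemma damped_apply (φ : 𝓓(Ω, ℝ)) : damped f φm φ =
    f.toDistribution (mulTest _ (contDiff_one_sub_theta f φm) φ) := rfl

lemma localFourier_damped (φ : 𝓓(Ω, ℝ)) : localFourier (damped f φm) φ =
    localFourier f.toDistribution (mulTest _ (contDiff_one_sub_theta f φm) φ) := by
  ext η
  rw [localFourier, localFourier, damped_apply, damped_apply,
    mulTest_comm (contDiff_one_sub_theta f φm), mulTest_comm (contDiff_one_sub_theta f φm)]

/-- By Plancherel both transforms are square-integrable; the smooth factor `1 - θ` is bounded on the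
support of the cut-off. -/
lemma exists_goodOn_of_mem_l2Supp {x : Plane} (hx : x ∈ l2Supp f) :
    ∃ U, IsOpen U ∧ x ∈ U ∧ GoodOn (heaviside f) (damped f φm) U := by
  obtain ⟨U, ⟨hU, -, g, hg, hfg⟩, hxU⟩ := hx
  refine ⟨U, hU, hxU, fun φ ψ hφ hψ => convBounded_of_memLp (memLp_localFourier_heaviside f φ) ?_⟩
  rw [localFourier_damped]
  have hT : ∀ φ : 𝓓(Ω, ℝ), tsupport φ ⊆ U →
      f.toDistribution φ = ∫ x, U.indicator g x * φ x := by
    intro φ hφ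
    have h1 := hfg (testToSchwartz φ) fun y hy =>
      image_eq_zero_of_notMem_tsupport fun h => hy (hφ h)
    refine h1.trans ?_
    rw [← integral_indicator hU.measurableSet]
    congr 1
    ext x
    by_cases hx : x ∈ U <;> simp [hx]
  refine memLp_localFourier hT ((tsupport_mulTest_subset _ _ _).trans hψ) ?_
  have h2 : MemLp (U.indicator g) 2 := (memLp_indicator_iff_restrict hU.measurableSet).mpr hg
  have h3 : MemLp (mulTest _ (contDiff_one_sub_theta f φm) ψ) ⊤ :=
    (TestFunction.continuous _).memLp_of_hasCompactSupport (TestFunction.hasCompactSupport _)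
  exact h3.mul (r := 2) h2

/-- Compactness of the support inside the open ball leaves a margin `κ - r`, which becomes the
radius in `theta_eq_one`. -/
lemma exists_tsupport_subset_closedBall (φm : Mollifier κ) (hκ : 0 < κ) :
    ∃ r < κ, ∀ y, φm.fn y ≠ 0 → ‖y‖ ≤ r := by
  have hc : IsCompact (tsupport φm.fn) :=
    (Metric.isBounded_ball.subset φm.tsupport_subset).isCompact_closure.of_isClosed_subset
      (isClosed_tsupport _) subset_closure
  by_cases hne : (tsupport φm.fn).Nonempty
  · obtain ⟨y₀, hy₀, hmax⟩ := hc.exists_isMaxOn hne continuous_norm.continuousOn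
    refine ⟨‖y₀‖, by simpa using φm.tsupport_subset hy₀, fun y hy => ?_⟩
    exact hmax (subset_tsupport _ hy)
  · refine ⟨0, hκ, fun y hy => ?_⟩
    exact absurd ⟨y, subset_tsupport _ hy⟩ hne

lemma theta_eq_one (hκ : 0 < κ) {x : Plane} (hx : x ∈ conflictSet f) :
    ∃ ε > 0, ∀ y ∈ Metric.ball x ε, theta f φm y = 1 := by
  obtain ⟨r, hr, hsupp⟩ := exists_tsupport_subset_closedBall φm hκ
  refine ⟨κ - r, by linarith, fun y hy => ?_⟩
  have h1 : theta f φm y = ∫ t, φm.fn (y - t) := by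
    rw [theta, convolution_def]
    congr 1
    ext t
    by_cases h0 : φm.fn (y - t) = 0
    · simp [h0]
    · have ht : t ∈ exceptionalSet f κ := by
        refine Set.mem_add.mpr ⟨x, hx, t - x, ?_, by abel⟩
        rw [Metric.mem_ball, dist_eq_norm] at hy
        rw [mem_ball_zero_iff]
        calc ‖t - x‖ = ‖(y - x) - (y - t)‖ := by congr 1; abel
          _ ≤ ‖y - x‖ + ‖y - t‖ := norm_sub_le _ _
          _ < κ := by linarith [hsupp _ h0]
      simp [ht]
  rw [h1, integral_sub_left_eq_self (fun t => φm.fn t) volume y, φm.integral_eq_one]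

/-- Three distances less than `κ` add up: from `X₀` to a point of `X`, across the support of the
mollifier, and from `y` to `x`. -/
lemma theta_eq_zero {x : Plane} (hx : x ∉ exceptionalSet f (3 * κ)) :
    ∀ y ∈ Metric.ball x κ, theta f φm y = 0 := by
  intro y hy
  rw [theta, convolution_def, ← integral_zero Plane ℝ]
  congr 1
  ext t
  by_cases h0 : φm.fn (y - t) = 0
  · simp [h0]
  · have ht : t ∉ exceptionalSet f κ := by
      intro ht
      obtain ⟨z, hz, b, hb, rfl⟩ := Set.mem_add.mp ht
      refine hx (Set.mem_add.mpr ⟨z, hz, x - z, ?_, by abel⟩)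
      have h1 := φm.tsupport_subset (subset_tsupport _ h0)
      rw [Metric.mem_ball, dist_eq_norm] at hy
      rw [mem_ball_zero_iff] at hb h1 ⊢
      calc ‖x - z‖ = ‖b + (y - (z + b)) - (y - x)‖ := by congr 1; abel
        _ ≤ ‖b‖ + ‖y - (z + b)‖ + ‖y - x‖ := (norm_sub_le _ _).trans (by gcongr; exact norm_add_le _ _)
        _ < 3 * κ := by linarith
    simp [ht]

lemma exists_goodOn_of_mem_conflictSet (hκ : 0 < κ) {x : Plane} (hx : x ∈ conflictSet f) :
    ∃ U, IsOpen U ∧ x ∈ U ∧ GoodOn (heaviside f) (damped f φm) U := by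
  obtain ⟨ε, hε, hθ⟩ := theta_eq_one f φm hκ hx
  refine ⟨Metric.ball x ε, Metric.isOpen_ball, Metric.mem_ball_self hε, fun φ ψ hφ hψ => ?_⟩
  have h0 : mulTest _ (contDiff_one_sub_theta f φm) ψ = 0 := by
    ext y
    by_cases hy : y ∈ tsupport ψ
    · simp [hθ y (hψ hy)]
    · simp [image_eq_zero_of_notMem_tsupport hy]
  rw [localFourier_damped, h0]
  refine ⟨0, 0, le_rfl, fun ζ => ?_⟩
  simp [localFourier]

/-- This is Hörmander's criterion for products. Each direction offers decay of one of the two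
factors, and compactness of the circle leaves finitely many cones to combine. -/
lemma exists_goodOn_of_notMem {x : Plane} (hxΩ : x ∈ Ω) (hx : x ∉ l2Supp f)
    (hx' : x ∉ conflictSet f) :
    ∃ U, IsOpen U ∧ x ∈ U ∧ GoodOn (heaviside f) (damped f φm) U := by
  set T := f.toDistribution with hTdef
  obtain ⟨K, hK, hxK, hKΩ⟩ := exists_compact_subset Ω.isOpen hxΩ
  -- The growth order `k` of `f` is fixed before the cones are chosen: it determines the order `k +
  -- 3` of decay required of `H(f)`, and it serves all cut-offs supported in `K`.
  obtain ⟨k, m, hrep⟩ := exists_isRepresentedOn T hK hKΩ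
  let Q : Set Plane → Prop := fun S => ∃ W, IsOpen W ∧ x ∈ W ∧ W ⊆ K ∧
    ∀ φ ψ : 𝓓(Ω, ℝ), tsupport φ ⊆ W → tsupport ψ ⊆ W → ∃ (C : ℝ) (M : ℕ), 0 ≤ C ∧
      ∀ η, η ≠ 0 → ‖η‖⁻¹ • η ∈ S → ∀ ζ,
        ‖localFourier (heaviside f) φ η * localFourier T ψ (ζ - η)‖ * (1 + ‖η‖) ^ 3 ≤
          C * (1 + ‖ζ‖) ^ M
  have hQ : Q (Metric.sphere 0 1) := by
    refine (isCompact_sphere (0 : Plane) 1).induction_on (p := Q) ?_ ?_ ?_ ?_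
    · exact ⟨interior K, isOpen_interior, hxK, interior_subset, fun φ ψ _ _ =>
        ⟨0, 0, le_rfl, fun η _ h => absurd h (Set.notMem_empty _)⟩⟩
    · rintro S S' hSS' ⟨W, hW, hxW, hWK, h⟩
      refine ⟨W, hW, hxW, hWK, fun φ ψ hφ hψ => ?_⟩
      obtain ⟨C, M, hC, hb⟩ := h φ ψ hφ hψ
      exact ⟨C, M, hC, fun η hη hS => hb η hη (hSS' hS)⟩
    · rintro S S' ⟨W, hW, hxW, hWK, h⟩ ⟨W', hW', hxW', -, h'⟩
      refine ⟨W ∩ W', hW.inter hW', ⟨hxW, hxW'⟩, Set.inter_subset_left.trans hWK,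
        fun φ ψ hφ hψ => ?_⟩
      obtain ⟨C, M, hC, hb⟩ := h φ ψ (hφ.trans Set.inter_subset_left)
        (hψ.trans Set.inter_subset_left)
      obtain ⟨C', M', hC', hb'⟩ := h' φ ψ (hφ.trans Set.inter_subset_right)
        (hψ.trans Set.inter_subset_right)
      refine ⟨C + C', M + M', by positivity, fun η hη hS ζ => ?_⟩
      have h1 : (1 : ℝ) ≤ 1 + ‖ζ‖ := by simp
      rcases hS with hS | hS
      · refine (hb η hη hS ζ).trans ?_
        gcongr
        · linarith
        · omega
      · refine (hb' η hη hS ζ).trans ?_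
        gcongr
        · linarith
        · omega
    · intro ξ hξ
      have hξ1 : ‖ξ‖ = 1 := by simpa using hξ
      have hor : (x, ξ) ∉ WF (heaviside f) ∨ (x, -ξ) ∉ WF T := by
        by_contra hcon
        push Not at hcon
        exact hx' ⟨hx, ξ, hcon.1, hcon.2⟩
      rcases hor with hor | hor
      -- Decay of order `k + 3` of the transform of `H(f)` outweighs the growth `k` of the other
      -- factor and leaves the integrable order 3.
      · rw [notMem_WF_iff hxΩ hξ1] at hor
        obtain ⟨W, V, hW, hxW, hV, hdec⟩ := (hor (k + 3)).exists_coneDecayOn hξ1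
        refine ⟨V, mem_nhdsWithin_of_mem_nhds (hV.1.mem_nhds hV.2.1), W ∩ interior K,
          hW.inter isOpen_interior, ⟨hxW, hxK⟩, Set.inter_subset_right.trans interior_subset,
          fun φ ψ hφ hψ => ?_⟩
        obtain ⟨C, P, hC, hb⟩ := hdec φ (hφ.trans Set.inter_subset_left)
        obtain ⟨C', hC', hb'⟩ := hrep.norm_localFourier_le
          (hψ.trans (Set.inter_subset_right.trans interior_subset))
        refine ⟨C * C', k, by positivity, fun η hη hηV ζ => ?_⟩
        have hηV' : η ∈ V := by
          have := hV.2.2 ‖η‖ (norm_pos_iff.mpr hη) _ hηV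
          rwa [smul_inv_smul₀ (norm_ne_zero_iff.mpr hη)] at this
        have h1 := hb η hηV' 0
        rw [sub_zero, norm_zero, add_zero, one_pow, mul_one] at h1
        have h2 : (1 + ‖ζ - η‖) ^ k ≤ (1 + ‖ζ‖) ^ k * (1 + ‖η‖) ^ k := by
          rw [← mul_pow]
          have := one_add_norm_sub_le ζ η
          gcongr
        rw [norm_mul]
        calc ‖localFourier (heaviside f) φ η‖ * ‖localFourier T ψ (ζ - η)‖ * (1 + ‖η‖) ^ 3
            ≤ ‖localFourier (heaviside f) φ η‖ * (C' * ((1 + ‖ζ‖) ^ k * (1 + ‖η‖) ^ k)) *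
              (1 + ‖η‖) ^ 3 := by
              gcongr
              exact (hb' _).trans (by gcongr)
          _ = ‖localFourier (heaviside f) φ η‖ * (1 + ‖η‖) ^ (k + 3) * (C' * (1 + ‖ζ‖) ^ k) := by
              ring
          _ ≤ C * (C' * (1 + ‖ζ‖) ^ k) := by gcongr
          _ = _ := by ring
      -- Here the transform of `H(f)` is merely bounded, so order 3 is enough for `f`. The argument
      -- `ζ - η` is read as `-η` shifted by `-ζ`, which is where translation-stable decay is used.
      · rw [notMem_WF_iff hxΩ (by rwa [norm_neg])] at hor
        obtain ⟨W, V, hW, hxW, hV, hdec⟩ := (hor 3).exists_coneDecayOn (by rwa [norm_neg])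
        refine ⟨-V, mem_nhdsWithin_of_mem_nhds (hV.1.neg.mem_nhds hV.2.1), W ∩ interior K,
          hW.inter isOpen_interior, ⟨hxW, hxK⟩, Set.inter_subset_right.trans interior_subset,
          fun φ ψ hφ hψ => ?_⟩
        obtain ⟨C, P, hC, hb⟩ := hdec ψ (hψ.trans Set.inter_subset_left)
        obtain ⟨C', hC', hb'⟩ := exists_norm_localFourier_heaviside_le f φ
        refine ⟨C' * C, P, by positivity, fun η hη hηV ζ => ?_⟩
        have hηV' : -η ∈ V := by
          have := hV.2.2 ‖η‖ (norm_pos_iff.mpr hη) _ hηV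
          rwa [smul_neg, smul_inv_smul₀ (norm_ne_zero_iff.mpr hη)] at this
        have h1 := hb (-η) hηV' (-ζ)
        rw [sub_neg_eq_add, neg_add_eq_sub, norm_neg, norm_neg] at h1
        rw [norm_mul, mul_assoc, mul_assoc]
        gcongr
        exact hb' η
  obtain ⟨W, hW, hxW, hWK, hWb⟩ := hQ
  refine ⟨W, hW, hxW, fun φ ψ hφ hψ => ?_⟩
  rw [localFourier_damped]
  set ψ' := mulTest _ (contDiff_one_sub_theta f φm) ψ
  have hψ' : tsupport ψ' ⊆ W := (tsupport_mulTest_subset _ _ _).trans hψ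
  obtain ⟨C, M, hC, hb⟩ := hWb φ ψ' hφ hψ'
  obtain ⟨C₁, hC₁, hb₁⟩ := exists_norm_localFourier_heaviside_le f φ
  obtain ⟨C₂, hC₂, hb₂⟩ := hrep.norm_localFourier_le (hψ'.trans hWK)
  refine convBounded_of_le (stronglyMeasurable_localFourier _ _)
    (stronglyMeasurable_localFourier _ _) (C := C + C₁ * C₂) (M := M + k) (by positivity)
    fun ζ η => ?_
  have h1 : (1 : ℝ) ≤ 1 + ‖ζ‖ := by simp
  -- The zero frequency has no direction and is bounded separately.
  by_cases hη : η = 0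
  · subst hη
    rw [norm_mul, norm_zero, add_zero, one_pow, mul_one, sub_zero]
    calc ‖localFourier (heaviside f) φ 0‖ * ‖localFourier T ψ' ζ‖
        ≤ C₁ * (C₂ * (1 + ‖ζ‖) ^ k) := by
          gcongr
          · exact hb₁ 0
          · exact hb₂ ζ
      _ = (C₁ * C₂) * (1 + ‖ζ‖) ^ k := by ring
      _ ≤ _ := by
        gcongr
        · linarith
        · omega
  · refine (hb η hη ?_ ζ).trans ?_
    · rw [mem_sphere_zero_iff_norm, norm_smul, norm_inv, norm_norm,
        inv_mul_cancel₀ (norm_ne_zero_iff.mpr hη)]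
    · gcongr
      · have : 0 ≤ C₁ * C₂ := by positivity
        linarith
      · omega

lemma exists_goodOn (hκ : 0 < κ) : ∀ x ∈ Ω, ∃ U, IsOpen U ∧ x ∈ U ∧
    GoodOn (heaviside f) (damped f φm) U := by
  intro x hx
  by_cases h1 : x ∈ l2Supp f
  · exact exists_goodOn_of_mem_l2Supp f φm h1
  · by_cases h2 : x ∈ conflictSet f
    · exact exists_goodOn_of_mem_conflictSet f φm hκ h2
    · exact exists_goodOn_of_notMem f φm hx h1 h2

lemma exists_isProduct (hκ : 0 < κ) : ∃ w, IsProduct (heaviside f) (damped f φm) w := by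
  obtain ⟨w, hw⟩ := exists_isLocalProduct (exists_goodOn f φm hκ)
  exact ⟨w, hw.isProduct (exists_goodOn f φm hκ)⟩

lemma isProduct_relu (hκ : 0 < κ) : IsProduct (heaviside f) (damped f φm) (relu f φm) := by
  have h := exists_isProduct f φm hκ
  rw [relu, dif_pos h]
  exact h.choose_spec

end Cases

/-! ### Local descriptions of the product -/

/-! ### The ReLU in the interior and exterior of the positive support, and where `f` is smooth. -/

section Local

variable {Ω : Opens Plane} {f : TemperedOn Ω} {κ : ℝ} (φm : Mollifier κ) {x : Plane}

lemma relu_locally_eq_pairing (hκ : 0 < κ) (hx : x ∈ Ω) {V : Set Plane} (hV : IsOpen V)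
    (hxV : x ∈ V) :
    ∃ W, IsOpen W ∧ x ∈ W ∧ W ⊆ V ∧ ∀ φ : 𝓓(Ω, ℝ), tsupport φ ⊆ W →
      ∃ ψ : 𝓓(Ω, ℝ), tsupport ψ ⊆ V ∧ (∀ y ∈ tsupport φ, ψ y = 1) ∧
        (relu f φm φ : ℂ) = pairing (heaviside f) (damped f φm) φ ψ := by
  obtain ⟨U, hU, hxU, hgood⟩ := exists_goodOn f φm hκ x hx
  obtain ⟨W, hW, hxW, hWU, h⟩ := (isProduct_relu f φm hκ).locally_eq_pairing (hU.inter hV)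
    (hgood.mono Set.inter_subset_left) hx ⟨hxU, hxV⟩
  refine ⟨W, hW, hxW, hWU.trans Set.inter_subset_right, fun φ hφ => ?_⟩
  obtain ⟨ψ, hψ, W', -, hW', hψ1⟩ := exists_cutoff φ.hasCompactSupport (hU.inter hV)
    (hφ.trans hWU) φ.tsupport_subset
  exact ⟨ψ, hψ.trans Set.inter_subset_right, fun y hy => hψ1 y (hW' hy),
    h φ ψ hφ hψ fun y hy => hψ1 y (hW' hy)⟩

/-- There `φ H(f)` is just `φ`, and the pairing becomes the Fourier formula for `f^s` applied to `φ
ψ = φ`. -/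
lemma relu_locally_eq_damped (hκ : 0 < κ) (hx : x ∈ Ω) (hxi : x ∈ interior (posSupp f)) :
    ∃ W, IsOpen W ∧ x ∈ W ∧ ∀ φ : 𝓓(Ω, ℝ), tsupport φ ⊆ W → relu f φm φ = damped f φm φ := by
  obtain ⟨W, hW, hxW, hWV, h⟩ := relu_locally_eq_pairing φm hκ hx isOpen_interior hxi
  refine ⟨W, hW, hxW, fun φ hφ => ?_⟩
  obtain ⟨ψ, -, hψ1, heq⟩ := h φ hφ
  have h1 : ∀ η, localFourier (heaviside f) φ η = ft φ η := by
    have hint := memLp_one_iff_integrable.mp (memLp_indicator_mul f φ 1)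
    intro η
    have h0 : (fun y => (((posSupp f).indicator (fun _ => (1 : ℝ)) y * φ y : ℝ) : ℂ)) =
        fun y => (φ y : ℂ) := by
      funext y
      by_cases hy : y ∈ tsupport φ
      · simp [interior_subset (hWV (hφ hy))]
      · simp [image_eq_zero_of_notMem_tsupport hy]
    rw [localFourier_eq_fourier (U := Set.univ) (fun φ _ => heaviside_eq_integral f φ)
      (Set.subset_univ _) hint, h0]
    rfl
  have h2 := apply_mulTest (damped f φm) ψ φ.contDiff φ.hasCompactSupport
  rw [mulTest_swap, mulTest_eq_self _ hψ1] at h2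
  have h3 : (relu f φm φ : ℂ) = damped f φm φ := by
    rw [heq, h2, pairing]
    simp_rw [h1]
  exact_mod_cast h3

lemma relu_locally_eq_zero (hκ : 0 < κ) (hx : x ∈ Ω) (hxi : x ∉ posSupp f) :
    ∃ W, IsOpen W ∧ x ∈ W ∧ ∀ φ : 𝓓(Ω, ℝ), tsupport φ ⊆ W → relu f φm φ = 0 := by
  obtain ⟨W, hW, hxW, hWV, h⟩ := relu_locally_eq_pairing φm hκ hx
    (isClosed_closure (s := _)).isOpen_compl hxi
  refine ⟨W, hW, hxW, fun φ hφ => ?_⟩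
  obtain ⟨ψ, -, hψ1, heq⟩ := h φ hφ
  have h1 : ∀ η, localFourier (heaviside f) φ η = 0 := by
    have hint := memLp_one_iff_integrable.mp (memLp_indicator_mul f φ 1)
    intro η
    rw [localFourier_eq_fourier (U := Set.univ) (fun φ _ => heaviside_eq_integral f φ)
      (Set.subset_univ _) hint]
    have h0 : (fun y => (((posSupp f).indicator (fun _ => (1 : ℝ)) y * φ y : ℝ) : ℂ)) =
        fun _ => 0 := by
      ext y
      by_cases hy : y ∈ tsupport φ
      · have : y ∉ posSupp f := hWV (hφ hy)
        simp [this]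
      · simp [image_eq_zero_of_notMem_tsupport hy]
    rw [h0, Real.fourier_eq']
    simp
  have h3 : (relu f φm φ : ℂ) = 0 := by
    rw [heq, pairing]
    simp [h1]
  exact_mod_cast h3

lemma contDiff_mul_testFunction_of_contDiffOn {U : Set Plane} (hU : IsOpen U) {g : Plane → ℝ}
    (hg : ContDiffOn ℝ ∞ g U) {ψ : 𝓓(Ω, ℝ)} (hψ : tsupport ψ ⊆ U) :
    ContDiff ℝ ∞ fun y => g y * ψ y := by
  rw [contDiff_iff_contDiffAt]
  intro y
  by_cases hy : y ∈ tsupport ψ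
  · exact (hg.contDiffAt (hU.mem_nhds (hψ hy))).mul ψ.contDiff.contDiffAt
  · have h0 : (fun y => g y * ψ y) =ᶠ[nhds y] fun _ => 0 := by
      filter_upwards [(isClosed_tsupport ψ).isOpen_compl.mem_nhds hy] with z hz
      rw [image_eq_zero_of_notMem_tsupport hz, mul_zero]
    exact contDiffAt_const.congr_of_eventuallyEq h0

lemma IsSmoothOn.exists_global {T : 𝓓'(Ω, ℝ)} {U : Set Plane} {g : Plane → ℝ}
    (h : IsSmoothOn T U g) (hx : x ∈ U) :
    ∃ (G : Plane → ℝ) (B : Set Plane), ContDiff ℝ ∞ G ∧ IsOpen B ∧ x ∈ B ∧ B ⊆ U ∧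
      (∀ y ∈ B, G y = g y) ∧ ∀ φ : 𝓓(Ω, ℝ), tsupport φ ⊆ B → T φ = ∫ y, G y * φ y := by
  obtain ⟨hU, hUΩ, hg, hT⟩ := h
  obtain ⟨χ, hχ, B, hB, hxB, hBU, hχ1⟩ := exists_cutoff_nhds (Ω := Ω) (hUΩ hx) hU hx
  refine ⟨fun y => g y * χ y, B, contDiff_mul_testFunction_of_contDiffOn hU hg hχ, hB, hxB, hBU,
    fun y hy => by simp [hχ1 y hy], fun φ hφ => ?_⟩
  rw [hT φ (hφ.trans hBU), ← integral_indicator hU.measurableSet]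
  congr 1
  ext y
  by_cases hy : y ∈ tsupport φ
  · rw [Set.indicator_of_mem (hBU (hφ hy))]
    change g y * φ y = g y * χ y * φ y
    rw [hχ1 y (hφ hy), mul_one]
  · have h0 := image_eq_zero_of_notMem_tsupport hy
    by_cases hyU : y ∈ U <;> simp [h0, hyU]

/-- Here `ψ f^s` is a smooth compactly supported function `F`, and the pairing becomes the Fourier
formula for `H(f)` applied to `F φ`. -/
lemma relu_locally_eq_integral (hκ : 0 < κ) (hx : x ∈ Ω) {G : Plane → ℝ} (hG : ContDiff ℝ ∞ G)
    {B : Set Plane} (hB : IsOpen B) (hxB : x ∈ B)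
    (hf : ∀ φ : 𝓓(Ω, ℝ), tsupport φ ⊆ B → f.toDistribution φ = ∫ y, G y * φ y) :
    ∃ W, IsOpen W ∧ x ∈ W ∧ W ⊆ B ∧ ∀ φ : 𝓓(Ω, ℝ), tsupport φ ⊆ W →
      relu f φm φ =
        ∫ y, (posSupp f).indicator (fun _ => (1 : ℝ)) y * (G y * ((1 - theta f φm y) * φ y)) := by
  obtain ⟨W, hW, hxW, hWB, h⟩ := relu_locally_eq_pairing φm hκ hx hB hxB
  refine ⟨W, hW, hxW, hWB, fun φ hφ => ?_⟩
  obtain ⟨ψ, hψB, hψ1, heq⟩ := h φ hφ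
  let F : 𝓓(Ω, ℝ) := mulTest G hG (mulTest _ (contDiff_one_sub_theta f φm) ψ)
  have h1 : ∀ η, localFourier (damped f φm) ψ η = ft F η := by
    intro η
    rw [localFourier_damped, localFourier_eq_fourier hf
      ((tsupport_mulTest_subset _ _ _).trans hψB)]
    · rfl
    · exact F.continuous.integrable_of_hasCompactSupport F.hasCompactSupport
  have h2 := apply_mulTest (heaviside f) φ F.contDiff F.hasCompactSupport
  have h3 : (relu f φm φ : ℂ) = heaviside f (mulTest F F.contDiff φ) := by
    rw [heq, h2, pairing, ← integral_neg_eq_self]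
    congr 1
    ext η
    rw [neg_neg, h1, mul_comm]
  have h4 : relu f φm φ = heaviside f (mulTest F F.contDiff φ) := by exact_mod_cast h3
  rw [h4, heaviside_eq_integral]
  congr 1
  ext y
  simp only [F, mulTest_apply]
  by_cases hy : y ∈ tsupport φ
  · rw [hψ1 y hy, mul_one, mul_assoc]
  · simp [image_eq_zero_of_notMem_tsupport hy]

/-! ### The wavefront set away from the boundary of the positive support -/

lemma WF_relu_subset_of_mem_interior (hκ : 0 < κ) (hxi : x ∈ interior (posSupp f)) {ξ : Plane}
    (h : (x, ξ) ∈ WF (relu f φm)) : (x, ξ) ∈ WF f.toDistribution := by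
  obtain ⟨W, hW, hxW, heq⟩ := relu_locally_eq_damped φm hκ (mem_WF_imp h).1 hxi
  exact mem_WF_of_locally_eq_mul (contDiff_one_sub_theta f φm) hW hxW heq h

lemma mem_WF_relu_of_mem_interior (hκ : 0 < κ) (hxi : x ∈ interior (posSupp f))
    (hxe : x ∉ exceptionalSet f (3 * κ)) {ξ : Plane} (h : (x, ξ) ∈ WF f.toDistribution) :
    (x, ξ) ∈ WF (relu f φm) := by
  obtain ⟨W, hW, hxW, heq⟩ := relu_locally_eq_damped φm hκ (mem_WF_imp h).1 hxi
  refine mem_WF_of_locally_eq (hW.inter Metric.isOpen_ball) ⟨hxW, Metric.mem_ball_self hκ⟩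
    (fun φ hφ => ?_) h
  rw [heq φ (hφ.trans Set.inter_subset_left), damped_apply, mulTest_eq_self]
  intro y hy
  rw [theta_eq_zero f φm hxe y (hφ hy).2, sub_zero]

lemma mem_posSupp_of_mem_WF_relu (hκ : 0 < κ) {ξ : Plane} (h : (x, ξ) ∈ WF (relu f φm)) :
    x ∈ posSupp f := by
  obtain ⟨hx, hξ⟩ := mem_WF_imp h
  by_contra hn
  obtain ⟨W, hW, hxW, heq⟩ := relu_locally_eq_zero φm hκ hx hn
  have h0 : (x, ξ) ∈ WF (0 : 𝓓'(Ω, ℝ)) := mem_WF_of_locally_eq hW hxW (fun φ hφ => heq φ hφ) h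
  refine (notMem_WF_iff hx hξ).mpr (fun N => ?_) h0
  obtain ⟨ψ, -, V, -, hxV, -, hψ⟩ := exists_cutoff_nhds hx isOpen_univ (Set.mem_univ x)
  refine ⟨Set.univ, isOpen_univ, trivial, Set.univ, isOpen_univ, trivial, fun _ _ _ _ => trivial,
    ψ, Set.subset_univ _, hψ x hxV, 1, one_pos, fun η _ => ?_⟩
  have : localFourier (0 : 𝓓'(Ω, ℝ)) ψ η = 0 := by
    simp [localFourier]
  rw [this, norm_zero]
  positivity

/-! ### Uniqueness of the gradient -/

/-- Two densities of one distribution agree almost everywhere, hence everywhere by continuity. Thus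
the gradient of `f` at a smooth point is well defined. -/
lemma IsSmoothOn.eqOn {T : 𝓓'(Ω, ℝ)} {U U' : Set Plane} {g g' : Plane → ℝ}
    (h : IsSmoothOn T U g) (h' : IsSmoothOn T U' g') : Set.EqOn g g' (U ∩ U') := by
  obtain ⟨hU, hUΩ, hg, hT⟩ := h
  obtain ⟨hU', hUΩ', hg', hT'⟩ := h'
  have ho := hU.inter hU'
  have hc : ContinuousOn g (U ∩ U') := hg.continuousOn.mono Set.inter_subset_left
  have hc' : ContinuousOn g' (U ∩ U') := hg'.continuousOn.mono Set.inter_subset_right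
  have hae : ∀ᵐ y, y ∈ U ∩ U' → (g - g') y = 0 := by
    refine IsOpen.ae_eq_zero_of_integral_contDiff_smul_eq_zero ho
      ((hc.sub hc').locallyIntegrableOn ho.measurableSet) fun φ hφ hφc hφs => ?_
    let ψ : 𝓓(Ω, ℝ) := mkTest φ hφ hφc (hφs.trans (Set.inter_subset_left.trans hUΩ))
    have key : ∀ {V : Set Plane} {u : Plane → ℝ}, IsOpen V → ContDiffOn ℝ ∞ u V → tsupport φ ⊆ V →
        ∫ y in V, u y * ψ y = ∫ y, u y * φ y ∧ Integrable fun y => u y * φ y := by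
      intro V u hV hu hφV
      constructor
      · rw [← integral_indicator hV.measurableSet]
        congr 1
        ext y
        by_cases hy : y ∈ tsupport φ
        · rw [Set.indicator_of_mem (hφV hy)]
          rfl
        · have h0 := image_eq_zero_of_notMem_tsupport hy
          by_cases hyV : y ∈ V <;> simp [h0, hyV, ψ]
      · have := contDiff_mul_testFunction_of_contDiffOn hV hu (ψ := ψ) hφV
        exact this.continuous.integrable_of_hasCompactSupport hφc.mul_left
    have k1 := key hU hg (hφs.trans Set.inter_subset_left)
    have k2 := key hU' hg' (hφs.trans Set.inter_subset_right)
    have e1 := hT ψ (hφs.trans Set.inter_subset_left)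
    have e2 := hT' ψ (hφs.trans Set.inter_subset_right)
    rw [k1.1] at e1
    rw [k2.1] at e2
    have : ∀ y, φ y • (g - g') y = g y * φ y - g' y * φ y := by
      intro y
      simp only [Pi.sub_apply, smul_eq_mul]
      ring
    simp_rw [this]
    rw [integral_sub k1.2 k2.2, ← e1, ← e2, sub_self]
  refine Measure.eqOn_open_of_ae_eq (μ := volume) ?_ ho hc hc'
  rw [Filter.EventuallyEq, ae_restrict_iff' ho.measurableSet]
  filter_upwards [hae] with y hy hyU
  exact sub_eq_zero.mp (hy hyU)

lemma HasGradAt.unique {T : 𝓓'(Ω, ℝ)} {v w : Plane} (h : HasGradAt T x v) (h' : HasGradAt T x w) :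
    v = w := by
  obtain ⟨U, g, hg, hxU, rfl⟩ := h
  obtain ⟨U', g', hg', hxU', rfl⟩ := h'
  have heq : g =ᶠ[nhds x] g' :=
    Filter.eventuallyEq_of_mem ((hg.1.inter hg'.1).mem_nhds ⟨hxU, hxU'⟩) (hg.eqOn hg')
  rw [gradient, gradient, heq.fderiv_eq]

end Local

/-! ### Divergence-free vector fields -/

lemma plane_eq_sum (v : Plane) :
    v = v 0 • EuclideanSpace.single 0 (1 : ℝ) + v 1 • EuclideanSpace.single 1 (1 : ℝ) := by
  ext i
  fin_cases i <;> simp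

lemma integral_fderiv_apply_eq_zero {V : Plane → Plane} (hV : ContDiff ℝ ∞ V)
    (hdiv : ∀ y, fderiv ℝ (fun z => V z 0) y (EuclideanSpace.single 0 1) +
      fderiv ℝ (fun z => V z 1) y (EuclideanSpace.single 1 1) = 0)
    {b : Plane → ℂ} (hb : ContDiff ℝ 1 b) (hc : HasCompactSupport b) :
    ∫ y, fderiv ℝ b y (V y) = 0 := by
  have hVi : ∀ i : Fin 2, ContDiff ℝ ∞ fun z => V z i := fun i =>
    (EuclideanSpace.proj (𝕜 := ℝ) i).contDiff.comp hV
  have hcV : ∀ i : Fin 2, Continuous fun z => V z i := fun i => (hVi i).continuous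
  have hcV' : ∀ (i : Fin 2) (e : Plane), Continuous fun z => fderiv ℝ (fun z => V z i) z e :=
    fun i e => ((hVi i).continuous_fderiv (by simp)).clm_apply continuous_const
  have hcb' : ∀ e : Plane, Continuous fun z => fderiv ℝ b z e :=
    fun e => (hb.continuous_fderiv (by simp)).clm_apply continuous_const
  have hi1 : ∀ (i : Fin 2) (e : Plane), Integrable fun z => V z i • fderiv ℝ b z e := fun i e =>
    ((hcV i).smul (hcb' e)).integrable_of_hasCompactSupport ((hc.fderiv_apply ℝ e).smul_left)
  have hi2 : ∀ (i : Fin 2) (e : Plane), Integrable fun z => fderiv ℝ (fun z => V z i) z e • b z :=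
    fun i e => ((hcV' i e).smul hb.continuous).integrable_of_hasCompactSupport hc.smul_left
  have hi3 : ∀ i : Fin 2, Integrable fun z => V z i • b z :=
    fun i => ((hcV i).smul hb.continuous).integrable_of_hasCompactSupport hc.smul_left
  have key : ∀ (i : Fin 2) (e : Plane), ∫ z, V z i • fderiv ℝ b z e =
      -∫ z, fderiv ℝ (fun z => V z i) z e • b z := fun i e =>
    integral_smul_fderiv_eq_neg_fderiv_smul_of_integrable (hi2 i e) (hi1 i e) (hi3 i)
      (fun z _ => (hVi i).differentiable (by simp) z) (fun z _ => hb.differentiable (by simp) z)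
  have h1 : ∀ y, fderiv ℝ b y (V y) = V y 0 • fderiv ℝ b y (EuclideanSpace.single 0 1) +
      V y 1 • fderiv ℝ b y (EuclideanSpace.single 1 1) := by
    intro y
    conv_lhs => rw [plane_eq_sum (V y)]
    simp
  simp_rw [h1]
  rw [integral_add (hi1 _ _) (hi1 _ _), key, key, ← neg_add, ← integral_add (hi2 _ _) (hi2 _ _)]
  simp_rw [← add_smul, hdiv]
  simp

/-- The function `a` is constant along `V`, so it can be pulled inside the derivative. -/
lemma integral_smul_fderiv_apply_eq_zero {V : Plane → Plane} (hV : ContDiff ℝ ∞ V)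
    (hdiv : ∀ y, fderiv ℝ (fun z => V z 0) y (EuclideanSpace.single 0 1) +
      fderiv ℝ (fun z => V z 1) y (EuclideanSpace.single 1 1) = 0)
    {a : Plane → ℝ} (ha : ContDiff ℝ 1 a) (haV : ∀ y, fderiv ℝ a y (V y) = 0)
    {b : Plane → ℂ} (hb : ContDiff ℝ 1 b) (hc : HasCompactSupport b) :
    ∫ y, a y • fderiv ℝ b y (V y) = 0 := by
  have h : ∀ y, a y • fderiv ℝ b y (V y) = fderiv ℝ (fun y => a y • b y) y (V y) := by
    intro y
    rw [fderiv_fun_smul (ha.differentiable (by simp) y) (hb.differentiable (by simp) y)]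
    simp [haV]
  exact (integral_congr_ae (.of_forall h)).trans <|
    integral_fderiv_apply_eq_zero (b := fun y => a y • b y) hV hdiv (ha.smul hb)
      (HasCompactSupport.smul_left (f := a) hc)

/-- No boundary term appears, whatever the regularity of `{g = 0}`: the indicator of `{g > 0}` is
the bounded limit of smooth functions of `n g`, each of which is constant along `V`. -/
lemma setIntegral_fderiv_apply_eq_zero {V : Plane → Plane} (hV : ContDiff ℝ ∞ V)
    (hdiv : ∀ y, fderiv ℝ (fun z => V z 0) y (EuclideanSpace.single 0 1) +
      fderiv ℝ (fun z => V z 1) y (EuclideanSpace.single 1 1) = 0)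
    {g : Plane → ℝ} (hg : ContDiff ℝ ∞ g) (hgV : ∀ y, fderiv ℝ g y (V y) = 0)
    {b : Plane → ℂ} (hb : ContDiff ℝ 1 b) (hc : HasCompactSupport b) :
    ∫ y in {y | 0 < g y}, fderiv ℝ b y (V y) = 0 := by
  let χ : ℕ → Plane → ℝ := fun n y => Real.smoothTransition (n * g y)
  have hχ : ∀ n, ContDiff ℝ 1 (χ n) := fun n =>
    Real.smoothTransition.contDiff.comp (contDiff_const.mul (hg.of_le (by simp)))
  have h0 : ∀ n y, fderiv ℝ (χ n) y (V y) = 0 := by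
    intro n y
    have h1 : HasFDerivAt (fun y => (n : ℝ) * g y) ((n : ℝ) • fderiv ℝ g y) y :=
      ((hg.differentiable (by simp) y).hasFDerivAt).const_mul _
    have h2 : DifferentiableAt ℝ Real.smoothTransition (n * g y) :=
      (Real.smoothTransition.contDiff (n := 1)).differentiable (by simp) _
    have h3 : HasFDerivAt (χ n) (fderiv ℝ Real.smoothTransition (n * g y) ∘L
        ((n : ℝ) • fderiv ℝ g y)) y :=
      HasFDerivAt.comp (g := Real.smoothTransition) y h2.hasFDerivAt h1
    rw [h3.fderiv]
    simp [hgV]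
  have hcb' : Continuous fun z => fderiv ℝ b z (V z) :=
    (hb.continuous_fderiv (by simp)).clm_apply hV.continuous
  have hs' : HasCompactSupport fun z => fderiv ℝ b z (V z) := by
    refine hc.fderiv ℝ |>.mono fun z hz => ?_
    contrapose! hz
    simp [Function.notMem_support.mp hz]
  have hn : ∀ n, ∫ y, χ n y • fderiv ℝ b y (V y) = 0 := fun n =>
    integral_smul_fderiv_apply_eq_zero hV hdiv (hχ n) (h0 n) hb hc
  have hm : MeasurableSet {y | 0 < g y} := (isOpen_lt continuous_const hg.continuous).measurableSet
  rw [← integral_indicator hm]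
  have hlim := tendsto_integral_of_dominated_convergence (μ := volume)
    (F := fun n y => χ n y • fderiv ℝ b y (V y))
    (f := {y | 0 < g y}.indicator fun y => fderiv ℝ b y (V y))
    (fun y => ‖fderiv ℝ b y (V y)‖)
    (fun n => ((hχ n).continuous.smul hcb').aestronglyMeasurable)
    (hcb'.integrable_of_hasCompactSupport hs').norm
    (fun n => .of_forall fun y => by
      rw [norm_smul, Real.norm_of_nonneg (Real.smoothTransition.nonneg _)]
      exact mul_le_of_le_one_left (norm_nonneg _) (Real.smoothTransition.le_one _))
    (.of_forall fun y => by
      by_cases hy : 0 < g y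
      · rw [Set.indicator_of_mem (by exact hy)]
        refine tendsto_const_nhds.congr' ?_
        obtain ⟨n₀, hn₀⟩ := exists_nat_gt (1 / g y)
        filter_upwards [Filter.eventually_ge_atTop n₀] with n hn
        have : (1 : ℝ) ≤ n * g y := by
          rw [← div_le_iff₀ hy]
          exact hn₀.le.trans (by exact_mod_cast hn)
        simp [χ, Real.smoothTransition.one_of_one_le this]
      · rw [Set.indicator_of_notMem (by exact hy)]
        refine tendsto_const_nhds.congr fun n => ?_
        have : (n : ℝ) * g y ≤ 0 := mul_nonpos_of_nonneg_of_nonpos n.cast_nonneg (not_lt.mp hy)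
        simp [χ, Real.smoothTransition.zero_of_nonpos this])
  simp_rw [hn] at hlim
  exact (tendsto_nhds_unique hlim tendsto_const_nhds)

/-- The vector field obtained by rotating the gradient of `g` by a right angle. -/
noncomputable def rotatedGradient (g : Plane → ℝ) (y : Plane) : Plane :=
  !₂[-fderiv ℝ g y (EuclideanSpace.single 1 1), fderiv ℝ g y (EuclideanSpace.single 0 1)]

lemma contDiff_rotatedGradient {g : Plane → ℝ} (hg : ContDiff ℝ ∞ g) :
    ContDiff ℝ ∞ (rotatedGradient g) := by
  have h : ∀ e : Plane, ContDiff ℝ ∞ fun y => fderiv ℝ g y e := fun e =>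
    (hg.fderiv_right (m := ∞) le_rfl).clm_apply contDiff_const
  rw [contDiff_euclidean]
  intro i
  fin_cases i
  · exact (h _).neg
  · exact h _

lemma fderiv_rotatedGradient_eq_zero (g : Plane → ℝ) (y : Plane) :
    fderiv ℝ g y (rotatedGradient g y) = 0 := by
  rw [plane_eq_sum (rotatedGradient g y)]
  simp [rotatedGradient, mul_comm]

lemma div_rotatedGradient {g : Plane → ℝ} (hg : ContDiff ℝ ∞ g) (y : Plane) :
    fderiv ℝ (fun z => rotatedGradient g z 0) y (EuclideanSpace.single 0 1) +
      fderiv ℝ (fun z => rotatedGradient g z 1) y (EuclideanSpace.single 1 1) = 0 := by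
  have hd : DifferentiableAt ℝ (fderiv ℝ g) y :=
    (hg.fderiv_right (m := ∞) le_rfl).differentiable (by simp) y
  have h : ∀ e e' : Plane, fderiv ℝ (fun z => fderiv ℝ g z e) y e' =
      fderiv ℝ (fderiv ℝ g) y e' e := by
    intro e e'
    rw [fderiv_clm_apply hd (differentiableAt_const e)]
    simp
  have hsymm : IsSymmSndFDerivAt ℝ g y := hg.contDiffAt.isSymmSndFDerivAt (by
    rw [minSmoothness_of_isRCLikeNormedField]
    exact ENat.LEInfty.out)
  have e0 : (fun z => rotatedGradient g z 0) =
      fun z => -fderiv ℝ g z (EuclideanSpace.single 1 1) := by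
    ext z
    simp [rotatedGradient]
  have e1 : (fun z => rotatedGradient g z 1) =
      fun z => fderiv ℝ g z (EuclideanSpace.single 0 1) := by
    ext z
    simp [rotatedGradient]
  rw [e0, e1, fderiv_fun_neg, neg_apply, h, h, hsymm.eq]
  simp

/-! ### Oscillatory integrals over superlevel sets -/

/-- The plane wave `e^{-2πi⟨y,η⟩}`. -/
noncomputable def planeWave (η y : Plane) : ℂ :=
  Complex.exp (((-2 * Real.pi * inner ℝ y η : ℝ) : ℂ) * Complex.I)

lemma norm_planeWave (η y : Plane) : ‖planeWave η y‖ = 1 :=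
  Complex.norm_exp_ofReal_mul_I _

lemma contDiff_planeWave (η : Plane) : ContDiff ℝ 1 (planeWave η) := by
  have h : ContDiff ℝ 1 fun y : Plane => -2 * Real.pi * inner ℝ y η :=
    contDiff_const.mul (contDiff_id.inner ℝ contDiff_const)
  exact ((Complex.ofRealCLM.contDiff.comp h).mul contDiff_const).cexp

/-- The oscillatory integral over `{g > 0}` with amplitude `A / ⟨V, η⟩ ^ m`. -/
noncomputable def oscIntegral (g : Plane → ℝ) (V : Plane → Plane) (A : Plane → ℝ) (m : ℕ)
    (η : Plane) : ℂ :=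
  ∫ y in {y | 0 < g y}, ((A y / inner ℝ (V y) η ^ m : ℝ) : ℂ) * planeWave η y

section Osc

variable {V : Plane → Plane} {A : Plane → ℝ} {B : Set Plane} {η : Plane}

lemma contDiff_amplitude (hV : ContDiff ℝ ∞ V) (hA : ContDiff ℝ ∞ A)
    (h : ∀ y ∈ tsupport A, inner ℝ (V y) η ≠ 0) (m : ℕ) :
    ContDiff ℝ 1 fun y => A y / inner ℝ (V y) η ^ m := by
  rw [contDiff_iff_contDiffAt]
  intro y
  by_cases hy : y ∈ tsupport A
  · exact (hA.of_le ENat.LEInfty.out).contDiffAt.div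
      (((hV.of_le ENat.LEInfty.out).inner ℝ contDiff_const).pow m).contDiffAt (pow_ne_zero _ (h y hy))
  · refine (contDiffAt_const (c := (0 : ℝ))).congr_of_eventuallyEq ?_
    filter_upwards [(isClosed_tsupport A).isOpen_compl.mem_nhds hy] with z hz
    rw [image_eq_zero_of_notMem_tsupport hz, zero_div]

lemma integrable_amplitude_mul_planeWave (hV : ContDiff ℝ ∞ V) (hA : ContDiff ℝ ∞ A)
    (hAc : HasCompactSupport A) (h : ∀ y ∈ tsupport A, inner ℝ (V y) η ≠ 0) (m : ℕ) :
    Integrable fun y => ((A y / inner ℝ (V y) η ^ m : ℝ) : ℂ) * planeWave η y := by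
  have hc := (contDiff_amplitude hV hA h m).continuous
  refine ((Complex.continuous_ofReal.comp hc).mul
    (contDiff_planeWave η).continuous).integrable_of_hasCompactSupport ?_
  refine hAc.mono fun y hy => ?_
  contrapose! hy
  simp [Function.notMem_support.mp hy]

/-- Differentiating the wave along `V` produces `-2πi⟨V, η⟩`, which cancels one power in the
denominator; the last term is thus the integrand with exponent `m`, expressed through integrands
with higher exponents. -/
lemma fderiv_amplitude_mul_planeWave (hV : ContDiff ℝ ∞ V) (hA : ContDiff ℝ ∞ A)
    (h : ∀ y ∈ tsupport A, inner ℝ (V y) η ≠ 0) (m : ℕ) (y : Plane) :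
    fderiv ℝ (fun y => ((A y / inner ℝ (V y) η ^ (m + 1) : ℝ) : ℂ) * planeWave η y) y (V y) =
      ((fderiv ℝ A y (V y) / inner ℝ (V y) η ^ (m + 1) : ℝ) : ℂ) * planeWave η y -
      (m + 1) * (((A y * inner ℝ (fderiv ℝ V y (V y)) η / inner ℝ (V y) η ^ (m + 2) : ℝ) : ℂ) *
        planeWave η y) -
      2 * Real.pi * Complex.I *
        (((A y / inner ℝ (V y) η ^ m : ℝ) : ℂ) * planeWave η y) := by
  by_cases hy : y ∈ tsupport A
  · have hq := h y hy
    have hd : DifferentiableAt ℝ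
        (fun y => ((A y / inner ℝ (V y) η ^ (m + 1) : ℝ) : ℂ) * planeWave η y) y := by
      have h1 : ContDiff ℝ 1 fun y => ((A y / inner ℝ (V y) η ^ (m + 1) : ℝ) : ℂ) :=
        Complex.ofRealCLM.contDiff.comp (contDiff_amplitude hV hA h (m + 1))
      exact (h1.mul (contDiff_planeWave η)).differentiable (by simp) y
    rw [← hd.lineDeriv_eq_fderiv]
    refine HasLineDerivAt.lineDeriv ?_
    have hl : HasDerivAt (fun t : ℝ => y + t • V y) (V y) 0 := by
      simpa using ((hasDerivAt_id (0 : ℝ)).smul_const (V y)).const_add y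
    have hA' : HasDerivAt (fun t : ℝ => A (y + t • V y)) (fderiv ℝ A y (V y)) 0 :=
      (hA.differentiable (by simp) y).hasFDerivAt.comp_hasDerivAt_of_eq 0 hl (by simp)
    have hV' : HasDerivAt (fun t : ℝ => V (y + t • V y)) (fderiv ℝ V y (V y)) 0 :=
      (hV.differentiable (by simp) y).hasFDerivAt.comp_hasDerivAt_of_eq 0 hl (by simp)
    have hq' : HasDerivAt (fun t : ℝ => inner ℝ (V (y + t • V y)) η)
        (inner ℝ (fderiv ℝ V y (V y)) η) 0 := by
      simpa using hV'.inner ℝ (hasDerivAt_const (0 : ℝ) η)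
    have hr := (hA'.fun_div (hq'.fun_pow (m + 1)) (by simpa using hq)).ofReal_comp
    have hw : HasDerivAt (fun t : ℝ => planeWave η (y + t • V y))
        (planeWave η y * (((-2 * Real.pi * inner ℝ (V y) η : ℝ) : ℂ) * Complex.I)) 0 := by
      have h1 : HasDerivAt (fun t : ℝ => -2 * Real.pi * inner ℝ (y + t • V y) η)
          (-2 * Real.pi * inner ℝ (V y) η) 0 := by
        simpa using (hl.inner ℝ (hasDerivAt_const (0 : ℝ) η)).const_mul (-2 * Real.pi)
      simpa [planeWave] using (h1.ofReal_comp.mul_const Complex.I).cexp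
    refine (hr.mul hw).congr_deriv ?_
    have hqc : ((inner ℝ (V y) η : ℝ) : ℂ) ≠ 0 := by exact_mod_cast hq
    simp only [zero_smul, add_zero]
    push_cast
    field_simp
    ring
  · have h0 : (fun y => ((A y / inner ℝ (V y) η ^ (m + 1) : ℝ) : ℂ) * planeWave η y) =ᶠ[nhds y]
        fun _ => 0 := by
      filter_upwards [(isClosed_tsupport A).isOpen_compl.mem_nhds hy] with z hz
      simp [image_eq_zero_of_notMem_tsupport hz]
    have hA0 : fderiv ℝ A y = 0 :=
      Function.notMem_support.mp fun h => hy (support_fderiv_subset ℝ h)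
    rw [h0.fderiv_eq, hA0, image_eq_zero_of_notMem_tsupport hy]
    simp

lemma contDiff_fderiv_apply {F : Type*} [NormedAddCommGroup F] [NormedSpace ℝ F] {b : Plane → F}
    (hb : ContDiff ℝ ∞ b) (hV : ContDiff ℝ ∞ V) : ContDiff ℝ ∞ fun y => fderiv ℝ b y (V y) :=
  (hb.fderiv_right (m := ∞) le_rfl).clm_apply hV

lemma tsupport_fderiv_apply_subset : tsupport (fun y => fderiv ℝ A y (V y)) ⊆ tsupport A := by
  refine closure_minimal (fun y hy => ?_) (isClosed_tsupport A)
  by_contra hn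
  refine hy ?_
  change fderiv ℝ A y (V y) = 0
  rw [Function.notMem_support.mp fun h => hn (support_fderiv_subset ℝ h)]
  rfl

lemma inner_eq_add (v w : Plane) : inner ℝ v w = v 0 * w 0 + v 1 * w 1 := by
  simp [PiLp.inner_apply, Fin.sum_univ_two, mul_comm]

variable {g : Plane → ℝ}

lemma integral_linear_combination {μ : Measure Plane} {F F₀ F₁ F₂ : Plane → ℂ}
    (h : Integrable F μ) (h₀ : Integrable F₀ μ) (h₁ : Integrable F₁ μ) (h₂ : Integrable F₂ μ)
    (a b c d : ℂ) : ∫ y, F y - a * (b * F₀ y + c * F₁ y) - d * F₂ y ∂μ =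
      ∫ y, F y ∂μ - a * (b * ∫ y, F₀ y ∂μ + c * ∫ y, F₁ y ∂μ) - d * ∫ y, F₂ y ∂μ := by
  have j₁ : Integrable (fun y => b * F₀ y + c * F₁ y) μ := (h₀.const_mul b).add (h₁.const_mul c)
  have j₂ : Integrable (fun y => F y - a * (b * F₀ y + c * F₁ y)) μ := h.sub (j₁.const_mul a)
  rw [integral_sub j₂ (h₂.const_mul d), integral_sub h (j₁.const_mul a), integral_const_mul,
    integral_const_mul, integral_add (h₀.const_mul b) (h₁.const_mul c), integral_const_mul,
    integral_const_mul]

/-- Integration by parts along a divergence-free field tangent to the level sets of `g`. -/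
lemma oscIntegral_eq (hV : ContDiff ℝ ∞ V)
    (hdiv : ∀ y, fderiv ℝ (fun z => V z 0) y (EuclideanSpace.single 0 1) +
      fderiv ℝ (fun z => V z 1) y (EuclideanSpace.single 1 1) = 0)
    (hg : ContDiff ℝ ∞ g) (hgV : ∀ y, fderiv ℝ g y (V y) = 0)
    (hA : ContDiff ℝ ∞ A) (hAc : HasCompactSupport A)
    (h : ∀ y ∈ tsupport A, inner ℝ (V y) η ≠ 0) (m : ℕ) :
    2 * Real.pi * Complex.I * oscIntegral g V A m η =
      oscIntegral g V (fun y => fderiv ℝ A y (V y)) (m + 1) η -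
      (m + 1) * ((η 0 : ℂ) * oscIntegral g V (fun y => A y * fderiv ℝ V y (V y) 0) (m + 2) η +
        (η 1 : ℂ) * oscIntegral g V (fun y => A y * fderiv ℝ V y (V y) 1) (m + 2) η) := by
  have hVV := contDiff_fderiv_apply hV hV
  have hVi : ∀ i : Fin 2, ContDiff ℝ ∞ fun y => A y * fderiv ℝ V y (V y) i := fun i =>
    hA.mul ((EuclideanSpace.proj (𝕜 := ℝ) i).contDiff.comp hVV)
  have hs : ∀ i : Fin 2, tsupport (fun y => A y * fderiv ℝ V y (V y) i) ⊆ tsupport A := fun i =>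
    closure_mono (Function.support_mul_subset_left _ _)
  have i1 := integrable_amplitude_mul_planeWave (η := η) hV (contDiff_fderiv_apply hA hV)
    (hAc.of_isClosed_subset (isClosed_tsupport _) tsupport_fderiv_apply_subset)
    (fun y hy => h y (tsupport_fderiv_apply_subset hy)) (m + 1)
  have i2 : ∀ i : Fin 2, _ := fun i => integrable_amplitude_mul_planeWave (η := η) hV (hVi i)
    (hAc.of_isClosed_subset (isClosed_tsupport _) (hs i)) (fun y hy => h y (hs i hy)) (m + 2)
  have i3 := integrable_amplitude_mul_planeWave hV hA hAc h m
  have hb : ContDiff ℝ 1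
      fun y => ((A y / inner ℝ (V y) η ^ (m + 1) : ℝ) : ℂ) * planeWave η y := by
    have h1 : ContDiff ℝ 1 fun y => ((A y / inner ℝ (V y) η ^ (m + 1) : ℝ) : ℂ) :=
      Complex.ofRealCLM.contDiff.comp (contDiff_amplitude hV hA h (m + 1))
    exact h1.mul (contDiff_planeWave η)
  have hbc : HasCompactSupport
      fun y => ((A y / inner ℝ (V y) η ^ (m + 1) : ℝ) : ℂ) * planeWave η y := by
    refine hAc.mono fun y hy => ?_
    contrapose! hy
    simp [Function.notMem_support.mp hy]
  have hzero := setIntegral_fderiv_apply_eq_zero hV hdiv hg hgV hb hbc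
  -- The inner product with `η` is expanded in coordinates, so that the new amplitudes do not depend
  -- on `η` and the recursion can be iterated.
  have hsplit : ∀ y, _ = _ := fun y =>
    (fderiv_amplitude_mul_planeWave hV hA h m y).trans
      (b := _) (c := ((fderiv ℝ A y (V y) / inner ℝ (V y) η ^ (m + 1) : ℝ) : ℂ) * planeWave η y -
      ((m : ℂ) + 1) * ((η 0 : ℂ) *
      (((A y * fderiv ℝ V y (V y) 0 / inner ℝ (V y) η ^ (m + 2) : ℝ) : ℂ) * planeWave η y) +
      (η 1 : ℂ) * (((A y * fderiv ℝ V y (V y) 1 / inner ℝ (V y) η ^ (m + 2) : ℝ) : ℂ) *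
        planeWave η y)) -
      2 * Real.pi * Complex.I * (((A y / inner ℝ (V y) η ^ m : ℝ) : ℂ) * planeWave η y)) (by
        rw [inner_eq_add (fderiv ℝ V y (V y))]
        push_cast
        ring)
  rw [integral_congr_ae (.of_forall hsplit), integral_linear_combination i1.restrict
    (i2 0).restrict (i2 1).restrict i3.restrict] at hzero
  exact (sub_eq_zero.mp hzero).symm

/-- Non-stationary phase by induction on `N`, over all amplitudes and exponents. One integration by
parts gives a term with exponent `m + 1` and terms with exponent `m + 2` carrying a factor `η i`;
each gains one power of `‖η‖`. -/
lemma oscIntegral_decay (hV : ContDiff ℝ ∞ V)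
    (hdiv : ∀ y, fderiv ℝ (fun z => V z 0) y (EuclideanSpace.single 0 1) +
      fderiv ℝ (fun z => V z 1) y (EuclideanSpace.single 1 1) = 0)
    (hg : ContDiff ℝ ∞ g) (hgV : ∀ y, fderiv ℝ g y (V y) = 0)
    {Γ : Set Plane} (hΓ : ∀ η ∈ Γ, η ≠ 0) {c : ℝ} (hc : 0 < c)
    (hB : ∀ y ∈ B, ∀ η ∈ Γ, c * ‖η‖ ≤ |inner ℝ (V y) η|) (N : ℕ) :
    ∀ (A : Plane → ℝ) (m : ℕ), ContDiff ℝ ∞ A → HasCompactSupport A → tsupport A ⊆ B →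
      ∃ C, ∀ η ∈ Γ, ‖oscIntegral g V A m η‖ * ‖η‖ ^ (m + N) ≤ C := by
  have hne : ∀ y ∈ B, ∀ η ∈ Γ, inner ℝ (V y) η ≠ 0 := by
    intro y hy η hη h0
    have := hB y hy η hη
    rw [h0, abs_zero] at this
    have := mul_pos hc (norm_pos_iff.mpr (hΓ η hη))
    linarith
  induction N with
  | zero =>
    intro A m hA hAc hAB
    refine ⟨(∫ y, |A y|) / c ^ m, fun η hη => ?_⟩
    have hη0 := norm_pos_iff.mpr (hΓ η hη)
    have hAi : Integrable fun y => |A y| := by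
      simpa using (hA.continuous.integrable_of_hasCompactSupport hAc).abs
    have h1 : ‖oscIntegral g V A m η‖ ≤ ∫ y in {y | 0 < g y}, |A y| / (c * ‖η‖) ^ m := by
      refine norm_integral_le_of_norm_le (hAi.restrict.div_const _) (.of_forall fun y => ?_)
      rw [norm_mul, norm_planeWave, mul_one, Complex.norm_real, Real.norm_eq_abs, abs_div, abs_pow]
      by_cases hy : y ∈ tsupport A
      · have := hB y (hAB hy) η hη
        gcongr
      · simp [image_eq_zero_of_notMem_tsupport hy]
    have h2 : ∫ y in {y | 0 < g y}, |A y| / (c * ‖η‖) ^ m ≤ (∫ y, |A y|) / (c * ‖η‖) ^ m := by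
      rw [integral_div]
      exact div_le_div_of_nonneg_right
        (setIntegral_le_integral hAi (.of_forall fun y => abs_nonneg _)) (by positivity)
    calc _ ≤ (∫ y, |A y|) / (c * ‖η‖) ^ m * ‖η‖ ^ (m + 0) := by
          gcongr
          exact h1.trans h2
      _ = _ := by
          rw [mul_pow, add_zero]
          field_simp
  | succ N ih =>
    intro A m hA hAc hAB
    have hVV := contDiff_fderiv_apply hV hV
    have hVi : ∀ i : Fin 2, ContDiff ℝ ∞ fun y => A y * fderiv ℝ V y (V y) i := fun i =>
      hA.mul ((EuclideanSpace.proj (𝕜 := ℝ) i).contDiff.comp hVV)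
    have hs : ∀ i : Fin 2, tsupport (fun y => A y * fderiv ℝ V y (V y) i) ⊆ tsupport A := fun i =>
      closure_mono (Function.support_mul_subset_left _ _)
    obtain ⟨C, hC⟩ := ih _ (m + 1) (contDiff_fderiv_apply hA hV)
      (hAc.of_isClosed_subset (isClosed_tsupport _) tsupport_fderiv_apply_subset)
      (tsupport_fderiv_apply_subset.trans hAB)
    choose D hD using fun i : Fin 2 => ih _ (m + 2) (hVi i)
      (hAc.of_isClosed_subset (isClosed_tsupport _) (hs i)) ((hs i).trans hAB)
    refine ⟨(C + (m + 1) * (D 0 + D 1)) / (2 * Real.pi), fun η hηΓ => ?_⟩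
    have heq := oscIntegral_eq hV hdiv hg hgV hA hAc (η := η)
      (fun y hy => hne y (hAB hy) η hηΓ) m
    have hη : ∀ i : Fin 2, ‖((η i : ℝ) : ℂ)‖ ≤ ‖η‖ := fun i => by
      rw [Complex.norm_real]
      exact PiLp.norm_apply_le η i
    rw [le_div_iff₀ (by positivity)]
    have h1 : ‖oscIntegral g V A m η‖ * (2 * Real.pi) =
        ‖2 * Real.pi * Complex.I * oscIntegral g V A m η‖ := by
      simp [abs_of_pos Real.pi_pos, mul_comm]
    have h2 : ∀ i : Fin 2, ‖((η i : ℝ) : ℂ) * oscIntegral g V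
        (fun y => A y * fderiv ℝ V y (V y) i) (m + 2) η‖ * ‖η‖ ^ (m + (N + 1)) ≤ D i := by
      intro i
      refine le_trans ?_ (hD i η hηΓ)
      rw [norm_mul]
      calc _ ≤ ‖η‖ * ‖oscIntegral g V (fun y => A y * fderiv ℝ V y (V y) i) (m + 2) η‖ *
            ‖η‖ ^ (m + (N + 1)) := by
            gcongr
            exact hη i
        _ = _ := by ring
    have h3 := hC η hηΓ
    rw [show m + 1 + N = m + (N + 1) by ring] at h3
    calc ‖oscIntegral g V A m η‖ * ‖η‖ ^ (m + (N + 1)) * (2 * Real.pi)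
        = ‖2 * Real.pi * Complex.I * oscIntegral g V A m η‖ * ‖η‖ ^ (m + (N + 1)) := by
          rw [← h1]
          ring
      _ ≤ (‖oscIntegral g V (fun y => fderiv ℝ A y (V y)) (m + 1) η‖ + (m + 1) *
          (‖(η 0 : ℂ) * oscIntegral g V (fun y => A y * fderiv ℝ V y (V y) 0) (m + 2) η‖ +
          ‖(η 1 : ℂ) * oscIntegral g V (fun y => A y * fderiv ℝ V y (V y) 1) (m + 2) η‖)) *
          ‖η‖ ^ (m + (N + 1)) := by
          rw [heq]
          gcongr
          refine (norm_sub_le _ _).trans (add_le_add le_rfl ?_)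
          rw [norm_mul]
          have : ‖(m : ℂ) + 1‖ = m + 1 := by exact_mod_cast Complex.norm_natCast (m + 1)
          rw [this]
          gcongr
          exact norm_add_le _ _
      _ ≤ C + (m + 1) * (D 0 + D 1) := by
          have := mul_le_mul_of_nonneg_left (add_le_add (h2 0) (h2 1))
            (by positivity : (0 : ℝ) ≤ m + 1)
          nlinarith [h3, this]

end Osc

/-! ### The product near a smooth boundary point -/

section SmoothBoundary

variable {Ω : Opens Plane} {f : TemperedOn Ω} {x : Plane} {G : Plane → ℝ} {B : Set Plane}

lemma mem_posSupp_of_pos (hG : ContDiff ℝ ∞ G) (hB : IsOpen B) (hBΩ : B ⊆ Ω)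
    (hf : ∀ φ : 𝓓(Ω, ℝ), tsupport φ ⊆ B → f.toDistribution φ = ∫ y, G y * φ y) {y : Plane}
    (hy : y ∈ B) (hGy : 0 < G y) : y ∈ interior (posSupp f) := by
  -- The unit ball forces Schwartz functions supported in `U` to be test functions, for which the
  -- integral formula is available.
  let U : Set Plane := (B ∩ {z | 0 < G z}) ∩ Metric.ball y 1
  have hU : IsOpen U := (hB.inter (isOpen_lt continuous_const hG.continuous)).inter
    Metric.isOpen_ball
  refine mem_interior.mpr ⟨U, fun z hz => subset_closure (Set.mem_sUnion.mpr
    ⟨U, ⟨hU, fun w hw => hBΩ hw.1.1, fun φ hφ0 hφU hφn => ?_⟩, hz⟩), hU, ⟨⟨hy, hGy⟩,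
    Metric.mem_ball_self one_pos⟩⟩
  have hc : HasCompactSupport (φ : 𝓢(Plane, ℝ)) :=
    (Metric.isBounded_ball.subset (hφU.trans Set.inter_subset_right)).isCompact_closure
      |>.of_isClosed_subset (isClosed_tsupport _) subset_closure
  let ψ : 𝓓(Ω, ℝ) := mkTest (φ : 𝓢(Plane, ℝ)) ((φ : 𝓢(Plane, ℝ)).smooth ⊤) hc
    (fun z hz => hBΩ (hφU hz).1.1)
  have h1 : f φ = ∫ z, G z * (φ : 𝓢(Plane, ℝ)) z := by
    exact hf ψ (fun z hz => (hφU hz).1.1)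
  rw [h1]
  obtain ⟨z, hz⟩ : ∃ z, (φ : 𝓢(Plane, ℝ)) z ≠ 0 := by
    by_contra! h
    exact hφ0 (Subtype.ext (SchwartzMap.ext h))
  refine (hG.continuous.mul (φ : 𝓢(Plane, ℝ)).continuous)
    |>.integral_pos_of_hasCompactSupport_nonneg_nonzero hc.mul_left (fun w => ?_)
    (mul_ne_zero (hφU (subset_tsupport _ hz)).1.2.ne' hz)
  by_cases hw : w ∈ tsupport (φ : 𝓢(Plane, ℝ))
  · exact mul_nonneg (hφU hw).1.2.le (hφn w)
  · simp [image_eq_zero_of_notMem_tsupport hw]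

/-- Otherwise a bump inside both `{G < 0}` and a positivity set of `f` would be sent to a number
that is positive and nonpositive. -/
lemma notMem_posSupp_of_neg (hG : ContDiff ℝ ∞ G) (hB : IsOpen B)
    (hf : ∀ φ : 𝓓(Ω, ℝ), tsupport φ ⊆ B → f.toDistribution φ = ∫ y, G y * φ y) {y : Plane}
    (hy : y ∈ B) (hGy : G y < 0) : y ∉ posSupp f := by
  intro hmem
  have hO : IsOpen (B ∩ {z | G z < 0}) := hB.inter (isOpen_lt hG.continuous continuous_const)
  obtain ⟨z, hzO, hzU⟩ := mem_closure_iff.mp hmem _ hO ⟨hy, hGy⟩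
  obtain ⟨U, ⟨hU, hUΩ, hpos⟩, hz⟩ := Set.mem_sUnion.mp hzU
  obtain ⟨ψ, hψ, V, -, hzV, -, hV⟩ := exists_cutoff_nhds (Ω := Ω) (hUΩ hz) (hU.inter hO) ⟨hz, hzO⟩
  -- Squaring makes the cut-off nonnegative.
  let χ : 𝓓(Ω, ℝ) := mulTest ψ ψ.contDiff ψ
  have hχ : tsupport χ ⊆ U ∩ (B ∩ {z | G z < 0}) := (tsupport_mulTest_subset _ _ _).trans hψ
  have hn : ∀ w, 0 ≤ χ w := fun w => mul_self_nonneg _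
  have h1 : 0 < f (testToSchwartz χ) := by
    refine hpos _ (fun h0 => ?_) (hχ.trans Set.inter_subset_left) hn
    have h2 : (testToSchwartz χ : 𝓢(Plane, ℝ)) z = 0 := by
      rw [h0]
      rfl
    rw [testToSchwartz_apply, mulTest_apply, hV z hzV] at h2
    norm_num at h2
  have h2 : f (testToSchwartz χ) = ∫ w, G w * χ w := hf χ (fun w hw => (hχ hw).2.1)
  rw [h2] at h1
  refine h1.not_ge (integral_nonpos fun w => ?_)
  by_cases hw : w ∈ tsupport χ
  · exact mul_nonpos_of_nonpos_of_nonneg (hχ hw).2.2.le (hn w)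
  · simp [image_eq_zero_of_notMem_tsupport hw]

/-- The sign of `G` decides membership in the positive support except on `{G = 0}`, where the
integrand vanishes anyway. At a frontier point both signs are excluded. -/
lemma exists_relu_eq_integral_max {κ : ℝ} (φm : Mollifier κ) (hκ : 0 < κ) {U : Set Plane}
    {g : Plane → ℝ} (hg : IsSmoothOn f.toDistribution U g) (hxU : x ∈ U)
    (hx : x ∈ frontier (posSupp f)) :
    ∃ (G : Plane → ℝ) (W : Set Plane), ContDiff ℝ ∞ G ∧ gradient G x = gradient g x ∧ G x = 0 ∧
      IsOpen W ∧ x ∈ W ∧ ∀ φ : 𝓓(Ω, ℝ), tsupport φ ⊆ W →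
        relu f φm φ = ∫ y, max (G y) 0 * (1 - theta f φm y) * φ y := by
  obtain ⟨G, B, hG, hB, hxB, hBU, hGg, hf⟩ := hg.exists_global hxU
  have hBΩ : B ⊆ Ω := hBU.trans hg.2.1
  obtain ⟨W, hW, hxW, hWB, hrelu⟩ := relu_locally_eq_integral φm hκ (hBΩ hxB) hG hB hxB hf
  refine ⟨G, W, hG, ?_, ?_, hW, hxW, fun φ hφ => ?_⟩
  · have : G =ᶠ[nhds x] g := Filter.eventuallyEq_of_mem (hB.mem_nhds hxB) hGg
    rw [gradient, gradient, this.fderiv_eq]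
  · rcases lt_trichotomy (G x) 0 with h | h | h
    · exact absurd (isClosed_closure.frontier_subset hx) (notMem_posSupp_of_neg hG hB hf hxB h)
    · exact h
    · exact absurd (mem_posSupp_of_pos hG hB hBΩ hf hxB h) hx.2
  · rw [hrelu φ hφ]
    congr 1
    ext y
    by_cases hy : y ∈ tsupport φ
    · have hyB := hWB (hφ hy)
      rcases lt_trichotomy (G y) 0 with h | h | h
      · rw [Set.indicator_of_notMem (notMem_posSupp_of_neg hG hB hf hyB h), max_eq_right h.le]
        ring
      · simp [h]
      · rw [Set.indicator_of_mem (interior_subset (mem_posSupp_of_pos hG hB hBΩ hf hyB h)),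
          max_eq_left h.le]
        ring
    · simp [image_eq_zero_of_notMem_tsupport hy]

end SmoothBoundary

/-! ### Microlocal regularity in directions other than the normal -/

section Regular

variable {Ω : Opens Plane} {T : 𝓓'(Ω, ℝ)} {x ξ : Plane} {G a : Plane → ℝ} {W : Set Plane}

/-- Near `x` and in a cone around `ξ` the rotated gradient pairs with `η` to at least `c‖η‖`, so
integration by parts along it gives decay of every order. -/
lemma isRegularDirectedPoint_of_eq_integral_max (hG : ContDiff ℝ ∞ G) (ha : ContDiff ℝ ∞ a)
    (hx : x ∈ Ω) (hW : IsOpen W) (hxW : x ∈ W)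
    (hT : ∀ φ : 𝓓(Ω, ℝ), tsupport φ ⊆ W → T φ = ∫ y, max (G y) 0 * a y * φ y)
    (hξ0 : ξ ≠ 0) (hξ : inner ℝ (rotatedGradient G x) ξ ≠ 0) (N : ℕ) :
    IsRegularDirectedPoint T N x ξ := by
  set V := rotatedGradient G with hVdef
  have hV : ContDiff ℝ ∞ V := contDiff_rotatedGradient hG
  -- The lower bound at `x` is `2c‖η‖`; moving to nearby `y` changes the field by less than `c` and
  -- costs half of it.
  obtain ⟨c, hc, hcξ⟩ : ∃ c, 0 < c ∧ 2 * c * ‖ξ‖ < |inner ℝ (V x) ξ| := by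
    have h1 := abs_pos.mpr hξ
    have h2 := norm_pos_iff.mpr hξ0
    refine ⟨|inner ℝ (V x) ξ| / (4 * ‖ξ‖), by positivity, ?_⟩
    field_simp
    linarith
  let B : Set Plane := W ∩ V ⁻¹' Metric.ball (V x) c
  have hB : IsOpen B := hW.inter (Metric.isOpen_ball.preimage hV.continuous)
  have hxB : x ∈ B := Set.mem_inter hxW (Set.mem_preimage.mpr (Metric.mem_ball_self hc))
  let Γ : Set Plane := {η | 2 * c * ‖η‖ < |inner ℝ (V x) η|}
  have hΓ : IsOpen Γ := isOpen_lt (by fun_prop) (by fun_prop)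
  have hΓ0 : ∀ η ∈ Γ, η ≠ 0 := by
    rintro η hη rfl
    simp [Γ] at hη
  have hcone : ∀ t : ℝ, 0 < t → ∀ η ∈ Γ, t • η ∈ Γ := by
    intro t ht η hη
    change 2 * c * ‖t • η‖ < |inner ℝ (V x) (t • η)|
    rw [norm_smul, inner_smul_right, abs_mul, Real.norm_of_nonneg ht.le, abs_of_pos ht]
    have : 2 * c * ‖η‖ < |inner ℝ (V x) η| := hη
    nlinarith
  have hBΓ : ∀ y ∈ B, ∀ η ∈ Γ, c * ‖η‖ ≤ |inner ℝ (V y) η| := by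
    intro y hy η hη
    have h1 : 2 * c * ‖η‖ < |inner ℝ (V x) η| := hη
    have h2 : |inner ℝ (V x - V y) η| ≤ c * ‖η‖ := by
      refine (abs_real_inner_le_norm _ _).trans ?_
      have : ‖V y - V x‖ < c := by simpa [dist_eq_norm] using hy.2
      rw [norm_sub_rev]
      gcongr
    rw [inner_sub_left] at h2
    have h3 := abs_sub_abs_le_abs_sub (inner ℝ (V x) η) (inner ℝ (V y) η)
    linarith
  obtain ⟨ψ, hψB, V', -, hxV', -, hψ⟩ := exists_cutoff_nhds (Ω := Ω) hx hB hxB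
  have hA : ContDiff ℝ ∞ fun y => G y * a y * ψ y := (hG.mul ha).mul ψ.contDiff
  have hAc : HasCompactSupport fun y => G y * a y * ψ y :=
    HasCompactSupport.mul_left (f := fun y => G y * a y) ψ.hasCompactSupport
  have hAB : tsupport (fun y => G y * a y * ψ y) ⊆ B :=
    (closure_mono (Function.support_mul_subset_right _ _)).trans hψB
  have hdecay := fun n => oscIntegral_decay hV (div_rotatedGradient hG) hG
    (fderiv_rotatedGradient_eq_zero G) hΓ0 hc hBΓ n _ 0 hA hAc hAB
  obtain ⟨C₀, hC₀⟩ := hdecay 0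
  obtain ⟨C₁, hC₁⟩ := hdecay N
  have heq : ∀ η, localFourier T ψ η = oscIntegral G V (fun y => G y * a y * ψ y) 0 η := by
    intro η
    have hcont : Continuous fun y => max (G y) 0 * a y * ψ y :=
      ((hG.continuous.max continuous_const).mul ha.continuous).mul ψ.continuous
    rw [localFourier_eq_fourier hT (hψB.trans Set.inter_subset_left)
      (hcont.integrable_of_hasCompactSupport ψ.hasCompactSupport.mul_left), Real.fourier_eq',
      oscIntegral, ← integral_indicator (isOpen_lt continuous_const hG.continuous).measurableSet]
    congr 1
    ext1 y
    by_cases hy : 0 < G y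
    · rw [Set.indicator_of_mem (by exact hy), max_eq_left hy.le, planeWave, smul_eq_mul, mul_comm]
      simp
    · rw [Set.indicator_of_notMem (by exact hy), max_eq_right (not_lt.mp hy)]
      simp
  refine ⟨Set.univ, isOpen_univ, trivial, Γ, hΓ, hcξ, hcone, ψ, Set.subset_univ _, hψ x hxV',
    2 ^ N * (|C₀| + |C₁|) + 1, by positivity, fun η hη => ?_⟩
  rw [le_div_iff₀ (by positivity), heq]
  have h0 := (hC₀ η hη).trans (le_abs_self _)
  have h1 := (hC₁ η hη).trans (le_abs_self _)
  simp only [add_zero, pow_zero, mul_one, zero_add] at h0 h1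
  have h2 : (1 + ‖η‖) ^ N ≤ 2 ^ N * (1 + ‖η‖ ^ N) := by
    have := add_pow_le (zero_le_one) (norm_nonneg η) N
    rw [one_pow] at this
    refine this.trans ?_
    gcongr
    · norm_num
    · omega
  calc _ ≤ ‖oscIntegral G V (fun y => G y * a y * ψ y) 0 η‖ * (2 ^ N * (1 + ‖η‖ ^ N)) := by gcongr
    _ = 2 ^ N * (‖oscIntegral G V (fun y => G y * a y * ψ y) 0 η‖ +
        ‖oscIntegral G V (fun y => G y * a y * ψ y) 0 η‖ * ‖η‖ ^ N) := by ring
    _ ≤ 2 ^ N * (|C₀| + |C₁|) := by gcongr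
    _ ≤ _ := by linarith

end Regular

/-! ### The normal directions at a smooth boundary point -/

section Kink

variable {Ω : Opens Plane} {T : 𝓓'(Ω, ℝ)} {x ξ : Plane} {N : ℕ}

lemma IsRegularDirectedPoint.neg (h : IsRegularDirectedPoint T N x ξ) :
    IsRegularDirectedPoint T N x (-ξ) := by
  obtain ⟨U, hU, hxU, V, hV, hξV, hcone, ψ, hψU, hψx, C, hC, hbd⟩ := h
  refine ⟨U, hU, hxU, -V, hV.neg, by simpa, fun t ht η hη => ?_, ψ, hψU, hψx, C, hC,
    fun η hη => ?_⟩
  · rw [Set.mem_neg, ← smul_neg]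
    exact hcone t ht _ hη
  · have h := hbd (-η) hη
    rwa [localFourier_neg, RCLike.norm_conj, norm_neg] at h

/-- Compactness of the circle: finitely many cones and the intersection of their neighbourhoods
suffice. -/
lemma exists_norm_localFourier_mul_le (h : ∀ ξ, ‖ξ‖ = 1 → IsRegularDirectedPoint T N x ξ) :
    ∃ W, IsOpen W ∧ x ∈ W ∧ ∀ φ : 𝓓(Ω, ℝ), tsupport φ ⊆ W →
      ∃ C, ∀ η, (1 + ‖η‖) ^ N * ‖localFourier T φ η‖ ≤ C := by
  let Q : Set Plane → Prop := fun S => ∃ W, IsOpen W ∧ x ∈ W ∧ ∀ φ : 𝓓(Ω, ℝ), tsupport φ ⊆ W →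
    ∃ C, ∀ η, η ≠ 0 → ‖η‖⁻¹ • η ∈ S → (1 + ‖η‖) ^ N * ‖localFourier T φ η‖ ≤ C
  have hQ : Q (Metric.sphere 0 1) := by
    refine (isCompact_sphere (0 : Plane) 1).induction_on (p := Q) ?_ ?_ ?_ ?_
    · exact ⟨Set.univ, isOpen_univ, trivial, fun φ _ =>
        ⟨0, fun η _ h => absurd h (Set.notMem_empty _)⟩⟩
    · rintro S S' hSS' ⟨W, hW, hxW, h⟩
      refine ⟨W, hW, hxW, fun φ hφ => ?_⟩
      obtain ⟨C, hb⟩ := h φ hφ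
      exact ⟨C, fun η hη hS => hb η hη (hSS' hS)⟩
    · rintro S S' ⟨W, hW, hxW, h⟩ ⟨W', hW', hxW', h'⟩
      refine ⟨W ∩ W', hW.inter hW', ⟨hxW, hxW'⟩, fun φ hφ => ?_⟩
      obtain ⟨C, hb⟩ := h φ (hφ.trans Set.inter_subset_left)
      obtain ⟨C', hb'⟩ := h' φ (hφ.trans Set.inter_subset_right)
      refine ⟨max C C', fun η hη hS => ?_⟩
      rcases hS with hS | hS
      · exact (hb η hη hS).trans (le_max_left _ _)
      · exact (hb' η hη hS).trans (le_max_right _ _)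
    · intro ξ hξ
      have hξ1 : ‖ξ‖ = 1 := by simpa using hξ
      obtain ⟨W, V, hW, hxW, hV, hdec⟩ := (h ξ hξ1).exists_coneDecayOn hξ1
      refine ⟨V, mem_nhdsWithin_of_mem_nhds (hV.1.mem_nhds hV.2.1), W, hW, hxW, fun φ hφ => ?_⟩
      obtain ⟨C, P, hC, hb⟩ := hdec φ hφ
      refine ⟨C, fun η hη hηV => ?_⟩
      have hηV' : η ∈ V := by
        have := hV.2.2 ‖η‖ (norm_pos_iff.mpr hη) _ hηV
        rwa [smul_inv_smul₀ (norm_ne_zero_iff.mpr hη)] at this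
      have h1 := hb η hηV' 0
      rwa [sub_zero, norm_zero, add_zero, one_pow, mul_one, mul_comm] at h1
  obtain ⟨W, hW, hxW, h⟩ := hQ
  refine ⟨W, hW, hxW, fun φ hφ => ?_⟩
  obtain ⟨C, hC⟩ := h φ hφ
  refine ⟨max C ‖localFourier T φ 0‖, fun η => ?_⟩
  by_cases hη : η = 0
  · subst hη
    simp
  · refine (hC η hη ?_).trans (le_max_left _ _)
    simp [norm_smul, hη]

/-- One power of `‖η‖` is spent on the derivative and three on integrability in the plane. -/
lemma differentiable_of_fourier_decay {h : Plane → ℝ} (hc : Continuous h) (hs : HasCompactSupport h)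
    {C : ℝ} (hd : ∀ η, (1 + ‖η‖) ^ 4 * ‖𝓕 (fun y => (h y : ℂ)) η‖ ≤ C) : Differentiable ℝ h := by
  have hcc : Continuous fun y => (h y : ℂ) := Complex.continuous_ofReal.comp hc
  have hi : Integrable fun y => (h y : ℂ) :=
    (hc.integrable_of_hasCompactSupport hs).ofReal
  have hF : Continuous (𝓕 fun y => (h y : ℂ)) :=
    VectorFourier.fourierIntegral_continuous Real.continuous_fourierChar
      (innerSL ℝ).continuous₂ hi
  have hFi : Integrable (𝓕 fun y => (h y : ℂ)) := by
    refine integrable_of_decay hF.aestronglyMeasurable (C := C) fun η => (hd η).trans' ?_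
    gcongr
    · simp
    · norm_num
  have hFi' : Integrable fun η : Plane => ‖η‖ * ‖𝓕 (fun y => (h y : ℂ)) η‖ := by
    have := integrable_of_decay (u := fun η => ((‖η‖ : ℝ) : ℂ) * 𝓕 (fun y => (h y : ℂ)) η)
      (by fun_prop) (C := C) fun η => (hd η).trans' ?_
    · simpa using this.norm
    · rw [norm_mul, Complex.norm_real, norm_norm]
      calc _ = (1 + ‖η‖) ^ 3 * ‖η‖ * ‖𝓕 (fun y => (h y : ℂ)) η‖ := by ring
        _ ≤ (1 + ‖η‖) ^ 3 * (1 + ‖η‖) * ‖𝓕 (fun y => (h y : ℂ)) η‖ := by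
          gcongr
          linarith
        _ = _ := by ring
  have hdiff := Real.differentiable_fourier hFi hFi'
  have heq : ∀ y, h y = Complex.reCLM (𝓕 (𝓕 fun y => (h y : ℂ)) (-y)) := by
    intro y
    rw [← Real.fourierInv_eq_fourier_neg, hcc.fourierInv_fourier_eq hi hFi]
    simp
  rw [funext heq]
  exact Complex.reCLM.differentiable.comp (hdiff.comp differentiable_id.neg)

/-- Both `max (G, 0)` and `max (G, 0) - G` have a minimum at `x`; if differentiable, both would have
vanishing derivative, and so would `G`. -/
lemma not_differentiableAt_max_zero {G : Plane → ℝ} (hG : DifferentiableAt ℝ G x) (hx : G x = 0)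
    (hG' : fderiv ℝ G x ≠ 0) : ¬ DifferentiableAt ℝ (fun y => max (G y) 0) x := by
  intro hd
  have h1 : IsLocalMin (fun y => max (G y) 0) x := .of_forall fun y => by simp [hx]
  have h2 : IsLocalMin (fun y => max (G y) 0 - G y) x := .of_forall fun y => by simp [hx]
  have h3 := h2.fderiv_eq_zero
  rw [fderiv_fun_sub hd hG, h1.fderiv_eq_zero, zero_sub, neg_eq_zero] at h3
  exact hG' h3

lemma eq_or_eq_neg_of_inner_rotatedGradient_eq_zero {G : Plane → ℝ}
    (hG : DifferentiableAt ℝ G x) (hG0 : gradient G x ≠ 0) (hξ : ‖ξ‖ = 1)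
    (h : inner ℝ (rotatedGradient G x) ξ = 0) :
    ξ = ‖gradient G x‖⁻¹ • gradient G x ∨ ξ = -(‖gradient G x‖⁻¹ • gradient G x) := by
  set v := gradient G x with hv
  have hvi : ∀ i : Fin 2, fderiv ℝ G x (EuclideanSpace.single i 1) = v i := by
    intro i
    have := hG.hasGradientAt.hasFDerivAt.fderiv
    rw [this, InnerProductSpace.toDual_apply_apply, ← hv, EuclideanSpace.inner_single_right]
    simp
  have hn : ∀ w : Plane, ‖w‖ ^ 2 = w 0 ^ 2 + w 1 ^ 2 := fun w => by
    simp [EuclideanSpace.norm_sq_eq]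
  rw [inner_eq_add] at h
  simp only [rotatedGradient, hvi, PiLp.toLp_apply, Matrix.cons_val_zero, Matrix.cons_val_one] at h
  have hv0 : 0 < ‖v‖ := norm_pos_iff.mpr hG0
  have hξ2 := hn ξ
  have hv2 := hn v
  rw [hξ] at hξ2
  set s := v 0 * ξ 0 + v 1 * ξ 1 with hs
  -- Lagrange's identity: the squares of the pairings of `ξ` with `v` and with the rotated `v` add
  -- up to `‖v‖²‖ξ‖²`.
  have hss : s ^ 2 = ‖v‖ ^ 2 := by
    rw [hv2]
    linear_combination (-(v 0 ^ 2 + v 1 ^ 2)) * hξ2 - (-v 1 * ξ 0 + v 0 * ξ 1) * h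
  have e0 : ‖v‖ ^ 2 * ξ 0 = s * v 0 := by
    rw [hv2]
    linear_combination (-v 1) * h
  have e1 : ‖v‖ ^ 2 * ξ 1 = s * v 1 := by
    rw [hv2]
    linear_combination (v 0) * h
  have hξs : ξ = (s / ‖v‖ ^ 2) • v := by
    ext i
    fin_cases i
    · simp only [Fin.zero_eta, PiLp.smul_apply, smul_eq_mul]
      field_simp
      linarith
    · simp only [Fin.mk_one, PiLp.smul_apply, smul_eq_mul]
      field_simp
      linarith
  rcases sq_eq_sq_iff_eq_or_eq_neg.mp hss with h | h
  · left
    rw [hξs, h]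
    congr 1
    field_simp
  · right
    rw [hξs, h, ← neg_smul]
    congr 1
    field_simp

/-- Regularity of order 4 at one normal passes to the opposite one by reality, and all other
directions are regular already. A cut-off of `max (G, 0) a` would then be differentiable, although
it equals `max (G, 0)` near `x`. -/
lemma not_isRegularDirectedPoint_normal {G a : Plane → ℝ} {W : Set Plane} (hG : ContDiff ℝ ∞ G)
    (ha : ContDiff ℝ ∞ a) (hx : x ∈ Ω) (hW : IsOpen W) (hxW : x ∈ W)
    (hT : ∀ φ : 𝓓(Ω, ℝ), tsupport φ ⊆ W → T φ = ∫ y, max (G y) 0 * a y * φ y)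
    (hGx : G x = 0) (hG0 : gradient G x ≠ 0) (ha1 : ∀ᶠ y in nhds x, a y = 1) :
    ¬ IsRegularDirectedPoint T 4 x (‖gradient G x‖⁻¹ • gradient G x) := by
  intro h
  have hd := hG.differentiable (by simp) x
  have hreg : ∀ ξ, ‖ξ‖ = 1 → IsRegularDirectedPoint T 4 x ξ := by
    intro ξ hξ
    by_cases hi : inner ℝ (rotatedGradient G x) ξ = 0
    · rcases eq_or_eq_neg_of_inner_rotatedGradient_eq_zero hd hG0 hξ hi with rfl | rfl
      · exact h
      · exact h.neg
    · exact isRegularDirectedPoint_of_eq_integral_max hG ha hx hW hxW hT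
        (norm_ne_zero_iff.mp (by simp [hξ])) hi 4
  obtain ⟨W', hW', hxW', hdec⟩ := exists_norm_localFourier_mul_le hreg
  obtain ⟨ψ, hψ, V, hV, hxV, -, hψ1⟩ := exists_cutoff_nhds (Ω := Ω) hx (hW.inter hW')
    (Set.mem_inter hxW hxW')
  obtain ⟨C, hC⟩ := hdec ψ (hψ.trans Set.inter_subset_right)
  have hc : Continuous fun y => max (G y) 0 * a y * ψ y :=
    ((hG.continuous.max continuous_const).mul ha.continuous).mul ψ.continuous
  have hs : HasCompactSupport fun y => max (G y) 0 * a y * ψ y :=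
    HasCompactSupport.mul_left (f := fun y => max (G y) 0 * a y) ψ.hasCompactSupport
  simp_rw [localFourier_eq_fourier hT (hψ.trans Set.inter_subset_left)
    (hc.integrable_of_hasCompactSupport hs)] at hC
  refine not_differentiableAt_max_zero hd hGx (fun h0 => hG0 ?_)
    ((differentiable_of_fourier_decay hc hs hC x).congr_of_eventuallyEq ?_)
  · rw [gradient, h0, map_zero]
  · filter_upwards [ha1, hV.mem_nhds hxV] with y hy hyV
    rw [hy, hψ1 y hyV, mul_one, mul_one]

end Kink

/-! ### The fibre of the wavefront set over points of `R_f`. -/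

section Normal

variable {Ω : Opens Plane} {f : TemperedOn Ω} {κ : ℝ} (φm : Mollifier κ) {x v : Plane}

lemma eq_or_eq_neg_of_mem_WF_relu (hκ : 0 < κ) (hx : x ∈ frontier (posSupp f))
    (hv : HasGradAt f.toDistribution x v) (hv0 : v ≠ 0) {ξ : Plane}
    (h : (x, ξ) ∈ WF (relu f φm)) : ξ = ‖v‖⁻¹ • v ∨ ξ = -(‖v‖⁻¹ • v) := by
  obtain ⟨hxΩ, hξ⟩ := mem_WF_imp h
  obtain ⟨U, g, hg, hxU, rfl⟩ := hv
  obtain ⟨G, W, hG, hGg, -, hW, hxW, hrep⟩ := exists_relu_eq_integral_max φm hκ hg hxU hx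
  rw [← hGg] at hv0 ⊢
  refine eq_or_eq_neg_of_inner_rotatedGradient_eq_zero (hG.differentiable (by simp) x) hv0 hξ ?_
  by_contra hi
  refine (notMem_WF_iff hxΩ hξ).mpr (fun N => ?_) h
  exact isRegularDirectedPoint_of_eq_integral_max hG (contDiff_one_sub_theta f φm) hxΩ hW hxW hrep
    (norm_ne_zero_iff.mp (by simp [hξ])) hi N

lemma mem_WF_relu_of_hasGradAt (hκ : 0 < κ) (hxΩ : x ∈ Ω) (hx : x ∈ frontier (posSupp f))
    (hxe : x ∉ exceptionalSet f (3 * κ)) (hv : HasGradAt f.toDistribution x v) (hv0 : v ≠ 0)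
    {ξ : Plane} (hξ : ξ = ‖v‖⁻¹ • v ∨ ξ = -(‖v‖⁻¹ • v)) : (x, ξ) ∈ WF (relu f φm) := by
  have hn : ‖‖v‖⁻¹ • v‖ = 1 := norm_smul_inv_norm hv0
  have hξ1 : ‖ξ‖ = 1 := by
    rcases hξ with rfl | rfl
    · exact hn
    · rwa [norm_neg]
  obtain ⟨U, g, hg, hxU, rfl⟩ := hv
  obtain ⟨G, W, hG, hGg, hGx, hW, hxW, hrep⟩ := exists_relu_eq_integral_max φm hκ hg hxU hx
  rw [← hGg] at hv0 hξ
  by_contra hcon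
  have hreg := (notMem_WF_iff hxΩ hξ1).mp hcon 4
  refine not_isRegularDirectedPoint_normal hG (contDiff_one_sub_theta f φm) hxΩ hW hxW hrep hGx hv0
    ?_ ?_
  · filter_upwards [Metric.ball_mem_nhds x hκ] with y hy
    rw [theta_eq_zero f φm hxe y hy, sub_zero]
  · rcases hξ with rfl | rfl
    · exact hreg
    · simpa using hreg.neg

end Normal

end MicroReLU

theorem mainTheorem1 (Ω : Opens Plane) (f : TemperedOn Ω) (κ : ℝ) (hκ : 0 < κ)
    (φ : Mollifier κ) :
    (∃! w : 𝓓'(Ω, ℝ), IsProduct (heaviside f) (damped f φ) w) ∧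
    IsProduct (heaviside f) (damped f φ) (relu f φ) ∧
    WF (relu f φ) ∩ (exceptionalSet f (3 * κ) ×ˢ Metric.sphere (0 : Plane) 1)ᶜ =
      (partA f ∪ partR f ∪ partCS f φ) ∩
        (exceptionalSet f (3 * κ) ×ˢ Metric.sphere (0 : Plane) 1)ᶜ ∧
    WF (relu f φ) ∩ (exceptionalSet f (3 * κ) ×ˢ Metric.sphere (0 : Plane) 1) ⊆
      (partA f ∪ partR f ∪ partCS f φ) ∩
        (exceptionalSet f (3 * κ) ×ˢ Metric.sphere (0 : Plane) 1) ∧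
    WF (relu f φ) ⊆
      partA f ∪ partR f ∪
        ((criticalPart f ∪ singularPart f) ×ˢ Metric.sphere (0 : Plane) 1) := by
  -- This inclusion holds everywhere; only the reverse one needs `θ = 0` near the point, hence the
  -- removal of `X^{3κ}`.
  have h1 : WF (relu f φ) ⊆ partA f ∪ partR f ∪ partCS f φ := by
    rintro ⟨x, ξ⟩ h
    obtain ⟨hx, hξ⟩ := mem_WF_imp h
    have hξ' : ξ ∈ Metric.sphere (0 : Plane) 1 := by simpa using hξ
    by_cases hi : x ∈ interior (posSupp f)
    · exact Or.inl (Or.inl ⟨WF_relu_subset_of_mem_interior φ hκ hi h, hi, hξ'⟩)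
    have hfr : x ∈ frontier (posSupp f) :=
      ⟨subset_closure (mem_posSupp_of_mem_WF_relu φ hκ h), hi⟩
    by_cases hs : x ∈ singSupp f.toDistribution
    · exact Or.inr ⟨Or.inl ⟨hx, hfr, hs⟩, hξ', h⟩
    obtain ⟨U, g, hg, hxU⟩ : ∃ U g, IsSmoothOn f.toDistribution U g ∧ x ∈ U := by
      by_contra hn
      exact hs ⟨hx, hn⟩
    have hv : HasGradAt f.toDistribution x (gradient g x) := ⟨U, g, hg, hxU, rfl⟩
    by_cases hv0 : gradient g x = 0
    · rw [hv0] at hv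
      exact Or.inr ⟨Or.inr ⟨hx, hfr, hs, hv⟩, hξ', h⟩
    · exact Or.inl (Or.inr ⟨⟨hx, hfr, hs, _, hv, hv0⟩, _, hv,
        eq_or_eq_neg_of_mem_WF_relu φ hκ hfr hv hv0 h⟩)
  have h2 : ∀ p ∈ partA f ∪ partR f ∪ partCS f φ,
      p ∉ exceptionalSet f (3 * κ) ×ˢ Metric.sphere (0 : Plane) 1 → p ∈ WF (relu f φ) := by
    rintro ⟨x, ξ⟩ ((⟨hA, hi, hξ⟩ | ⟨⟨hx, hfr, -, w, hw, hw0⟩, v, hv, hξ⟩) | ⟨-, -, h⟩) hp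
    · exact mem_WF_relu_of_mem_interior φ hκ hi (fun he => hp ⟨he, hξ⟩) hA
    -- `regularPart` and `partR` each choose a gradient; uniqueness identifies them, so that `v ≠
    -- 0`.
    · obtain rfl : v = w := hv.unique hw
      refine mem_WF_relu_of_hasGradAt φ hκ hx hfr (fun he => hp ⟨he, ?_⟩) hv hw0 hξ
      have hn : ‖‖v‖⁻¹ • v‖ = 1 := norm_smul_inv_norm hw0
      rw [mem_sphere_zero_iff_norm]
      rcases hξ with hξ | hξ
      · exact (congrArg norm hξ).trans hn
      · exact (congrArg norm hξ).trans ((norm_neg _).trans hn)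
    · exact h
  refine ⟨?_, isProduct_relu f φ hκ, ?_, fun p hp => ⟨h1 hp.1, hp.2⟩, fun p hp => ?_⟩
  · obtain ⟨w, hw⟩ := exists_isProduct f φ hκ
    exact ⟨w, hw, fun w' hw' => hw'.unique hw (exists_goodOn f φ hκ)⟩
  · exact Set.Subset.antisymm (fun p hp => ⟨h1 hp.1, hp.2⟩) fun p hp => ⟨h2 p hp.1 hp.2, hp.2⟩
  · rcases h1 hp with h | ⟨h, hξ, -⟩
    · exact Or.inl h
    · exact Or.inr ⟨h.symm, hξ⟩
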